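/- Let $d\ge 1$, let $T_1,\dots,T_m$ be bijective linear maps of $\mathbb R^d$ with singular values $\sigma_1(T_i)\ge\dots\ge\sigma_d(T_i)$, and suppose that $\max_i\sigma_1(T_i)<\tfrac12$. For a linear map $S$ let $\varphi^t(S)=\sigma_1(S)\cdots\sigma_{\lfloor t\rfloor}(S)\,\sigma_{\lfloor t\rfloor+1}(S)^{t-\lfloor t\rfloor}$ if $0\le t\le d$, and $\varphi^t(S)=|\det S|^{t/d}$ if $t>d$. For a finite word $w=w_1\cdots w_k$ over $\{1,\dots,m\}$ write $T_w=T_{w_1}\circ\dots\circ T_{w_k}$. Suppose that there is $D\in(0,1)$ such that $$\varphi^t(T_{ww'})\ge D\,\varphi^t(T_w)\,\varphi^t(T_{w'})\qquad\text{for all finite words } w,w' \text{ and all } 0\le t\le d.$$ Let $(\ell_k)$ be a sequence of non-negative integers. For $j\in\{1,\dots,m\}^{\mathbb N}$ let $j|_n$ be the word of its first $n$ letters, let $\sigma$ be the left shift, and put $$R(j)=\{i\in\{1,\dots,m\}^{\mathbb N}:\ \sigma^k(i)|_{\ell_k}=j|_{\ell_k}\text{ for infinitely many }k\},\qquad P(s,j)=\lim_{k\to\infty}\frac1k\log\sum_{|w|=k}\varphi^s(T_{w\,j|_{\ell_k}}).$$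 For $a=(a_1,\dots,a_m)\in\mathbb R^{dm}$ let $f_i(x)=T_i(x)+a_i$ and $\pi(i)=\lim_{k\to\infty}f_{i_1}\circ\dots\circ f_{i_k}(0)$. Consider the limit $$\lim_{k\to\infty}\frac1k\log\varphi^s(T_{j|_{\ell_k}})\in[-\infty,0].\qquad(*)$$ (a) For every ergodic $\sigma$-invariant Borel probability measure $\mu$ on $\{1,\dots,m\}^{\mathbb N}$ there is a number $s_0$ such that for $\mu$-almost every $j$ the following holds: if the limit $(*)$ exists and is finite for some $s>0$, then $P(s,j)$ exists and is finite for every $s\ge0$, $s_0$ is the unique zero of $P(\cdot,j)$ in $[0,\infty)$, and for Lebesgue-almost every $a\in\mathbb R^{dm}$ the Hausdorff dimension of $\pi(R(j))$ equals $\min\{s_0,d\}$. (b) For every $j$ for which the limit $(*)$ exists and is finite for all $0<s\le d$, the limit $P(s,j)$ exists and is finite for every $s\ge0$, $P(\cdot,j)$ has a unique zero $s_0$ in $[0,\infty)$, and for Lebesgue-almost every $a\in\mathbb R^{dm}$ the Hausdorff dimension of $\pi(R(j))$ equals $\min\{s_0,d\}$. (c) For every $j$ for which the limit $(*)$ is $-\infty$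 for some $s>0$, one has $P(s,j)=-\infty$ for every $s>0$, and the Hausdorff dimension of $\pi(R(j))$ is $0$ for every $a\in\mathbb R^{dm}$. -/

import Mathlib

open Filter Topology MeasureTheory

namespace ShrinkingTargets

/-- The space `ℝ^d` with its Euclidean norm and Lebesgue measure. -/
abbrev Space (d : ℕ) : Type := EuclideanSpace ℝ (Fin d)

/-- The singular value function `φ^t`. For `0 ≤ t ≤ d` it is
`σ_1 ⋯ σ_⌊t⌋ σ_{⌊t⌋+1}^{t - ⌊t⌋}`; for `t > d` it is, as usual, `|det S|^{t/d}`.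
Mathlib indexes singular values from `0`, so `σ_{i+1}(S)` is `S.singularValues i`. -/
noncomputable def svf {d : ℕ} (t : ℝ) (S : Space d →ₗ[ℝ] Space d) : ℝ :=
  if t ≤ d then
    (∏ i ∈ Finset.range ⌊t⌋₊, S.singularValues i) * S.singularValues ⌊t⌋₊ ^ Int.fract t
  else |LinearMap.det S| ^ (t / d)

/-- `T_w = T_{w_1} ∘ ⋯ ∘ T_{w_k}` for a finite word `w` (the identity for the empty word). -/
noncomputable def wordMap {d m : ℕ} (T : Fin m → Space d →ₗ[ℝ] Space d) (w : List (Fin m)) :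
    Space d →ₗ[ℝ] Space d :=
  (w.map T).prod

/-- `f_w(x)` for a finite word `w`, where `f_w = f_{w_1} ∘ ⋯ ∘ f_{w_k}` and
`f_i(x) = T_i(x) + a_i`. -/
noncomputable def affineWord {d m : ℕ} (T : Fin m → Space d →ₗ[ℝ] Space d)
    (a : Fin m → Space d) (w : List (Fin m)) (x : Space d) : Space d :=
  w.foldr (fun i y => T i y + a i) x

/-- The truncation `j|_n` of an infinite sequence to its first `n` letters. -/
def trunc {m : ℕ} (j : ℕ → Fin m) (n : ℕ) : List (Fin m) :=
  List.ofFn (fun r : Fin n => j r)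

/-- The projection `π(i) = lim_k f_{i|_k}(0)` from the sequence space to `ℝ^d`. -/
noncomputable def proj {d m : ℕ} (T : Fin m → Space d →ₗ[ℝ] Space d)
    (a : Fin m → Space d) (i : ℕ → Fin m) : Space d :=
  limUnder atTop (fun k : ℕ => affineWord T a (trunc i k) 0)

/-- The left shift on the sequence space. -/
def shift {m : ℕ} (i : ℕ → Fin m) : ℕ → Fin m := fun n => i (n + 1)

/-- The symbolic recurring set
`R(j) = {i : σ^k(i)|_{ℓ_k} = j|_{ℓ_k} for infinitely many k}`. -/
def recurringSet {m : ℕ} (ℓ : ℕ → ℕ) (j : ℕ → Fin m) : Set (ℕ → Fin m) :=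
  {i | ∃ᶠ k in atTop, trunc (shift^[k] i) (ℓ k) = trunc j (ℓ k)}

/-- `(1/k) log φ^s(T_{j|_{ℓ_k}})`. -/
noncomputable def targetRate {d m : ℕ} (T : Fin m → Space d →ₗ[ℝ] Space d) (ℓ : ℕ → ℕ)
    (j : ℕ → Fin m) (s : ℝ) (k : ℕ) : ℝ :=
  (1 / (k : ℝ)) * Real.log (svf s (wordMap T (trunc j (ℓ k))))

/-- `(1/k) log ∑_{|i| = k} φ^s(T_{i j|_{ℓ_k}})`, whose limit in `k` is the modified
pressure `P(s, j)`. -/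
noncomputable def pressureSeq {d m : ℕ} (T : Fin m → Space d →ₗ[ℝ] Space d) (ℓ : ℕ → ℕ)
    (j : ℕ → Fin m) (s : ℝ) (k : ℕ) : ℝ :=
  (1 / (k : ℝ)) *
    Real.log (∑ i : Fin k → Fin m, svf s (wordMap T (List.ofFn i ++ trunc j (ℓ k))))

/-- The modified pressure `P(s, j)` exists as a finite limit for every `s ≥ 0`, and `s₀` is
its unique zero in `[0, ∞)`. -/
def IsUniquePressureZero {d m : ℕ} (T : Fin m → Space d →ₗ[ℝ] Space d) (ℓ : ℕ → ℕ)
    (j : ℕ → Fin m) (s₀ : ℝ) : Prop :=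
  0 ≤ s₀ ∧ ∃ P : ℝ → ℝ,
    (∀ s, 0 ≤ s → Tendsto (pressureSeq T ℓ j s) atTop (𝓝 (P s))) ∧
    (∀ s, 0 ≤ s → (P s = 0 ↔ s = s₀))

/-- For Lebesgue almost every `a ∈ ℝ^{dm}`, the Hausdorff dimension of the projected recurring
set `π(R(j))` is `δ`. -/
def AlmostEveryDimEq {d m : ℕ} (T : Fin m → Space d →ₗ[ℝ] Space d) (ℓ : ℕ → ℕ)
    (j : ℕ → Fin m) (δ : ℝ) : Prop :=
  ∀ᵐ a : Fin m → Space d, dimH (proj T a '' recurringSet ℓ j) = ENNReal.ofReal δ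

end ShrinkingTargets

/-! ### Singular bases and submultiplicativity of products of singular values. -/

namespace LinearMap

open Module

variable {E F U : Type*} [NormedAddCommGroup E] [InnerProductSpace ℝ E] [FiniteDimensional ℝ E]
  [NormedAddCommGroup F] [InnerProductSpace ℝ F] [FiniteDimensional ℝ F]
  [NormedAddCommGroup U] [InnerProductSpace ℝ U] [FiniteDimensional ℝ U]

/-! Singular value functions are submultiplicative under composition, and the hypothesis supplies
the reverse inequality up to D, so log φ^s(T_w) is almost additive under concatenation of words.
With Z_k(s) the sum of φ^s over words of length k, Fekete's lemma gives a limit P(s) of (1/k) log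
Z_k(s), and splitting off the target gives P(s, j) = P(s) + r(s), where r(s) is the limit (*). The
singular values of T_w lie between α^|w| and 2^(-|w|), and convergence of one rate with positive
exponent forces ℓ_k = O(k). Hence P(·, j) is Lipschitz and falls from log m ≥ 0 with slope at most
-log 2, so it has exactly one zero s₀ (`exists_unique_zero`).

Upper bound, for every a: for each K the cylinders of the words w j|_{ℓ_k} with |w| = k ≥ K cover
R(j). Their projections lie in ellipsoids, which are cut into pieces comparable to the singular
value of index ⌊s⌋ + 1, at total cost about φ^s. For s > s₀ these costs are summable, and their
tails tend to 0 (`dimH_image_recurringSet_le`).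

Lower bound, for almost every a: fix s below min(s₀, d). A measure on R(j) is built from independent
blocks, with weights proportional to φ^s on free stretches and with deterministic blocks spelling j
at sparse times. Positivity of P(s, j) says that a long free stretch gains more than the next target
costs, so a cylinder [w] has mass at most a constant times φ^s(T_w) (`exists_frostman_measure`).
Since the contraction ratios are below 1/2, π(i) - π(k) depends transversally on a
(`exists_transversality_const`). Integrating a potential over a and over the measure shows that it
is finite almost everywhere for each t < s, so the dimension is at least t (`ae_le_dimH`).

For (a), an almost additive version of Birkhoff's theorem gives log φ^t(T_{j|_n})/n a limit L(t),
the same for almost all j and valid for all t at once. As L(s) < 0 for s > 0, convergence of one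
rate amounts to convergence of ℓ_k/k to some q, a condition that does not mention j. Then P(t, j) =
P(t) + q L(t), and the zero is common to almost all j. For (c), log φ^t(T_w) is comparable to -|w|
for each t > 0, so divergence for one exponent is divergence for all, and the upper bound applies
for every s > 0. -/

/-- An orthonormal basis of right singular vectors. -/
def IsSingularBasis {n : ℕ} (T : E →ₗ[ℝ] F) (b : OrthonormalBasis (Fin n) ℝ E) : Prop :=
  ∀ i j, inner ℝ (T (b i)) (T (b j)) = if i = j then T.singularValues i ^ 2 else 0

theorem exists_isSingularBasis (T : E →ₗ[ℝ] F) {n : ℕ} (hn : finrank ℝ E = n) :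
    ∃ b : OrthonormalBasis (Fin n) ℝ E, T.IsSingularBasis b := by
  refine ⟨T.isSymmetric_adjoint_comp_self.eigenvectorBasis hn, fun i j => ?_⟩
  have h := T.isSymmetric_adjoint_comp_self.apply_eigenvectorBasis hn j
  rw [← LinearMap.adjoint_inner_right, ← LinearMap.comp_apply, h, inner_smul_right,
    OrthonormalBasis.inner_eq_ite, T.sq_singularValues_fin hn]
  split_ifs with hij
  · subst hij; simp
  · simp

theorem IsSingularBasis.norm_apply {n : ℕ} {T : E →ₗ[ℝ] F} {b : OrthonormalBasis (Fin n) ℝ E}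
    (hb : T.IsSingularBasis b) (i : Fin n) : ‖T (b i)‖ = T.singularValues i := by
  have h := hb i i
  rw [if_pos rfl, real_inner_self_eq_norm_sq] at h
  exact (sq_eq_sq₀ (norm_nonneg _) (T.singularValues_nonneg _)).1 h

theorem IsSingularBasis.norm_sq {n : ℕ} {T : E →ₗ[ℝ] F} {b : OrthonormalBasis (Fin n) ℝ E}
    (hb : T.IsSingularBasis b) (x : E) :
    ‖T x‖ ^ 2 = ∑ i : Fin n, (T.singularValues i * inner ℝ (b i) x) ^ 2 := by
  have hx : T x = ∑ i, inner ℝ (b i) x • T (b i) := by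
    conv_lhs => rw [← b.sum_repr' x]
    simp
  rw [← real_inner_self_eq_norm_sq, hx, sum_inner]
  refine Finset.sum_congr rfl fun i _ => ?_
  rw [inner_sum, Finset.sum_eq_single i]
  · rw [inner_smul_left, inner_smul_right, hb i i, if_pos rfl]
    simp; ring
  · intro j _ hj
    rw [inner_smul_left, inner_smul_right, hb i j, if_neg hj.symm]
    simp
  · simp

/-- Together with the next lemma this is the easy half of the min-max principle: T multiplies the
k-th singular coordinate by the k-th singular value, and these decrease in k. -/
theorem IsSingularBasis.norm_apply_le {n : ℕ} {T : E →ₗ[ℝ] F} {b : OrthonormalBasis (Fin n) ℝ E}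
    (hb : T.IsSingularBasis b) {i : ℕ} {x : E}
    (hx : ∀ k : Fin n, (k : ℕ) < i → inner ℝ (b k) x = 0) :
    ‖T x‖ ≤ T.singularValues i * ‖x‖ := by
  refine le_of_sq_le_sq ?_ (mul_nonneg (T.singularValues_nonneg _) (norm_nonneg _))
  rw [hb.norm_sq, mul_pow, ← b.sum_sq_inner_right, Finset.mul_sum]
  refine Finset.sum_le_sum fun k _ => ?_
  rw [mul_pow]
  by_cases hk : (k : ℕ) < i
  · simp [hx k hk]
  · exact mul_le_mul_of_nonneg_right (pow_le_pow_left₀ (T.singularValues_nonneg _)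
      (T.singularValues_antitone (not_lt.1 hk)) 2) (sq_nonneg _)

theorem IsSingularBasis.le_norm_apply {n : ℕ} {T : E →ₗ[ℝ] F} {b : OrthonormalBasis (Fin n) ℝ E}
    (hb : T.IsSingularBasis b) {i : ℕ} {x : E}
    (hx : ∀ k : Fin n, i < (k : ℕ) → inner ℝ (b k) x = 0) :
    T.singularValues i * ‖x‖ ≤ ‖T x‖ := by
  refine le_of_sq_le_sq ?_ (norm_nonneg _)
  rw [hb.norm_sq, mul_pow, ← b.sum_sq_inner_right, Finset.mul_sum]
  refine Finset.sum_le_sum fun k _ => ?_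
  rw [mul_pow]
  by_cases hk : i < (k : ℕ)
  · simp [hx k hk]
  · exact mul_le_mul_of_nonneg_right (pow_le_pow_left₀ (T.singularValues_nonneg _)
      (T.singularValues_antitone (not_lt.1 hk)) 2) (sq_nonneg _)

theorem norm_apply_le_singularValues_zero (T : E →ₗ[ℝ] F) (x : E) :
    ‖T x‖ ≤ T.singularValues 0 * ‖x‖ := by
  obtain ⟨b, hb⟩ := T.exists_isSingularBasis rfl
  exact hb.norm_apply_le (by simp)

theorem le_norm_apply_singularValues_last (T : E →ₗ[ℝ] F) (x : E) :
    T.singularValues (finrank ℝ E - 1) * ‖x‖ ≤ ‖T x‖ := by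
  obtain ⟨b, hb⟩ := T.exists_isSingularBasis rfl
  exact hb.le_norm_apply fun k hk => by have := k.2; omega

/-- Courant–Fischer by counting dimensions. The i conditions placing P x orthogonal to the leading
singular vectors of T, and the dim U - i - 1 conditions placing x in the span of the first i + 1
singular vectors of T ∘ P, have a common nonzero solution; there the two bounds meet. -/
theorem singularValues_comp_isometry_le (T : E →ₗ[ℝ] F) (P : U →ₗᵢ[ℝ] E) (i : ℕ) :
    (T ∘ₗ P.toLinearMap).singularValues i ≤ T.singularValues i := by
  rcases le_or_gt (finrank ℝ U) i with hi | hi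
  · rw [singularValues_of_finrank_le _ hi]; exact T.singularValues_nonneg i
  have hUE : finrank ℝ U ≤ finrank ℝ E := LinearMap.finrank_le_finrank_of_injective P.injective
  obtain ⟨b, hb⟩ := T.exists_isSingularBasis rfl
  obtain ⟨b', hb'⟩ := (T ∘ₗ P.toLinearMap).exists_isSingularBasis rfl
  let L : U →ₗ[ℝ] (Fin i → ℝ) × (Fin (finrank ℝ U - i - 1) → ℝ) :=
    LinearMap.prod
      (LinearMap.pi fun k => (innerₛₗ ℝ (b ⟨k, by omega⟩)) ∘ₗ P.toLinearMap)
      (LinearMap.pi fun k => innerₛₗ ℝ (b' ⟨i + 1 + k, by omega⟩))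
  have hker : LinearMap.ker L ≠ ⊥ := by
    apply LinearMap.ker_ne_bot_of_finrank_lt
    simp only [finrank_prod, finrank_fintype_fun_eq_card, Fintype.card_fin]
    omega
  obtain ⟨x, hx, hx0⟩ := (Submodule.ne_bot_iff _).1 hker
  have hx' : L x = 0 := hx
  have h1 : ∀ k : Fin (finrank ℝ E), (k : ℕ) < i → inner ℝ (b k) (P x) = 0 := fun k hk => by
    have := congrFun (congrArg Prod.fst hx') ⟨k, hk⟩
    simpa [L] using this
  have h2 : ∀ k : Fin (finrank ℝ U), i < (k : ℕ) → inner ℝ (b' k) x = 0 := fun k hk => by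
    have := congrFun (congrArg Prod.snd hx') ⟨k - i - 1, by omega⟩
    have e : (⟨i + 1 + (k - i - 1), by omega⟩ : Fin (finrank ℝ U)) = k := by
      ext; simp; omega
    simpa [L, e] using this
  have h3 := hb.norm_apply_le h1
  have h4 := hb'.le_norm_apply h2
  rw [P.norm_map] at h3
  exact le_of_mul_le_mul_right (h4.trans h3) (norm_pos_iff.2 hx0)

theorem abs_det_eq_prod_singularValues (T : E →ₗ[ℝ] E) :
    |LinearMap.det T| = ∏ i ∈ Finset.range (finrank ℝ E), T.singularValues i := by
  rw [← T.normDet_eq_prod_singularValues, T.normDet_eq_norm_det, Real.norm_eq_abs]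

theorem normDet_le_prod_singularValues (T : E →ₗ[ℝ] F) (P : U →ₗᵢ[ℝ] E) :
    (T ∘ₗ P.toLinearMap).normDet ≤ ∏ i ∈ Finset.range (finrank ℝ U), T.singularValues i := by
  rw [normDet_eq_prod_singularValues]
  exact Finset.prod_le_prod (fun i _ => singularValues_nonneg _ _)
    fun i _ => T.singularValues_comp_isometry_le P i

/-- The span of the first j singular vectors attains the bound of `normDet_le_prod_singularValues`:
the images of these vectors are orthogonal, so their Gram matrix is diagonal. -/
theorem exists_isometry_normDet_eq (T : E →ₗ[ℝ] F) {j : ℕ} (hj : j ≤ finrank ℝ E) :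
    ∃ P : EuclideanSpace ℝ (Fin j) →ₗᵢ[ℝ] E,
      (T ∘ₗ P.toLinearMap).normDet = ∏ i ∈ Finset.range j, T.singularValues i := by
  obtain ⟨b, hb⟩ := T.exists_isSingularBasis rfl
  let e := EuclideanSpace.basisFun (Fin j) ℝ
  let f : EuclideanSpace ℝ (Fin j) →ₗ[ℝ] E := e.toBasis.constr ℝ fun k => b (Fin.castLE hj k)
  have hf : ∀ k, f (e k) = b (Fin.castLE hj k) := fun k => by
    rw [← e.coe_toBasis]; exact e.toBasis.constr_basis ℝ _ k
  let P : EuclideanSpace ℝ (Fin j) →ₗᵢ[ℝ] E := f.isometryOfOrthonormal (v := e.toBasis)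
    (by rw [e.coe_toBasis]; exact e.orthonormal)
    (by
      have : (f ∘ e.toBasis) = fun k => b (Fin.castLE hj k) := by
        funext k; rw [Function.comp_apply, e.coe_toBasis, hf]
      rw [this]
      exact b.orthonormal.comp _ (Fin.castLE_injective hj))
  refine ⟨P, ?_⟩
  refine (sq_eq_sq₀ (normDet_nonneg _)
    (Finset.prod_nonneg fun i _ => T.singularValues_nonneg i)).1 ?_
  have h := (T ∘ₗ P.toLinearMap).normDet_sq_eq_det_gram e
  have hg : Matrix.gram ℝ (fun k => (T ∘ₗ P.toLinearMap) (e k)) =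
      Matrix.diagonal fun k : Fin j => T.singularValues k ^ 2 := by
    ext k l
    have hP : ∀ k, (T ∘ₗ P.toLinearMap) (e k) = T (b (Fin.castLE hj k)) := fun k => by
      rw [← hf k]; rfl
    rw [Matrix.gram_apply, hP, hP, hb, Matrix.diagonal_apply]
    simp [(Fin.castLE_injective hj).eq_iff]
  rw [hg, Matrix.det_diagonal] at h
  rw [RCLike.ofReal_real_eq_id] at h
  exact h.trans (by rw [← Finset.prod_pow, Finset.prod_range])

/-- On the j-plane where S ∘ T attains its product, volume distortion factors into that of T on the
plane and that of S on the image plane, and each factor is at most the product of the j largest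
singular values. Injectivity of T keeps the image j-dimensional. -/
theorem prod_singularValues_comp_le (S : F →ₗ[ℝ] U) (T : E →ₗ[ℝ] F)
    (hT : Function.Injective T) {j : ℕ} (hj : j ≤ finrank ℝ E) :
    ∏ i ∈ Finset.range j, (S ∘ₗ T).singularValues i ≤
      (∏ i ∈ Finset.range j, S.singularValues i) * ∏ i ∈ Finset.range j, T.singularValues i := by
  obtain ⟨P, hP⟩ := (S ∘ₗ T).exists_isometry_normDet_eq hj
  rw [← hP, LinearMap.comp_assoc, normDet_comp]
  have hinj : Function.Injective (T ∘ₗ P.toLinearMap) := hT.comp P.injective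
  have hr : finrank ℝ (LinearMap.range (T ∘ₗ P.toLinearMap)) = j := by
    rw [LinearMap.finrank_range_of_inj hinj, finrank_euclideanSpace_fin]
  have h1 := T.normDet_le_prod_singularValues P
  rw [finrank_euclideanSpace_fin] at h1
  have h2 := S.normDet_le_prod_singularValues
    (LinearMap.range (T ∘ₗ P.toLinearMap)).subtypeₗᵢ
  rw [hr] at h2
  exact mul_le_mul h2 h1 (normDet_nonneg _)
    (Finset.prod_nonneg fun i _ => S.singularValues_nonneg i)

end LinearMap

/-! ### The singular value function and its multiplicative structure. -/

namespace ShrinkingTargets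

open Module

variable {d m : ℕ}

/-- The product of the `j` largest singular values. -/
noncomputable def topProd (j : ℕ) (S : Space d →ₗ[ℝ] Space d) : ℝ :=
  ∏ i ∈ Finset.range j, S.singularValues i

theorem topProd_nonneg (j : ℕ) (S : Space d →ₗ[ℝ] Space d) : 0 ≤ topProd j S :=
  Finset.prod_nonneg fun i _ => S.singularValues_nonneg i

theorem singularValues_pos {S : Space d →ₗ[ℝ] Space d} (hS : Function.Injective S) {i : ℕ}
    (hi : i < d) : 0 < S.singularValues i :=
  S.injective_iff_forall_lt_finrank_singularValues_pos.1 hS i (by simpa using hi)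

theorem topProd_pos {S : Space d →ₗ[ℝ] Space d} (hS : Function.Injective S) {j : ℕ}
    (hj : j ≤ d) : 0 < topProd j S :=
  Finset.prod_pos fun _ hi => singularValues_pos hS ((Finset.mem_range.1 hi).trans_le hj)

theorem topProd_comp_le (S : Space d →ₗ[ℝ] Space d) {T : Space d →ₗ[ℝ] Space d}
    (hT : Function.Injective T) {j : ℕ} (hj : j ≤ d) :
    topProd j (S ∘ₗ T) ≤ topProd j S * topProd j T :=
  S.prod_singularValues_comp_le T hT (by simpa using hj)

theorem abs_det_eq_topProd (S : Space d →ₗ[ℝ] Space d) : |LinearMap.det S| = topProd d S := by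
  rw [S.abs_det_eq_prod_singularValues, finrank_euclideanSpace_fin, topProd]

theorem floor_lt_of_fract_ne_zero {t : ℝ} (ht : 0 ≤ t) (htd : t ≤ d) (hf : Int.fract t ≠ 0) :
    ⌊t⌋₊ < d := by
  rw [Nat.floor_lt ht]
  refine lt_of_le_of_ne htd fun h => hf ?_
  rw [h, Int.fract_natCast]

theorem natFloor_add_fract {t : ℝ} (ht : 0 ≤ t) : (⌊t⌋₊ : ℝ) + Int.fract t = t := by
  rw [natCast_floor_eq_intCast_floor ht, Int.floor_add_fract]

/-- A geometric mean of the values at the neighbouring integers, so inequalities in t reduce to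
integer exponents. At t = d the second product contains a singular value beyond the dimension and
vanishes, but its exponent is 0 and the factor is 1. -/
theorem svf_eq_topProd_rpow {S : Space d →ₗ[ℝ] Space d} (hS : Function.Injective S) {t : ℝ}
    (ht : 0 ≤ t) (htd : t ≤ d) :
    svf t S = topProd ⌊t⌋₊ S ^ (1 - Int.fract t) * topProd (⌊t⌋₊ + 1) S ^ Int.fract t := by
  rw [svf, if_pos htd]
  change topProd ⌊t⌋₊ S * _ = _
  by_cases hf : Int.fract t = 0
  · simp [hf]
  · have hk := floor_lt_of_fract_ne_zero ht htd hf
    rw [show topProd (⌊t⌋₊ + 1) S = topProd ⌊t⌋₊ S * S.singularValues ⌊t⌋₊ from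
      Finset.prod_range_succ _ _, Real.mul_rpow (topProd_nonneg _ _) (S.singularValues_nonneg _),
      ← mul_assoc, ← Real.rpow_add (topProd_pos hS hk.le), sub_add_cancel, Real.rpow_one]

theorem svf_natCast (S : Space d →ₗ[ℝ] Space d) {k : ℕ} (hk : k ≤ d) :
    svf (k : ℝ) S = topProd k S := by
  rw [svf, if_pos (by exact_mod_cast hk)]
  simp [topProd]

/-- The exponent of the `i`-th singular value in `φ^t`. -/
noncomputable def svWeight (d : ℕ) (t : ℝ) (i : ℕ) : ℝ :=
  if t ≤ d then max 0 (min 1 (t - i)) else t / d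

theorem svWeight_mono {t t' : ℝ} (hd : 0 < d) (h : t ≤ t') (i : ℕ) :
    svWeight d t i ≤ svWeight d t' i := by
  have hd' : (0 : ℝ) < d := by exact_mod_cast hd
  unfold svWeight
  split_ifs with h1 h2 h2
  · gcongr
  · have : 1 ≤ t' / d := (one_le_div hd').2 (not_le.1 h2).le
    exact max_le (by linarith) ((min_le_left _ _).trans this)
  · exact absurd (h.trans h2) h1
  · gcongr

theorem svWeight_of_lt {t : ℝ} (ht : 0 ≤ t) (htd : t ≤ d) {i : ℕ} (hi : i < ⌊t⌋₊) :
    svWeight d t i = 1 := by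
  have h : ((i + 1 : ℕ) : ℝ) ≤ t := (Nat.le_floor_iff ht).1 hi
  push_cast at h
  rw [svWeight, if_pos htd, min_eq_left (by linarith), max_eq_right zero_le_one]

theorem svWeight_floor {t : ℝ} (ht : 0 ≤ t) (htd : t ≤ d) :
    svWeight d t ⌊t⌋₊ = Int.fract t := by
  have h := natFloor_add_fract ht
  rw [svWeight, if_pos htd, show t - (⌊t⌋₊ : ℝ) = Int.fract t by linarith,
    min_eq_right (Int.fract_lt_one t).le, max_eq_right (Int.fract_nonneg t)]

theorem svWeight_of_gt {t : ℝ} (htd : t ≤ d) {i : ℕ} (hi : ⌊t⌋₊ < i) :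
    svWeight d t i = 0 := by
  have h : t < i := Nat.lt_of_floor_lt hi
  rw [svWeight, if_pos htd, max_eq_left]
  exact (min_le_right _ _).trans (by linarith)

/-- Because the weights have total t both below and above d, and increase with t, a uniform bound β
on the singular values turns into a factor β^(t' - t) when t is raised to t'. The two comparison
lemmas below rest on this. -/
theorem sum_svWeight (hd : 0 < d) {t : ℝ} (ht : 0 ≤ t) :
    ∑ i ∈ Finset.range d, svWeight d t i = t := by
  have hd' : (0 : ℝ) < d := by exact_mod_cast hd
  by_cases htd : t ≤ d
  · have key : ∑ i ∈ Finset.range ⌊t⌋₊, svWeight d t i = ⌊t⌋₊ := by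
      rw [Finset.sum_congr rfl fun i hi => svWeight_of_lt ht htd (Finset.mem_range.1 hi)]
      simp
    have hle : ⌊t⌋₊ ≤ d := Nat.floor_le_of_le htd
    rcases hle.lt_or_eq with hk | hk
    · rw [← Finset.sum_subset (Finset.range_subset_range.2 (Nat.succ_le_of_lt hk)),
        Finset.sum_range_succ, key, svWeight_floor ht htd, natFloor_add_fract ht]
      intro i _ hi
      exact svWeight_of_gt htd (by simpa [Nat.lt_succ_iff] using hi)
    · rw [hk] at key
      rw [key, ← hk]
      exact le_antisymm (Nat.floor_le ht) (by rw [hk]; exact htd)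
  · simp only [svWeight, if_neg htd, Finset.sum_const, Finset.card_range, nsmul_eq_mul]
    field_simp

theorem svf_eq_prod_rpow {S : Space d →ₗ[ℝ] Space d} {t : ℝ} (ht : 0 ≤ t) :
    svf t S = ∏ i ∈ Finset.range d, S.singularValues i ^ svWeight d t i := by
  by_cases htd : t ≤ d
  · have key : ∏ i ∈ Finset.range ⌊t⌋₊, S.singularValues i ^ svWeight d t i =
        ∏ i ∈ Finset.range ⌊t⌋₊, S.singularValues i :=
      Finset.prod_congr rfl fun i hi => by
        rw [svWeight_of_lt ht htd (Finset.mem_range.1 hi), Real.rpow_one]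
    rw [svf, if_pos htd]
    have hle : ⌊t⌋₊ ≤ d := Nat.floor_le_of_le htd
    rcases hle.lt_or_eq with hk | hk
    · rw [← Finset.prod_subset (Finset.range_subset_range.2 (Nat.succ_le_of_lt hk)),
        Finset.prod_range_succ, key, svWeight_floor ht htd]
      intro i _ hi
      rw [svWeight_of_gt htd (by simpa [Nat.lt_succ_iff] using hi), Real.rpow_zero]
    · have hf : Int.fract t = 0 := by
        by_contra h
        exact (floor_lt_of_fract_ne_zero ht htd h).ne hk
      rw [hf, Real.rpow_zero, mul_one, ← key, hk]
  · rw [svf, if_neg htd, abs_det_eq_topProd, topProd,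
      ← Real.finsetProd_rpow _ _ fun i _ => S.singularValues_nonneg i]
    simp [svWeight, htd]

theorem svf_pos {S : Space d →ₗ[ℝ] Space d} (hS : Function.Injective S) {t : ℝ} (ht : 0 ≤ t) :
    0 < svf t S := by
  rw [svf_eq_prod_rpow ht]
  exact Finset.prod_pos fun i hi =>
    Real.rpow_pos_of_pos (singularValues_pos hS (Finset.mem_range.1 hi)) _

theorem svf_le_rpow_mul (hd : 0 < d) {S : Space d →ₗ[ℝ] Space d} (hS : Function.Injective S)
    {β : ℝ} (hβ0 : 0 < β) (hβ : ∀ i < d, S.singularValues i ≤ β) {t t' : ℝ} (ht : 0 ≤ t)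
    (htt : t ≤ t') : svf t' S ≤ β ^ (t' - t) * svf t S := by
  rw [svf_eq_prod_rpow ht, svf_eq_prod_rpow (ht.trans htt),
    show t' - t = ∑ i ∈ Finset.range d, (svWeight d t' i - svWeight d t i) by
      rw [Finset.sum_sub_distrib, sum_svWeight hd ht, sum_svWeight hd (ht.trans htt)],
    Real.rpow_sum_of_pos hβ0, ← Finset.prod_mul_distrib]
  refine Finset.prod_le_prod (fun i _ => Real.rpow_nonneg (S.singularValues_nonneg i) _)
    fun i hi => ?_
  have hi := Finset.mem_range.1 hi
  have hσ := singularValues_pos hS hi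
  rw [show svWeight d t' i = (svWeight d t' i - svWeight d t i) + svWeight d t i by ring,
    Real.rpow_add hσ, add_sub_cancel_right]
  exact mul_le_mul_of_nonneg_right (Real.rpow_le_rpow hσ.le (hβ i hi)
    (sub_nonneg.2 (svWeight_mono hd htt i))) (Real.rpow_nonneg hσ.le _)

theorem rpow_mul_le_svf (hd : 0 < d) {S : Space d →ₗ[ℝ] Space d} (hS : Function.Injective S)
    {α : ℝ} (hα0 : 0 < α) (hα : ∀ i < d, α ≤ S.singularValues i) {t t' : ℝ} (ht : 0 ≤ t)
    (htt : t ≤ t') : α ^ (t' - t) * svf t S ≤ svf t' S := by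
  rw [svf_eq_prod_rpow ht, svf_eq_prod_rpow (ht.trans htt),
    show t' - t = ∑ i ∈ Finset.range d, (svWeight d t' i - svWeight d t i) by
      rw [Finset.sum_sub_distrib, sum_svWeight hd ht, sum_svWeight hd (ht.trans htt)],
    Real.rpow_sum_of_pos hα0, ← Finset.prod_mul_distrib]
  refine Finset.prod_le_prod (fun i _ => mul_nonneg (Real.rpow_nonneg hα0.le _)
    (Real.rpow_nonneg (S.singularValues_nonneg i) _)) fun i hi => ?_
  have hi := Finset.mem_range.1 hi
  have hσ := singularValues_pos hS hi
  rw [show S.singularValues i ^ svWeight d t' i = S.singularValues i ^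
      ((svWeight d t' i - svWeight d t i) + svWeight d t i) by congr 1; ring, Real.rpow_add hσ]
  exact mul_le_mul_of_nonneg_right (Real.rpow_le_rpow hα0.le (hα i hi)
    (sub_nonneg.2 (svWeight_mono hd htt i))) (Real.rpow_nonneg hσ.le _)

theorem svf_comp_le {S T : Space d →ₗ[ℝ] Space d} (hS : Function.Injective S)
    (hT : Function.Injective T) {t : ℝ} (ht : 0 ≤ t) :
    svf t (S ∘ₗ T) ≤ svf t S * svf t T := by
  have hST : Function.Injective (S ∘ₗ T) := hS.comp hT
  by_cases htd : t ≤ d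
  · have hk : ⌊t⌋₊ ≤ d := Nat.floor_le_of_le htd
    by_cases hf : Int.fract t = 0
    · simp only [svf, if_pos htd, hf, Real.rpow_zero, mul_one]
      exact topProd_comp_le S hT hk
    · have hk' := floor_lt_of_fract_ne_zero ht htd hf
      rw [svf_eq_topProd_rpow hST ht htd, svf_eq_topProd_rpow hS ht htd,
        svf_eq_topProd_rpow hT ht htd, mul_mul_mul_comm,
        ← Real.mul_rpow (topProd_nonneg _ _) (topProd_nonneg _ _),
        ← Real.mul_rpow (topProd_nonneg _ _) (topProd_nonneg _ _)]
      refine mul_le_mul (Real.rpow_le_rpow (topProd_nonneg _ _) (topProd_comp_le S hT hk)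
        (by linarith [Int.fract_lt_one t])) (Real.rpow_le_rpow (topProd_nonneg _ _)
        (topProd_comp_le S hT hk') (Int.fract_nonneg t)) (Real.rpow_nonneg (topProd_nonneg _ _) _)
        (Real.rpow_nonneg (mul_nonneg (topProd_nonneg _ _) (topProd_nonneg _ _)) _)
  · simp only [svf, if_neg htd, LinearMap.det_comp, abs_mul]
    rw [Real.mul_rpow (abs_nonneg _) (abs_nonneg _)]

theorem wordMap_append (T : Fin m → Space d →ₗ[ℝ] Space d) (w w' : List (Fin m)) :
    wordMap T (w ++ w') = wordMap T w ∘ₗ wordMap T w' := by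
  rw [wordMap, List.map_append, List.prod_append]; rfl

theorem wordMap_nil (T : Fin m → Space d →ₗ[ℝ] Space d) : wordMap T [] = LinearMap.id := by
  simp [wordMap]; rfl

theorem wordMap_cons (T : Fin m → Space d →ₗ[ℝ] Space d) (i : Fin m) (w : List (Fin m)) :
    wordMap T (i :: w) = T i ∘ₗ wordMap T w := by
  rw [wordMap, List.map_cons, List.prod_cons]; rfl

theorem wordMap_injective {T : Fin m → Space d →ₗ[ℝ] Space d}
    (hT : ∀ i, Function.Injective (T i)) (w : List (Fin m)) :
    Function.Injective (wordMap T w) := by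
  induction w with
  | nil => rw [wordMap_nil]; exact Function.injective_id
  | cons i w ih => rw [wordMap_cons]; exact (hT i).comp ih

theorem norm_wordMap_le {T : Fin m → Space d →ₗ[ℝ] Space d} {c : ℝ} (hc : 0 ≤ c)
    (hT : ∀ i x, ‖T i x‖ ≤ c * ‖x‖) (w : List (Fin m)) (x : Space d) :
    ‖wordMap T w x‖ ≤ c ^ w.length * ‖x‖ := by
  induction w with
  | nil => simp [wordMap_nil]
  | cons i w ih =>
    rw [wordMap_cons, LinearMap.comp_apply, List.length_cons, pow_succ', mul_assoc]
    exact (hT i _).trans (mul_le_mul_of_nonneg_left ih hc)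

theorem le_norm_wordMap {T : Fin m → Space d →ₗ[ℝ] Space d} {c : ℝ} (hc : 0 ≤ c)
    (hT : ∀ i x, c * ‖x‖ ≤ ‖T i x‖) (w : List (Fin m)) (x : Space d) :
    c ^ w.length * ‖x‖ ≤ ‖wordMap T w x‖ := by
  induction w with
  | nil => simp [wordMap_nil]
  | cons i w ih =>
    rw [wordMap_cons, LinearMap.comp_apply, List.length_cons, pow_succ', mul_assoc]
    exact (mul_le_mul_of_nonneg_left ih hc).trans (hT i _)

theorem singularValues_le_of_norm_le {S : Space d →ₗ[ℝ] Space d} {c : ℝ}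
    (hc : ∀ x, ‖S x‖ ≤ c * ‖x‖) {i : ℕ} (hi : i < d) : S.singularValues i ≤ c := by
  obtain ⟨b, hb⟩ := S.exists_isSingularBasis (finrank_euclideanSpace_fin (𝕜 := ℝ) (n := d))
  have h := hc (b ⟨i, hi⟩)
  rwa [hb.norm_apply, b.norm_eq_one, mul_one] at h

theorem le_singularValues_of_le_norm {S : Space d →ₗ[ℝ] Space d} {c : ℝ}
    (hc : ∀ x, c * ‖x‖ ≤ ‖S x‖) {i : ℕ} (hi : i < d) : c ≤ S.singularValues i := by
  obtain ⟨b, hb⟩ := S.exists_isSingularBasis (finrank_euclideanSpace_fin (𝕜 := ℝ) (n := d))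
  have h := hc (b ⟨i, hi⟩)
  rwa [hb.norm_apply, b.norm_eq_one, mul_one] at h

/-- A ratio strictly below 1/2 leaves the room that transversality needs. Choosing it from a left
neighbourhood of 1/2 avoids taking a maximum and covers m = 0. -/
theorem exists_contraction_bound {T : Fin m → Space d →ₗ[ℝ] Space d}
    (hhalf : ∀ i, (T i).singularValues 0 < 1 / 2) :
    ∃ c : ℝ, 0 < c ∧ c < 1 / 2 ∧ ∀ i x, ‖T i x‖ ≤ c * ‖x‖ := by
  have h1 : ∀ᶠ c : ℝ in 𝓝[<] (1 / 2), ∀ i, (T i).singularValues 0 < c :=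
    eventually_all.2 fun i =>
      (eventually_mem_set.2 (Ioo_mem_nhdsLT (hhalf i))).mono fun c hc => hc.1
  have h2 : ∀ᶠ c : ℝ in 𝓝[<] (1 / 2), c ∈ Set.Ioo (0 : ℝ) (1 / 2) :=
    Ioo_mem_nhdsLT (by norm_num)
  obtain ⟨c, hc1, hc2⟩ := (h1.and h2).exists
  exact ⟨c, hc2.1, hc2.2, fun i x => ((T i).norm_apply_le_singularValues_zero x).trans
    (mul_le_mul_of_nonneg_right (hc1 i).le (norm_nonneg x))⟩

theorem exists_expansion_bound (hd : 0 < d) {T : Fin m → Space d →ₗ[ℝ] Space d}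
    (hT : ∀ i, Function.Injective (T i)) :
    ∃ α : ℝ, 0 < α ∧ α < 1 ∧ ∀ i x, α * ‖x‖ ≤ ‖T i x‖ := by
  have h1 : ∀ᶠ c : ℝ in 𝓝[>] 0, ∀ i, c < (T i).singularValues (d - 1) :=
    eventually_all.2 fun i =>
      (eventually_mem_set.2 (Ioo_mem_nhdsGT
        (singularValues_pos (hT i) (Nat.sub_lt hd one_pos)))).mono fun c hc => hc.2
  have h2 : ∀ᶠ c : ℝ in 𝓝[>] 0, c ∈ Set.Ioo (0 : ℝ) 1 := Ioo_mem_nhdsGT (by norm_num)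
  obtain ⟨c, hc1, hc2⟩ := (h1.and h2).exists
  refine ⟨c, hc2.1, hc2.2, fun i x => ?_⟩
  have h := (T i).le_norm_apply_singularValues_last x
  rw [finrank_euclideanSpace_fin] at h
  exact (mul_le_mul_of_nonneg_right (hc1 i).le (norm_nonneg x)).trans h

/-- The properties of `(t, w) ↦ φ^t(T_w)` that the pressure arguments use. -/
structure QuasiPotential (φ : ℝ → List (Fin m) → ℝ) (d : ℕ) (D α : ℝ) : Prop where
  dim_pos : 0 < d
  const_pos : 0 < D
  const_lt_one : D < 1
  rate_pos : 0 < α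
  rate_lt_one : α < 1
  pos : ∀ t, 0 ≤ t → ∀ w, 0 < φ t w
  zero : ∀ w, φ 0 w = 1
  append_le : ∀ t, 0 ≤ t → ∀ w w', φ t (w ++ w') ≤ φ t w * φ t w'
  le_append : ∀ t, 0 ≤ t → ∀ w w', D * φ t w * φ t w' ≤ φ t (w ++ w')
  lower : ∀ t t', 0 ≤ t → t ≤ t' → ∀ w : List (Fin m),
    (α ^ w.length) ^ (t' - t) * φ t w ≤ φ t' w
  upper : ∀ t t', 0 ≤ t → t ≤ t' → ∀ w : List (Fin m),
    φ t' w ≤ ((1 / 2) ^ w.length) ^ (t' - t) * φ t w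
  interp : ∀ t : ℝ, 0 ≤ t → t ≤ d → ∀ w,
    φ t w = φ ⌊t⌋₊ w ^ (1 - Int.fract t) * φ (⌊t⌋₊ + 1 : ℕ) w ^ Int.fract t
  scale : ∀ t : ℝ, d < t → ∀ w, φ t w = φ d w ^ (t / d)

theorem exists_quasiPotential (hd : 0 < d) {T : Fin m → Space d →ₗ[ℝ] Space d}
    (hbij : ∀ i, Function.Bijective (T i)) (hhalf : ∀ i, (T i).singularValues 0 < 1 / 2)
    {D : ℝ} (hD0 : 0 < D) (hD1 : D < 1)
    (hquasi : ∀ t : ℝ, 0 ≤ t → t ≤ d → ∀ w w' : List (Fin m),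
      D * svf t (wordMap T w) * svf t (wordMap T w') ≤ svf t (wordMap T (w ++ w'))) :
    ∃ α, QuasiPotential (fun t w => svf t (wordMap T w)) d D α := by
  have hT : ∀ i, Function.Injective (T i) := fun i => (hbij i).1
  obtain ⟨c, hc0, hc1, hc⟩ := exists_contraction_bound hhalf
  obtain ⟨α, hα0, hα1, hα⟩ := exists_expansion_bound hd hT
  have hw := wordMap_injective hT
  refine ⟨α, hd, hD0, hD1, hα0, hα1, fun t ht w => svf_pos (hw w) ht, fun w => ?_,
    fun t ht w w' => ?_, fun t ht w w' => ?_, fun t t' ht htt w => ?_,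
    fun t t' ht htt w => ?_, fun t ht htd w => ?_, fun t ht w => ?_⟩
  · simp [svf]
  · simp only [wordMap_append]; exact svf_comp_le (hw w) (hw w') ht
  -- The hypothesis stops at t = d. Above it φ^t is a power of the determinant, hence
  -- multiplicative, and D < 1 suffices.
  · by_cases htd : t ≤ d
    · exact hquasi t ht htd w w'
    · simp only [wordMap_append, svf, if_neg htd, LinearMap.det_comp, abs_mul]
      rw [Real.mul_rpow (abs_nonneg _) (abs_nonneg _), mul_assoc]
      exact mul_le_of_le_one_left (by positivity) hD1.le
  · exact rpow_mul_le_svf hd (hw w) (by positivity)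
      (fun i hi => le_singularValues_of_le_norm (le_norm_wordMap hα0.le hα w) hi) ht htt
  · refine svf_le_rpow_mul hd (hw w) (by positivity)
      (fun i hi => (singularValues_le_of_norm_le (norm_wordMap_le hc0.le hc w) hi).trans
        (pow_le_pow_left₀ hc0.le hc1.le _)) ht htt
  · rw [svf_eq_topProd_rpow (hw w) ht htd, svf_natCast _ (Nat.floor_le_of_le htd)]
    by_cases hf : Int.fract t = 0
    · simp [hf]
    · rw [svf_natCast _ (floor_lt_of_fract_ne_zero ht htd hf)]
  · rw [svf_natCast _ le_rfl, svf, if_neg (not_le.2 ht), abs_det_eq_topProd]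

end ShrinkingTargets

/-! ### Pressure: existence, monotonicity and the unique zero. -/

namespace ShrinkingTargets

variable {d m : ℕ} {φ : ℝ → List (Fin m) → ℝ} {D α : ℝ}

/-- The partition function `∑_{|w| = k} φ^t(w)`. -/
noncomputable def partitionSum (φ : ℝ → List (Fin m) → ℝ) (t : ℝ) (k : ℕ) : ℝ :=
  ∑ i : Fin k → Fin m, φ t (List.ofFn i)

/-- The partition function with the target word of length `ℓ k` appended. -/
noncomputable def targetSum (φ : ℝ → List (Fin m) → ℝ) (ℓ : ℕ → ℕ) (j : ℕ → Fin m) (t : ℝ)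
    (k : ℕ) : ℝ :=
  ∑ i : Fin k → Fin m, φ t (List.ofFn i ++ trunc j (ℓ k))

/-- `(1/k) log φ^t(j|_{ℓ_k})`. -/
noncomputable def wordRate (φ : ℝ → List (Fin m) → ℝ) (ℓ : ℕ → ℕ) (j : ℕ → Fin m) (t : ℝ)
    (k : ℕ) : ℝ :=
  (1 / (k : ℝ)) * Real.log (φ t (trunc j (ℓ k)))

/-- `(1/k) log ∑_{|w| = k} φ^t(w j|_{ℓ_k})`. -/
noncomputable def targetPressure (φ : ℝ → List (Fin m) → ℝ) (ℓ : ℕ → ℕ) (j : ℕ → Fin m) (t : ℝ)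
    (k : ℕ) : ℝ :=
  (1 / (k : ℝ)) * Real.log (targetSum φ ℓ j t k)

@[simp]
theorem length_trunc (j : ℕ → Fin m) (n : ℕ) : (trunc j n).length = n := by
  simp [trunc]

namespace QuasiPotential

theorem nil (h : QuasiPotential φ d D α) {t : ℝ} (ht : 0 ≤ t) : φ t [] = 1 := by
  have h1 := h.upper 0 t le_rfl ht []
  have h2 := h.lower 0 t le_rfl ht []
  simp [h.zero] at h1 h2
  exact le_antisymm h1 h2

theorem le_half (h : QuasiPotential φ d D α) {t : ℝ} (ht : 0 ≤ t) (w : List (Fin m)) :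
    φ t w ≤ ((1 / 2) ^ w.length) ^ t := by
  have h1 := h.upper 0 t le_rfl ht w
  rwa [h.zero, mul_one, sub_zero] at h1

theorem ge_rate (h : QuasiPotential φ d D α) {t : ℝ} (ht : 0 ≤ t) (w : List (Fin m)) :
    (α ^ w.length) ^ t ≤ φ t w := by
  have h1 := h.lower 0 t le_rfl ht w
  rwa [h.zero, mul_one, sub_zero] at h1

theorem le_one (h : QuasiPotential φ d D α) {t : ℝ} (ht : 0 ≤ t) (w : List (Fin m)) :
    φ t w ≤ 1 :=
  (h.le_half ht w).trans (Real.rpow_le_one (by positivity)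
    (pow_le_one₀ (by norm_num) (by norm_num)) ht)

theorem append_le_left (h : QuasiPotential φ d D α) {t : ℝ} (ht : 0 ≤ t) (w w' : List (Fin m)) :
    φ t (w ++ w') ≤ φ t w :=
  (h.append_le t ht w w').trans (mul_le_of_le_one_right (h.pos t ht w).le (h.le_one ht w'))

theorem partitionSum_pos (h : QuasiPotential φ d D α) (hm : 0 < m) {t : ℝ} (ht : 0 ≤ t) (k : ℕ) :
    0 < partitionSum φ t k := by
  have : Nonempty (Fin m) := ⟨⟨0, hm⟩⟩
  exact Finset.sum_pos (fun i _ => h.pos t ht _) Finset.univ_nonempty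

theorem partitionSum_le (h : QuasiPotential φ d D α) {t : ℝ} (ht : 0 ≤ t) (k : ℕ) :
    partitionSum φ t k ≤ (m : ℝ) ^ k := by
  calc partitionSum φ t k ≤ ∑ _i : Fin k → Fin m, (1 : ℝ) :=
        Finset.sum_le_sum fun i _ => h.le_one ht _
    _ = (m : ℝ) ^ k := by simp

theorem mul_partitionSum_le (h : QuasiPotential φ d D α) {t : ℝ} (ht : 0 ≤ t) (k l : ℕ) :
    D * partitionSum φ t k * partitionSum φ t l ≤ partitionSum φ t (k + l) := by
  have e : partitionSum φ t (k + l) =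
      ∑ p : (Fin k → Fin m) × (Fin l → Fin m), φ t (List.ofFn p.1 ++ List.ofFn p.2) := by
    rw [partitionSum, ← (Fin.appendEquiv k l).sum_comp]
    refine Finset.sum_congr rfl fun p _ => ?_
    rw [← List.ofFn_fin_append]; rfl
  rw [e, partitionSum, partitionSum, mul_assoc, Fintype.sum_mul_sum, Fintype.sum_prod_type,
    Finset.mul_sum]
  refine Finset.sum_le_sum fun i _ => ?_
  rw [Finset.mul_sum]
  refine Finset.sum_le_sum fun i' _ => ?_
  rw [← mul_assoc]
  exact h.le_append t ht _ _

/-- Fekete's lemma for -log Z_k - log D, which is subadditive by quasi-multiplicativity and at least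
-k log m. The term log D disappears after division by k. -/
theorem exists_pressure (h : QuasiPotential φ d D α) (hm : 0 < m) {t : ℝ} (ht : 0 ≤ t) :
    ∃ P : ℝ, Tendsto (fun k : ℕ => (1 / (k : ℝ)) * Real.log (partitionSum φ t k)) atTop (𝓝 P) := by
  let u : ℕ → ℝ := fun k => -Real.log (partitionSum φ t k) - Real.log D
  have hpos := h.partitionSum_pos hm ht
  have hlogD : Real.log D < 0 := Real.log_neg h.const_pos h.const_lt_one
  have hu : Subadditive u := fun k l => by
    have := Real.log_le_log (mul_pos (mul_pos h.const_pos (hpos k)) (hpos l))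
      (h.mul_partitionSum_le ht k l)
    rw [Real.log_mul (mul_pos h.const_pos (hpos k)).ne' (hpos l).ne',
      Real.log_mul h.const_pos.ne' (hpos k).ne'] at this
    simp only [u]; linarith
  have hb : BddBelow (Set.range fun n : ℕ => u n / n) := by
    refine ⟨-Real.log m, ?_⟩
    rintro _ ⟨n, rfl⟩
    have hm1 : 0 ≤ Real.log m := Real.log_natCast_nonneg m
    rcases Nat.eq_zero_or_pos n with rfl | hn
    · simpa using hm1
    · have hn' : (0 : ℝ) < n := by exact_mod_cast hn
      have := Real.log_le_log (hpos n) (h.partitionSum_le ht n)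
      rw [Real.log_pow] at this
      change _ ≤ u n / n
      rw [le_div_iff₀ hn']
      simp only [u]; linarith
  have hlim := hu.tendsto_lim hb
  have hD : Tendsto (fun n : ℕ => Real.log D / n) atTop (𝓝 0) :=
    tendsto_const_nhds.div_atTop tendsto_natCast_atTop_atTop
  refine ⟨-hu.lim - 0, (hlim.neg.sub hD).congr fun n => ?_⟩
  simp only [u]; ring

theorem targetSum_pos (h : QuasiPotential φ d D α) (ℓ : ℕ → ℕ) (j : ℕ → Fin m) {t : ℝ}
    (ht : 0 ≤ t) (k : ℕ) : 0 < targetSum φ ℓ j t k := by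
  have : Nonempty (Fin m) := ⟨j 0⟩
  exact Finset.sum_pos (fun i _ => h.pos t ht _) Finset.univ_nonempty

theorem targetSum_le (h : QuasiPotential φ d D α) (ℓ : ℕ → ℕ) (j : ℕ → Fin m) {t : ℝ}
    (ht : 0 ≤ t) (k : ℕ) :
    targetSum φ ℓ j t k ≤ partitionSum φ t k * φ t (trunc j (ℓ k)) := by
  rw [targetSum, partitionSum, Finset.sum_mul]
  exact Finset.sum_le_sum fun i _ => h.append_le t ht _ _

theorem le_targetSum (h : QuasiPotential φ d D α) (ℓ : ℕ → ℕ) (j : ℕ → Fin m) {t : ℝ}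
    (ht : 0 ≤ t) (k : ℕ) :
    D * (partitionSum φ t k * φ t (trunc j (ℓ k))) ≤ targetSum φ ℓ j t k := by
  rw [targetSum, partitionSum, Finset.sum_mul, Finset.mul_sum]
  refine Finset.sum_le_sum fun i _ => ?_
  rw [← mul_assoc]
  exact h.le_append t ht _ _

theorem targetPressure_le (h : QuasiPotential φ d D α) (ℓ : ℕ → ℕ) (j : ℕ → Fin m) {t : ℝ}
    (ht : 0 ≤ t) (k : ℕ) :
    targetPressure φ ℓ j t k ≤
      (1 / (k : ℝ)) * Real.log (partitionSum φ t k) + wordRate φ ℓ j t k := by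
  have hm : 0 < m := (j 0).pos
  rw [targetPressure, wordRate, ← mul_add,
    ← Real.log_mul (h.partitionSum_pos hm ht k).ne' (h.pos t ht _).ne']
  exact mul_le_mul_of_nonneg_left (Real.log_le_log (h.targetSum_pos ℓ j ht k)
    (h.targetSum_le ℓ j ht k)) (by positivity)

theorem le_targetPressure (h : QuasiPotential φ d D α) (ℓ : ℕ → ℕ) (j : ℕ → Fin m) {t : ℝ}
    (ht : 0 ≤ t) (k : ℕ) :
    Real.log D / k + ((1 / (k : ℝ)) * Real.log (partitionSum φ t k) + wordRate φ ℓ j t k) ≤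
      targetPressure φ ℓ j t k := by
  have hm : 0 < m := (j 0).pos
  have hp := h.partitionSum_pos hm ht k
  have hq := h.pos t ht (trunc j (ℓ k))
  rw [targetPressure, wordRate, ← mul_add, ← Real.log_mul hp.ne' hq.ne', div_eq_mul_one_div,
    mul_comm, ← mul_add, ← Real.log_mul h.const_pos.ne' (mul_pos hp hq).ne']
  exact mul_le_mul_of_nonneg_left (Real.log_le_log (mul_pos h.const_pos (mul_pos hp hq))
    (h.le_targetSum ℓ j ht k)) (by positivity)

/-- Quasi-multiplicativity detaches the target from the free word at a cost of log D / k, which is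
negligible in the limit. -/
theorem tendsto_targetPressure (h : QuasiPotential φ d D α) {ℓ : ℕ → ℕ} {j : ℕ → Fin m} {t : ℝ}
    (ht : 0 ≤ t) {P c : ℝ}
    (hP : Tendsto (fun k : ℕ => (1 / (k : ℝ)) * Real.log (partitionSum φ t k)) atTop (𝓝 P))
    (hc : Tendsto (wordRate φ ℓ j t) atTop (𝓝 c)) :
    Tendsto (targetPressure φ ℓ j t) atTop (𝓝 (P + c)) := by
  have hD : Tendsto (fun n : ℕ => Real.log D / n) atTop (𝓝 0) :=
    tendsto_const_nhds.div_atTop tendsto_natCast_atTop_atTop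
  refine tendsto_of_tendsto_of_tendsto_of_le_of_le ?_ (hP.add hc)
    (fun k => h.le_targetPressure ℓ j ht k) (fun k => h.targetPressure_le ℓ j ht k)
  simpa using hD.add (hP.add hc)

theorem log_le (h : QuasiPotential φ d D α) {t : ℝ} (ht : 0 ≤ t) (w : List (Fin m)) :
    Real.log (φ t w) ≤ -(w.length * t * Real.log 2) := by
  have h1 := Real.log_le_log (h.pos t ht w) (h.le_half ht w)
  rw [Real.log_rpow (by positivity), Real.log_pow, one_div, Real.log_inv] at h1
  linarith

theorem le_log (h : QuasiPotential φ d D α) {t : ℝ} (ht : 0 ≤ t) (w : List (Fin m)) :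
    w.length * t * Real.log α ≤ Real.log (φ t w) := by
  have hα := h.rate_pos
  have h1 := Real.log_le_log (by positivity) (h.ge_rate ht w)
  rw [Real.log_rpow (by positivity), Real.log_pow] at h1
  linarith

theorem wordRate_nonpos (h : QuasiPotential φ d D α) (ℓ : ℕ → ℕ) (j : ℕ → Fin m) {t : ℝ}
    (ht : 0 ≤ t) (k : ℕ) : wordRate φ ℓ j t k ≤ 0 :=
  mul_nonpos_of_nonneg_of_nonpos (by positivity)
    (Real.log_nonpos (h.pos t ht _).le (h.le_one ht _))

/-- A finite exponential rate bounds the relative length of the targets. -/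
theorem exists_length_bound (h : QuasiPotential φ d D α) {ℓ : ℕ → ℕ} {j : ℕ → Fin m} {t : ℝ}
    (ht : 0 < t) {c : ℝ} (hc : Tendsto (wordRate φ ℓ j t) atTop (𝓝 c)) :
    ∃ B : ℝ, 0 ≤ B ∧ ∀ᶠ k : ℕ in atTop, (ℓ k : ℝ) ≤ B * k := by
  have hl2 : 0 < Real.log 2 := Real.log_pos (by norm_num)
  have h1 : ∀ᶠ k in atTop, c - 1 < wordRate φ ℓ j t k := hc.eventually (lt_mem_nhds (by linarith))
  have hc0 : c ≤ 0 := le_of_tendsto' hc fun k => h.wordRate_nonpos ℓ j ht.le k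
  refine ⟨(1 - c) / (t * Real.log 2), div_nonneg (by linarith) (by positivity), ?_⟩
  filter_upwards [h1, eventually_gt_atTop 0] with k hk hk0
  have hk0' : (0 : ℝ) < k := by exact_mod_cast hk0
  have h2 := h.log_le ht.le (trunc j (ℓ k))
  rw [length_trunc] at h2
  rw [wordRate, one_div, inv_mul_eq_div, lt_div_iff₀ hk0'] at hk
  rw [div_mul_eq_mul_div, le_div_iff₀ (by positivity)]
  nlinarith

theorem targetSum_upper (h : QuasiPotential φ d D α) (ℓ : ℕ → ℕ) (j : ℕ → Fin m) {t t' : ℝ}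
    (ht : 0 ≤ t) (htt : t ≤ t') (k : ℕ) :
    targetSum φ ℓ j t' k ≤ ((1 / 2) ^ (k + ℓ k)) ^ (t' - t) * targetSum φ ℓ j t k := by
  rw [targetSum, targetSum, Finset.mul_sum]
  refine Finset.sum_le_sum fun i _ => ?_
  simpa using h.upper t t' ht htt (List.ofFn i ++ trunc j (ℓ k))

theorem targetSum_lower (h : QuasiPotential φ d D α) (ℓ : ℕ → ℕ) (j : ℕ → Fin m) {t t' : ℝ}
    (ht : 0 ≤ t) (htt : t ≤ t') (k : ℕ) :
    (α ^ (k + ℓ k)) ^ (t' - t) * targetSum φ ℓ j t k ≤ targetSum φ ℓ j t' k := by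
  rw [targetSum, targetSum, Finset.mul_sum]
  refine Finset.sum_le_sum fun i _ => ?_
  simpa using h.lower t t' ht htt (List.ofFn i ++ trunc j (ℓ k))

/-- The words have length k + ℓ_k ≥ k, so each unit of exponent loses at least log 2 whatever the
targets are. -/
theorem targetPressure_upper (h : QuasiPotential φ d D α) (ℓ : ℕ → ℕ) (j : ℕ → Fin m) {t t' : ℝ}
    (ht : 0 ≤ t) (htt : t ≤ t') {k : ℕ} (hk : 0 < k) :
    targetPressure φ ℓ j t' k ≤ targetPressure φ ℓ j t k - (t' - t) * Real.log 2 := by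
  have hk' : (0 : ℝ) < k := by exact_mod_cast hk
  have hl2 : 0 < Real.log 2 := Real.log_pos (by norm_num)
  have h1 := Real.log_le_log (h.targetSum_pos ℓ j (ht.trans htt) k) (h.targetSum_upper ℓ j ht htt k)
  rw [Real.log_mul (by positivity) (h.targetSum_pos ℓ j ht k).ne', Real.log_rpow (by positivity),
    Real.log_pow, one_div, Real.log_inv] at h1
  have h2 : (0 : ℝ) ≤ (ℓ k : ℝ) * ((t' - t) * Real.log 2) :=
    mul_nonneg (by positivity) (mul_nonneg (by linarith) hl2.le)
  push_cast at h1
  rw [targetPressure, targetPressure, one_div, inv_mul_eq_div, inv_mul_eq_div, div_le_iff₀ hk',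
    sub_mul, div_mul_cancel₀ _ hk'.ne']
  nlinarith

/-- The matching bound on the loss, which yields continuity of the pressure; it needs k + ℓ_k ≤ (1 +
B) k. -/
theorem targetPressure_lower (h : QuasiPotential φ d D α) (ℓ : ℕ → ℕ) (j : ℕ → Fin m) {t t' : ℝ}
    (ht : 0 ≤ t) (htt : t ≤ t') {k : ℕ} (hk : 0 < k) {B : ℝ} (hB : (ℓ k : ℝ) ≤ B * k) :
    targetPressure φ ℓ j t k + (t' - t) * ((1 + B) * Real.log α) ≤ targetPressure φ ℓ j t' k := by
  have hk' : (0 : ℝ) < k := by exact_mod_cast hk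
  have hα := h.rate_pos
  have hl : Real.log α < 0 := Real.log_neg hα h.rate_lt_one
  have h1 := Real.log_le_log (mul_pos (by positivity) (h.targetSum_pos ℓ j ht k))
    (h.targetSum_lower ℓ j ht htt k)
  rw [Real.log_mul (by positivity) (h.targetSum_pos ℓ j ht k).ne', Real.log_rpow (by positivity),
    Real.log_pow] at h1
  push_cast at h1
  have h2 : 0 ≤ (B * k - ℓ k) * ((t' - t) * -Real.log α) :=
    mul_nonneg (by linarith) (mul_nonneg (by linarith) (by linarith))
  rw [targetPressure, targetPressure, one_div, inv_mul_eq_div, inv_mul_eq_div, le_div_iff₀ hk',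
    add_mul, div_mul_cancel₀ _ hk'.ne']
  nlinarith

theorem targetPressure_zero (h : QuasiPotential φ d D α) (ℓ : ℕ → ℕ) (j : ℕ → Fin m) {k : ℕ}
    (hk : 0 < k) : targetPressure φ ℓ j 0 k = Real.log m := by
  have hk' : (k : ℝ) ≠ 0 := by positivity
  simp only [targetPressure, targetSum, h.zero]
  simp only [Finset.sum_const, Finset.card_univ, Fintype.card_pi, Fintype.card_fin,
    Finset.prod_const, nsmul_eq_mul, mul_one]
  push_cast
  rw [Real.log_pow]
  field_simp

/-- The modified pressure has exactly one zero, where it changes sign. -/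
theorem exists_unique_zero (h : QuasiPotential φ d D α) {ℓ : ℕ → ℕ} {j : ℕ → Fin m}
    (hrate : ∀ t, 0 ≤ t → ∃ c, Tendsto (wordRate φ ℓ j t) atTop (𝓝 c)) :
    ∃ (s₀ : ℝ) (P : ℝ → ℝ), 0 ≤ s₀ ∧
      (∀ t, 0 ≤ t → Tendsto (targetPressure φ ℓ j t) atTop (𝓝 (P t))) ∧
      (∀ t, 0 ≤ t → (P t = 0 ↔ t = s₀)) ∧ (∀ t, 0 ≤ t → t < s₀ → 0 < P t) ∧
      ∀ t, s₀ < t → P t < 0 := by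
  have hm : 0 < m := (j 0).pos
  have hl2 : 0 < Real.log 2 := Real.log_pos (by norm_num)
  have hex : ∀ t, 0 ≤ t → ∃ p, Tendsto (targetPressure φ ℓ j t) atTop (𝓝 p) := fun t ht => by
    obtain ⟨P, hP⟩ := h.exists_pressure hm ht
    obtain ⟨c, hc⟩ := hrate t ht
    exact ⟨_, h.tendsto_targetPressure ht hP hc⟩
  choose! P hP using hex
  obtain ⟨c₁, hc₁⟩ := hrate 1 zero_le_one
  obtain ⟨B, hB0, hB⟩ := h.exists_length_bound one_pos hc₁
  have hup : ∀ t t', 0 ≤ t → t ≤ t' → P t' ≤ P t - (t' - t) * Real.log 2 := fun t t' ht htt => by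
    refine le_of_tendsto_of_tendsto (hP t' (ht.trans htt)) ((hP t ht).sub_const _) ?_
    filter_upwards [eventually_gt_atTop 0] with k hk
    exact h.targetPressure_upper ℓ j ht htt hk
  have hlow : ∀ t t', 0 ≤ t → t ≤ t' → P t + (t' - t) * ((1 + B) * Real.log α) ≤ P t' :=
    fun t t' ht htt => by
      refine le_of_tendsto_of_tendsto ((hP t ht).add_const _) (hP t' (ht.trans htt)) ?_
      filter_upwards [eventually_gt_atTop 0, hB] with k hk hkB
      exact h.targetPressure_lower ℓ j ht htt hk hkB
  have hP0 : 0 ≤ P 0 := by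
    refine ge_of_tendsto (hP 0 le_rfl) ?_
    filter_upwards [eventually_gt_atTop 0] with k hk
    rw [h.targetPressure_zero ℓ j hk]
    exact Real.log_natCast_nonneg m
  have hlα : Real.log α < 0 := Real.log_neg h.rate_pos h.rate_lt_one
  have hcont : ContinuousOn P (Set.Ici 0) := by
    have hK : 0 ≤ (1 + B) * -Real.log α := mul_nonneg (by linarith) (by linarith)
    refine (LipschitzOnWith.of_le_add_mul' (K := (1 + B) * -Real.log α)
      (s := Set.Ici 0) (f := P) fun x hx y hy => ?_).continuousOn
    rw [Real.dist_eq]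
    rcases le_total x y with hxy | hxy
    · have := hlow x y hx hxy
      rw [abs_sub_comm, abs_of_nonneg (by linarith)]
      nlinarith
    · have := hup y x hy hxy
      have h3 : 0 ≤ (x - y) * Real.log 2 := mul_nonneg (by linarith) hl2.le
      have h4 : 0 ≤ (1 + B) * -Real.log α * |x - y| := mul_nonneg hK (abs_nonneg _)
      linarith
  -- Descending with slope at most -log 2 from P 0 ≥ 0, the pressure is no longer positive at P 0 /
  -- log 2; this is the right end for the intermediate value theorem.
  have hS : 0 ≤ P 0 / Real.log 2 := div_nonneg hP0 hl2.le
  have hPS : P (P 0 / Real.log 2) ≤ 0 := by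
    have := hup 0 _ le_rfl hS
    rw [sub_zero, div_mul_cancel₀ _ hl2.ne'] at this
    linarith
  obtain ⟨s₀, hs₀, hs₀0⟩ := intermediate_value_Icc' hS
    (hcont.mono Set.Icc_subset_Ici_self) (show (0 : ℝ) ∈ Set.Icc _ _ from ⟨hPS, hP0⟩)
  have hlt : ∀ t, 0 ≤ t → t < s₀ → 0 < P t := fun t ht hts => by
    have := hup t s₀ ht hts.le
    have h3 : 0 < (s₀ - t) * Real.log 2 := mul_pos (by linarith) hl2
    linarith
  have hgt : ∀ t, s₀ < t → P t < 0 := fun t hts => by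
    have := hup s₀ t hs₀.1 hts.le
    have h3 : 0 < (t - s₀) * Real.log 2 := mul_pos (by linarith) hl2
    linarith
  refine ⟨s₀, P, hs₀.1, hP, fun t ht => ⟨fun h0 => ?_, fun h0 => h0 ▸ hs₀0⟩, hlt, hgt⟩
  rcases lt_trichotomy t s₀ with hts | hts | hts
  · exact absurd h0 (hlt t ht hts).ne'
  · exact hts
  · exact absurd h0 (hgt t hts).ne

theorem wordRate_zero (h : QuasiPotential φ d D α) (ℓ : ℕ → ℕ) (j : ℕ → Fin m) (k : ℕ) :
    wordRate φ ℓ j 0 k = 0 := by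
  simp [wordRate, h.zero]

theorem wordRate_scale (h : QuasiPotential φ d D α) (ℓ : ℕ → ℕ) (j : ℕ → Fin m) {t : ℝ}
    (ht : d < t) (k : ℕ) : wordRate φ ℓ j t k = t / d * wordRate φ ℓ j d k := by
  rw [wordRate, wordRate, h.scale t ht, Real.log_rpow (h.pos _ (Nat.cast_nonneg d) _)]
  ring

/-- Exponents outside (0, d] are free: at 0 the rate vanishes, and above d it is t/d times the rate
at d. -/
theorem exists_tendsto_wordRate (h : QuasiPotential φ d D α) {ℓ : ℕ → ℕ} {j : ℕ → Fin m}
    (hrate : ∀ t : ℝ, 0 < t → t ≤ d → ∃ c, Tendsto (wordRate φ ℓ j t) atTop (𝓝 c)) (t : ℝ)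
    (ht : 0 ≤ t) : ∃ c, Tendsto (wordRate φ ℓ j t) atTop (𝓝 c) := by
  rcases ht.eq_or_lt with rfl | ht
  · exact ⟨0, tendsto_const_nhds.congr fun k => (h.wordRate_zero ℓ j k).symm⟩
  by_cases htd : t ≤ d
  · exact hrate t ht htd
  · obtain ⟨c, hc⟩ := hrate d (by exact_mod_cast h.dim_pos) le_rfl
    exact ⟨t / d * c, (hc.const_mul _).congr fun k =>
      (h.wordRate_scale ℓ j (not_le.1 htd) k).symm⟩

/-- For positive s and t both log φ^s(w) and log φ^t(w) are comparable to -|w|, so one diverging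
rate drags down all others. The ratio of the extreme constants is K. -/
theorem tendsto_targetPressure_atBot (h : QuasiPotential φ d D α) {ℓ : ℕ → ℕ} {j : ℕ → Fin m}
    {s : ℝ} (hs : 0 < s) (hrate : Tendsto (wordRate φ ℓ j s) atTop atBot) {t : ℝ} (ht : 0 < t) :
    Tendsto (targetPressure φ ℓ j t) atTop atBot := by
  obtain ⟨P, hP⟩ := h.exists_pressure (j 0).pos ht.le
  have hl2 : 0 < Real.log 2 := Real.log_pos (by norm_num)
  have hlα : Real.log α < 0 := Real.log_neg h.rate_pos h.rate_lt_one
  set K : ℝ := t * Real.log 2 / (s * -Real.log α) with hK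
  have hK0 : 0 < K := div_pos (by positivity) (mul_pos hs (by linarith))
  have hle : ∀ k, wordRate φ ℓ j t k ≤ K * wordRate φ ℓ j s k := fun k => by
    have h1 := h.log_le ht.le (trunc j (ℓ k))
    have h2 := h.le_log hs.le (trunc j (ℓ k))
    rw [wordRate, wordRate, mul_left_comm]
    refine mul_le_mul_of_nonneg_left ?_ (by positivity)
    refine h1.trans ?_
    have h3 := mul_le_mul_of_nonneg_left h2 hK0.le
    refine le_trans (le_of_eq ?_) h3
    have hne : Real.log α ≠ 0 := hlα.ne
    rw [hK]
    field_simp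
  have hr : Tendsto (wordRate φ ℓ j t) atTop atBot :=
    tendsto_atBot_mono hle (hrate.const_mul_atBot hK0)
  exact tendsto_atBot_mono (fun k => h.targetPressure_le ℓ j ht.le k) (hP.add_atBot hr)

theorem summable_targetSum (h : QuasiPotential φ d D α) {ℓ : ℕ → ℕ} {j : ℕ → Fin m} {t : ℝ}
    (ht : 0 ≤ t) {ε : ℝ} (hε : 0 < ε)
    (hev : ∀ᶠ k in atTop, targetPressure φ ℓ j t k < -ε) :
    Summable (targetSum φ ℓ j t) := by
  have hg : Summable fun k : ℕ => (Real.exp (-ε)) ^ k :=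
    summable_geometric_of_lt_one (Real.exp_pos _).le (Real.exp_lt_one_iff.2 (by linarith))
  refine Summable.of_norm_bounded_eventually_nat hg ?_
  filter_upwards [hev, eventually_gt_atTop 0] with k hk hk0
  have hk' : (0 : ℝ) < k := by exact_mod_cast hk0
  have hpos := h.targetSum_pos ℓ j ht k
  rw [targetPressure, one_div, inv_mul_eq_div, div_lt_iff₀ hk'] at hk
  rw [Real.norm_eq_abs, abs_of_pos hpos, ← Real.exp_nat_mul, ← Real.log_le_iff_le_exp hpos]
  linarith

end QuasiPotential

end ShrinkingTargets

/-! ### Coding by words and the upper bound for the dimension. -/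

namespace ShrinkingTargets

open Module

variable {d m : ℕ}

theorem shift_iterate_apply (i : ℕ → Fin m) (n r : ℕ) : (shift^[n] i) r = i (r + n) := by
  induction n generalizing i with
  | zero => rfl
  | succ n ih => rw [Function.iterate_succ_apply, ih, shift, add_assoc]

theorem trunc_add (i : ℕ → Fin m) (n k : ℕ) :
    trunc i (n + k) = trunc i n ++ trunc (shift^[n] i) k := by
  unfold trunc
  rw [List.ofFn_add]
  congr 1
  refine congrArg List.ofFn (funext fun r => ?_)
  rw [shift_iterate_apply]
  simp [add_comm]

theorem trunc_succ (i : ℕ → Fin m) (n : ℕ) : trunc i (n + 1) = trunc i n ++ [i n] := by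
  rw [trunc_add]
  simp [trunc, shift_iterate_apply]

theorem trunc_eq_iff {i j : ℕ → Fin m} {n : ℕ} :
    trunc i n = trunc j n ↔ ∀ r < n, i r = j r := by
  rw [trunc, trunc, List.ofFn_inj]
  exact ⟨fun h r hr => congrFun h ⟨r, hr⟩, fun h => funext fun r => h r r.2⟩

theorem affineWord_append (T : Fin m → Space d →ₗ[ℝ] Space d) (a : Fin m → Space d)
    (w w' : List (Fin m)) (x : Space d) :
    affineWord T a (w ++ w') x = affineWord T a w (affineWord T a w' x) :=
  List.foldr_append

theorem affineWord_eq (T : Fin m → Space d →ₗ[ℝ] Space d) (a : Fin m → Space d)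
    (w : List (Fin m)) (x : Space d) :
    affineWord T a w x = wordMap T w x + affineWord T a w 0 := by
  induction w with
  | nil => simp [affineWord, wordMap_nil]
  | cons i w ih =>
    have hc : ∀ y, affineWord T a (i :: w) y = T i (affineWord T a w y) + a i := fun y => rfl
    rw [hc, hc, ih, wordMap_cons, LinearMap.comp_apply, map_add, add_assoc]

/-- Presents π(i) as a series with terms linear in a; its convergence, linearity in a and
measurability are all read off from this. -/
theorem affineWord_trunc (T : Fin m → Space d →ₗ[ℝ] Space d) (a : Fin m → Space d)
    (i : ℕ → Fin m) (k : ℕ) :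
    affineWord T a (trunc i k) 0 =
      ∑ r ∈ Finset.range k, wordMap T (trunc i r) (a (i r)) := by
  induction k with
  | zero => rfl
  | succ k ih =>
    rw [trunc_succ, affineWord_append, affineWord_eq, Finset.sum_range_succ, ih, add_comm]
    congr 2
    simp [affineWord]

section Projection

variable {T : Fin m → Space d →ₗ[ℝ] Space d} {c : ℝ}

theorem norm_wordMap_trunc_le (hc0 : 0 < c) (hT : ∀ i x, ‖T i x‖ ≤ c * ‖x‖)
    (a : Fin m → Space d) (i : ℕ → Fin m) (r : ℕ) :
    ‖wordMap T (trunc i r) (a (i r))‖ ≤ ‖a‖ * c ^ r := by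
  have h := norm_wordMap_le hc0.le hT (trunc i r) (a (i r))
  rw [length_trunc] at h
  rw [mul_comm]
  exact h.trans (mul_le_mul_of_nonneg_left (norm_le_pi_norm a (i r)) (by positivity))

theorem summable_proj (hc0 : 0 < c) (hc1 : c < 1) (hT : ∀ i x, ‖T i x‖ ≤ c * ‖x‖)
    (a : Fin m → Space d) (i : ℕ → Fin m) :
    Summable fun r => wordMap T (trunc i r) (a (i r)) :=
  Summable.of_norm_bounded ((summable_geometric_of_lt_one hc0.le hc1).mul_left ‖a‖)
    (norm_wordMap_trunc_le hc0 hT a i)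

theorem hasSum_proj (hc0 : 0 < c) (hc1 : c < 1) (hT : ∀ i x, ‖T i x‖ ≤ c * ‖x‖)
    (a : Fin m → Space d) (i : ℕ → Fin m) :
    HasSum (fun r => wordMap T (trunc i r) (a (i r))) (proj T a i) := by
  have h := (summable_proj hc0 hc1 hT a i).hasSum
  have h' := h.tendsto_sum_nat
  simp only [← affineWord_trunc] at h'
  rwa [proj, h'.limUnder_eq]

theorem tendsto_proj (hc0 : 0 < c) (hc1 : c < 1) (hT : ∀ i x, ‖T i x‖ ≤ c * ‖x‖)
    (a : Fin m → Space d) (i : ℕ → Fin m) :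
    Tendsto (fun k => affineWord T a (trunc i k) 0) atTop (𝓝 (proj T a i)) := by
  simpa only [affineWord_trunc] using (hasSum_proj hc0 hc1 hT a i).tendsto_sum_nat

theorem norm_proj_le (hc0 : 0 < c) (hc1 : c < 1) (hT : ∀ i x, ‖T i x‖ ≤ c * ‖x‖)
    (a : Fin m → Space d) (i : ℕ → Fin m) : ‖proj T a i‖ ≤ ‖a‖ * (1 - c)⁻¹ := by
  rw [← (hasSum_proj hc0 hc1 hT a i).tsum_eq]
  exact tsum_of_norm_bounded ((hasSum_geometric_of_lt_one hc0.le hc1).mul_left ‖a‖)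
    (norm_wordMap_trunc_le hc0 hT a i)

/-- Makes the image of a cylinder an affine copy of a bounded set, with linear part independent of
a. Both the covering and the transversality argument start from this. -/
theorem proj_eq_affineWord (hc0 : 0 < c) (hc1 : c < 1) (hT : ∀ i x, ‖T i x‖ ≤ c * ‖x‖)
    (a : Fin m → Space d) (i : ℕ → Fin m) (n : ℕ) :
    proj T a i = wordMap T (trunc i n) (proj T a (shift^[n] i)) +
      affineWord T a (trunc i n) 0 := by
  have h1 := (tendsto_add_atTop_iff_nat n).2 (tendsto_proj hc0 hc1 hT a i)
  have h2 := ((LinearMap.continuous_of_finiteDimensional (wordMap T (trunc i n))).tendsto _).comp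
    (tendsto_proj hc0 hc1 hT a (shift^[n] i))
  refine tendsto_nhds_unique h1 ((h2.add_const (affineWord T a (trunc i n) 0)).congr fun k => ?_)
  rw [add_comm k n, trunc_add, affineWord_append,
    affineWord_eq T a (trunc i n) (affineWord T a _ 0)]
  rfl

end Projection

/-- The image of a ball under a linear map is covered by `≲ ∏_{i<k} σ_i/σ_k` sets of diameter
`≲ σ_k`, where `k` is the integer part of `s`. -/
theorem exists_cover_image_ball {S : Space d →ₗ[ℝ] Space d} (hS : Function.Injective S) {s : ℝ}
    (hs : 0 ≤ s) (hsd : s < d) {R : ℝ} (hR : 0 < R) :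
    ∃ (n : ℕ) (t : Fin n → Set (Space d)),
      (∀ x, ‖x‖ ≤ R → ∃ p, S x ∈ t p) ∧
      (∀ p, ∀ x ∈ t p, ∀ y ∈ t p, ‖x - y‖ ≤ 2 * d * R * S.singularValues ⌊s⌋₊) ∧
      n * S.singularValues ⌊s⌋₊ ^ s ≤ 4 ^ d * svf s S := by
  obtain ⟨b, hb⟩ := S.exists_isSingularBasis (finrank_euclideanSpace_fin (𝕜 := ℝ) (n := d))
  have hk : ⌊s⌋₊ < d := (Nat.floor_lt hs).2 hsd
  set k := ⌊s⌋₊ with hkdef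
  set r := S.singularValues k with hr
  have hr0 : 0 < r := singularValues_pos hS hk
  -- In the i-th singular direction [-R, R] is cut into pieces that S maps to length at most 2Rr.
  -- Directions with singular value at most r need a single piece.
  let N : Fin d → ℕ := fun i => ⌈S.singularValues i / r⌉₊
  have hN1 : ∀ i : Fin d, 0 < N i := fun i =>
    Nat.ceil_pos.2 (div_pos (singularValues_pos hS i.2) hr0)
  have hN2 : ∀ i : Fin d, S.singularValues i ≤ N i * r := fun i =>
    (div_le_iff₀ hr0).1 (Nat.le_ceil _)
  have hN3 : ∀ i : Fin d, ((N i + 1 : ℕ) : ℝ) ≤ 4 * max 1 (S.singularValues i / r) := fun i => by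
    have h1 := Nat.ceil_lt_add_one (div_pos (singularValues_pos hS i.2) hr0).le
    have h2 := le_max_left 1 (S.singularValues i / r)
    have h3 := le_max_right 1 (S.singularValues i / r)
    push_cast
    simp only [N]
    linarith
  -- One extra index, since a coordinate equal to R has floor exactly N i.
  let ι := (i : Fin d) → Fin (N i + 1)
  let cell : ι → Set (Space d) := fun p =>
    S '' {x | ∀ i, inner ℝ (b i) x + R ∈ Set.Icc (2 * R / N i * p i) (2 * R / N i * (p i + 1))}
  let e : ι ≃ Fin (Fintype.card ι) := Fintype.equivFin ι
  have hmem : ∀ x, ‖x‖ ≤ R → ∃ p : ι, S x ∈ cell p := fun x hx => by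
    have hin : ∀ i, |inner ℝ (b i) x| ≤ R := fun i => by
      have := abs_real_inner_le_norm (b i) x
      rw [b.norm_eq_one, one_mul] at this
      exact this.trans hx
    have hN' : ∀ i, (0 : ℝ) < N i := fun i => by exact_mod_cast hN1 i
    have hq : ∀ i, 0 ≤ (inner ℝ (b i) x + R) * N i / (2 * R) := fun i =>
      div_nonneg (mul_nonneg (by linarith [neg_le_of_abs_le (hin i)]) (hN' i).le) (by linarith)
    have hq' : ∀ i, ⌊(inner ℝ (b i) x + R) * N i / (2 * R)⌋₊ < N i + 1 := fun i => by
      rw [Nat.lt_succ_iff]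
      refine Nat.floor_le_of_le ?_
      rw [div_le_iff₀ (by linarith), mul_comm]
      exact mul_le_mul_of_nonneg_left (by linarith [le_of_abs_le (hin i)]) (hN' i).le
    refine ⟨fun i => ⟨_, hq' i⟩, x, fun i => ⟨?_, ?_⟩, rfl⟩
    · have := Nat.floor_le (hq i)
      rw [le_div_iff₀ (by linarith)] at this
      rw [div_mul_eq_mul_div, div_le_iff₀ (hN' i), mul_comm]
      exact this
    · have := (Nat.lt_floor_add_one ((inner ℝ (b i) x + R) * N i / (2 * R))).le
      rw [div_le_iff₀ (by linarith)] at this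
      rw [div_mul_eq_mul_div, le_div_iff₀ (hN' i)]
      linarith
  have hdiam : ∀ p : ι, ∀ x ∈ cell p, ∀ y ∈ cell p, ‖x - y‖ ≤ 2 * d * R * r := by
    rintro p _ ⟨x, hx, rfl⟩ _ ⟨y, hy, rfl⟩
    have hxy : S x - S y = ∑ i, inner ℝ (b i) (x - y) • S (b i) := by
      rw [← map_sub]
      conv_lhs => rw [← b.sum_repr' (x - y)]
      simp
    rw [hxy]
    refine (norm_sum_le _ _).trans ?_
    have hterm : ∀ i ∈ Finset.univ, ‖inner ℝ (b i) (x - y) • S (b i)‖ ≤ 2 * R * r := fun i _ => by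
      have hN' : (0 : ℝ) < N i := by exact_mod_cast hN1 i
      rw [norm_smul, hb.norm_apply, Real.norm_eq_abs]
      have h1 : |inner ℝ (b i) (x - y)| ≤ 2 * R / N i := by
        obtain ⟨h1, h2⟩ := hx i
        obtain ⟨h3, h4⟩ := hy i
        rw [mul_add, mul_one] at h2 h4
        rw [inner_sub_right, abs_le]
        constructor <;> linarith
      calc |inner ℝ (b i) (x - y)| * S.singularValues i ≤ 2 * R / N i * (N i * r) :=
            mul_le_mul h1 (hN2 i) (S.singularValues_nonneg _) (by positivity)
        _ = 2 * R * r := by field_simp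
    refine (Finset.sum_le_card_nsmul _ _ _ hterm).trans (le_of_eq ?_)
    simp; ring
  have hcard : (Fintype.card ι : ℝ) * r ^ s ≤ 4 ^ d * svf s S := by
    have h1 : (Fintype.card ι : ℝ) = ∏ i : Fin d, ((N i + 1 : ℕ) : ℝ) := by
      simp [ι, Fintype.card_pi]
    have h2 : ∏ i : Fin d, ((N i + 1 : ℕ) : ℝ) ≤
        ∏ i : Fin d, 4 * max 1 (S.singularValues i / r) :=
      Finset.prod_le_prod (fun i _ => by positivity) fun i _ => hN3 i
    have h3 : ∏ i : Fin d, max 1 (S.singularValues i / r) =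
        ∏ i ∈ Finset.range k, S.singularValues i / r := by
      rw [← Finset.prod_range fun i => max 1 (S.singularValues i / r),
        ← Finset.prod_subset (Finset.range_subset_range.2 hk.le)]
      · refine Finset.prod_congr rfl fun i hi => max_eq_right ?_
        exact (one_le_div hr0).2 (S.singularValues_antitone (Finset.mem_range.1 hi).le)
      · intro i _ hi
        refine max_eq_left ((div_le_one hr0).2 (S.singularValues_antitone ?_))
        simpa using hi
    have h4 : svf s S = (∏ i ∈ Finset.range k, S.singularValues i / r) * r ^ s := by
      rw [svf, if_pos hsd.le, ← hkdef, ← hr, Finset.prod_div_distrib, Finset.prod_const,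
        Finset.card_range]
      conv_rhs => rw [← natFloor_add_fract hs, ← hkdef, Real.rpow_add hr0, Real.rpow_natCast]
      have : r ^ k ≠ 0 := by positivity
      field_simp
    rw [h1, h4, ← mul_assoc, ← h3]
    refine mul_le_mul_of_nonneg_right (h2.trans (le_of_eq ?_)) (by positivity)
    rw [Finset.prod_mul_distrib]; simp
  refine ⟨Fintype.card ι, fun p => cell (e.symm p), fun x hx => ?_, fun p => hdiam _, hcard⟩
  obtain ⟨p, hp⟩ := hmem x hx
  exact ⟨e p, by simpa using hp⟩

/-- If the sums of `φ^s` over the words `w j|_{ℓ_k}`, `|w| = k`, are summable in `k`, then the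
projected recurring set has dimension at most `s` for every translation vector. -/
theorem dimH_image_recurringSet_le {T : Fin m → Space d →ₗ[ℝ] Space d}
    (hinj : ∀ i, Function.Injective (T i)) {c : ℝ} (hc0 : 0 < c) (hc1 : c < 1)
    (hT : ∀ i x, ‖T i x‖ ≤ c * ‖x‖) {ℓ : ℕ → ℕ} {j : ℕ → Fin m} {s : ℝ} (hs : 0 ≤ s)
    (hsd : s < d) (hsum : Summable (targetSum (fun t w => svf t (wordMap T w)) ℓ j s))
    (a : Fin m → Space d) :
    dimH (proj T a '' recurringSet ℓ j) ≤ ENNReal.ofReal s := by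
  set R : ℝ := ‖a‖ * (1 - c)⁻¹ + 1 with hRdef
  have hR : 0 < R := by
    have : 0 ≤ ‖a‖ * (1 - c)⁻¹ := mul_nonneg (norm_nonneg _) (inv_nonneg.2 (by linarith))
    linarith
  have hk : ⌊s⌋₊ < d := (Nat.floor_lt hs).2 hsd
  have hd0 : 0 < d := (Nat.zero_le _).trans_lt hk
  have hd0' : (0 : ℝ) < d := by exact_mod_cast hd0
  have hcov := fun w => exists_cover_image_ball (wordMap_injective hinj w) hs hsd hR
  choose n t ht1 ht2 ht3 using hcov
  let v : (k : ℕ) → (Fin k → Fin m) → List (Fin m) := fun k i => List.ofFn i ++ trunc j (ℓ k)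
  -- Stage K uses only times k + K ≥ K, so its cost is a tail of the summable series.
  let ι : ℕ → Type := fun K => Σ k : ℕ, Σ i : Fin (k + K) → Fin m, Fin (n (v (k + K) i))
  let C : ℝ := 2 * d * R
  have hC : 0 < C := by positivity
  have hdiam : ∀ w p, Metric.ediam ((fun x => x + affineWord T a w 0) '' t w p) ≤
      ENNReal.ofReal (C * (wordMap T w).singularValues ⌊s⌋₊) := fun w p => by
    refine Metric.ediam_le ?_
    rintro _ ⟨x, hx, rfl⟩ _ ⟨y, hy, rfl⟩
    rw [edist_dist, dist_eq_norm, add_sub_add_right_eq_sub]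
    exact ENNReal.ofReal_le_ofReal (ht2 w p x hx y hy)
  have hσ : ∀ w : List (Fin m), (wordMap T w).singularValues ⌊s⌋₊ ≤ c ^ w.length := fun w =>
    singularValues_le_of_norm_le (norm_wordMap_le hc0.le hT w) hk
  have hH : μH[s] (proj T a '' recurringSet ℓ j) ≤
      liminf (fun K => ∑' q : ι K, Metric.ediam ((fun x => x + affineWord T a (v _ q.2.1) 0) ''
        t (v _ q.2.1) q.2.2) ^ s) atTop := by
    refine Measure.hausdorffMeasure_le_liminf_tsum (β := ℕ) (ι := ι) s _
      (fun K => ENNReal.ofReal (C * c ^ K)) ?_ _ ?_ ?_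
    · have : Tendsto (fun K : ℕ => C * c ^ K) atTop (𝓝 (C * 0)) :=
        (tendsto_pow_atTop_nhds_zero_of_lt_one hc0.le hc1).const_mul C
      simpa using ENNReal.tendsto_ofReal this
    · refine Eventually.of_forall fun K q => (hdiam _ _).trans (ENNReal.ofReal_le_ofReal ?_)
      refine mul_le_mul_of_nonneg_left ((hσ _).trans ?_) hC.le
      refine pow_le_pow_of_le_one hc0.le hc1.le ?_
      simp only [v, List.length_append, List.length_ofFn]
      omega
    · refine Eventually.of_forall fun K => ?_
      rintro _ ⟨i, hi, rfl⟩
      obtain ⟨k, hkK, hik⟩ := (frequently_atTop.1 hi) K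
      obtain ⟨k, rfl⟩ := Nat.exists_eq_add_of_le' hkK
      -- A visit at time k determines the first k + ℓ_k letters; what remains is a point of the ball
      -- of radius R, moved by the corresponding affine map.
      have hw : trunc i (k + K + ℓ (k + K)) = v (k + K) fun r => i r := by
        rw [trunc_add, hik]; rfl
      have hp := proj_eq_affineWord hc0 hc1 hT a i (k + K + ℓ (k + K))
      rw [hw] at hp
      obtain ⟨p, hp'⟩ := ht1 (v (k + K) fun r => i r)
        (proj T a (shift^[k + K + ℓ (k + K)] i))
        ((norm_proj_le hc0 hc1 hT a _).trans (by linarith))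
      exact Set.mem_iUnion.2 ⟨⟨k, fun r => i r, p⟩, _, hp', hp.symm⟩
  set g : ℕ → ℝ := targetSum (fun t w => svf t (wordMap T w)) ℓ j s with hg
  have hg0 : ∀ k, 0 ≤ g k := fun k =>
    Finset.sum_nonneg fun i _ => (svf_pos (wordMap_injective hinj _) hs).le
  have hbound : ∀ K, ∑' q : ι K, Metric.ediam ((fun x => x + affineWord T a (v _ q.2.1) 0) ''
        t (v _ q.2.1) q.2.2) ^ s ≤ ENNReal.ofReal (C ^ s * 4 ^ d * ∑' k, g (k + K)) := fun K => by
    have hgK : Summable fun k => g (k + K) := (summable_nat_add_iff K).2 hsum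
    rw [← tsum_mul_left, ENNReal.ofReal_tsum_of_nonneg
      (fun k => mul_nonneg (by positivity) (hg0 _)) (hgK.mul_left _), ENNReal.tsum_sigma']
    refine ENNReal.tsum_le_tsum fun k => ?_
    rw [ENNReal.tsum_sigma', tsum_fintype, hg, targetSum, Finset.mul_sum,
      ENNReal.ofReal_sum_of_nonneg fun i _ =>
        mul_nonneg (by positivity) (svf_pos (wordMap_injective hinj _) hs).le]
    refine Finset.sum_le_sum fun i _ => ?_
    rw [tsum_fintype]
    set w := List.ofFn i ++ trunc j (ℓ (k + K)) with hwdef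
    have hσ0 := (wordMap T w).singularValues_nonneg ⌊s⌋₊
    calc ∑ p : Fin (n w), Metric.ediam ((fun x => x + affineWord T a w 0) '' t w p) ^ s
        ≤ ∑ _p : Fin (n w), ENNReal.ofReal (C * (wordMap T w).singularValues ⌊s⌋₊) ^ s :=
          Finset.sum_le_sum fun p _ => ENNReal.rpow_le_rpow (hdiam w p) hs
      _ = ENNReal.ofReal (n w * (C * (wordMap T w).singularValues ⌊s⌋₊) ^ s) := by
          rw [Finset.sum_const, Finset.card_univ, Fintype.card_fin, nsmul_eq_mul,
            ENNReal.ofReal_mul (p := (n w : ℝ)) (by positivity), ENNReal.ofReal_natCast,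
            ENNReal.ofReal_rpow_of_nonneg (by positivity) hs]
      _ ≤ ENNReal.ofReal (C ^ s * 4 ^ d * svf s (wordMap T w)) := by
          refine ENNReal.ofReal_le_ofReal ?_
          rw [Real.mul_rpow hC.le hσ0, mul_left_comm, mul_assoc]
          exact mul_le_mul_of_nonneg_left (ht3 w) (by positivity)
  have hzero : μH[s] (proj T a '' recurringSet ℓ j) ≤ 0 := by
    refine hH.trans ((liminf_le_liminf (Eventually.of_forall hbound)).trans (le_of_eq ?_))
    refine Tendsto.liminf_eq ?_
    have := ENNReal.tendsto_ofReal ((tendsto_sum_nat_add g).const_mul (C ^ s * 4 ^ d))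
    simpa using this
  rw [ENNReal.ofReal_eq_coe_nnreal hs]
  refine dimH_le_of_hausdorffMeasure_ne_top ?_
  exact (hzero.trans_lt (by simp)).ne

end ShrinkingTargets

/-! ### Transversality in the translation vector. -/

namespace ShrinkingTargets

open Module

variable {d m : ℕ}

/-- In singular coordinates the set lies in a box: use the constraint on S y in the first j
directions and the constraint on y in the others. The assumption R ≥ 1 absorbs R^(d - j) into R^d.
-/
theorem volume_ball_inter_preimage_le {S : Space d →ₗ[ℝ] Space d} (hS : Function.Injective S)
    {R r : ℝ} (hR : 1 ≤ R) (hr : 0 < r) {j : ℕ} (hj : j ≤ d) :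
    volume {y : Space d | ‖y‖ ≤ R ∧ ‖S y‖ ≤ r} ≤
      ENNReal.ofReal ((2 * R) ^ d * (r ^ j / topProd j S)) := by
  obtain ⟨b, hb⟩ := S.exists_isSingularBasis (finrank_euclideanSpace_fin (𝕜 := ℝ) (n := d))
  have hR0 : 0 < R := by linarith
  let u : ℕ → ℝ := fun i => if i < j then r / S.singularValues i else R
  have hu0 : ∀ i : Fin d, 0 ≤ u i := fun i => by
    simp only [u]; split_ifs
    · exact div_nonneg hr.le (S.singularValues_nonneg _)
    · exact hR0.le
  let box : Set (Fin d → ℝ) := Set.Icc (fun i => -u i) (fun i => u i)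
  have hsub : {y : Space d | ‖y‖ ≤ R ∧ ‖S y‖ ≤ r} ⊆
      b.repr ⁻¹' ((WithLp.ofLp : Space d → (Fin d → ℝ)) ⁻¹' box) := by
    rintro y ⟨hy1, hy2⟩
    have key : ∀ i : Fin d, |inner ℝ (b i) y| ≤ u i := fun i => by
      simp only [u]; split_ifs with hij
      · have h1 : (S.singularValues i * inner ℝ (b i) y) ^ 2 ≤ ‖S y‖ ^ 2 := by
          rw [hb.norm_sq]
          exact Finset.single_le_sum
            (f := fun i : Fin d => (S.singularValues i * inner ℝ (b i) y) ^ 2)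
            (fun k _ => sq_nonneg _) (Finset.mem_univ i)
        have h2 := abs_le_of_sq_le_sq h1 (norm_nonneg _)
        rw [abs_mul, abs_of_nonneg (S.singularValues_nonneg _)] at h2
        rw [le_div_iff₀ (singularValues_pos hS i.2), mul_comm]
        exact h2.trans hy2
      · have := abs_real_inner_le_norm (b i) y
        rw [b.norm_eq_one, one_mul] at this
        exact this.trans hy1
    refine ⟨fun i => ?_, fun i => ?_⟩
    · simpa [b.repr_apply_apply] using (abs_le.1 (key i)).1
    · simpa [b.repr_apply_apply] using (abs_le.1 (key i)).2
  refine (measure_mono hsub).trans ?_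
  rw [b.measurePreserving_repr.measure_preimage, (PiLp.volume_preserving_ofLp _).measure_preimage,
    Real.volume_Icc_pi]
  rotate_left
  · exact measurableSet_Icc.nullMeasurableSet
  · exact (measurableSet_Icc.preimage (WithLp.measurable_ofLp _ _)).nullMeasurableSet
  rw [← ENNReal.ofReal_prod_of_nonneg fun i _ => by linarith [hu0 i]]
  refine ENNReal.ofReal_le_ofReal ?_
  have h1 : ∏ i : Fin d, (u i - -u i) = 2 ^ d * ∏ i ∈ Finset.range d, u i := by
    rw [Finset.prod_range, ← Fin.prod_const, ← Finset.prod_mul_distrib]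
    exact Finset.prod_congr rfl fun i _ => by ring
  have h2 : ∏ i ∈ Finset.range d, u i = (r ^ j / topProd j S) * R ^ (d - j) := by
    rw [← Finset.prod_range_mul_prod_Ico _ hj]
    congr 1
    · rw [Finset.prod_congr rfl fun i hi => if_pos (Finset.mem_range.1 hi),
        Finset.prod_div_distrib, Finset.prod_const, Finset.card_range, topProd]
    · rw [Finset.prod_congr rfl fun i hi => if_neg (not_lt.2 (Finset.mem_Ico.1 hi).1),
        Finset.prod_const, Nat.card_Ico]
  have h3 : 0 ≤ r ^ j / topProd j S := div_nonneg (by positivity) (topProd_nonneg _ _)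
  rw [h1, h2, mul_pow, mul_assoc, mul_comm (r ^ j / topProd j S)]
  exact mul_le_mul_of_nonneg_left (mul_le_mul_of_nonneg_right
    (pow_le_pow_right₀ hR (Nat.sub_le _ _)) h3) (by positivity)

theorem pow_le_abs_det {A : Space d →ₗ[ℝ] Space d} {κ : ℝ} (hκ : 0 ≤ κ)
    (hA : ∀ x, κ * ‖x‖ ≤ ‖A x‖) : κ ^ d ≤ |LinearMap.det A| := by
  rw [abs_det_eq_topProd, topProd]
  calc κ ^ d = ∏ _i ∈ Finset.range d, κ := by simp
    _ ≤ _ := Finset.prod_le_prod (fun _ _ => hκ) fun i hi =>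
      le_singularValues_of_le_norm hA (Finset.mem_range.1 hi)

/-- Averaging over translates in the direction of `ι` bounds the measure of a slab by the measure
of its section. -/
theorem volume_slab_mul_le {V : Type*} [NormedAddCommGroup V] [NormedSpace ℝ V]
    [FiniteDimensional ℝ V] [MeasurableSpace V] [BorelSpace V] (μ : Measure V)
    [μ.IsAddHaarMeasure] (Δ : V →ₗ[ℝ] Space d) (ι : Space d →ₗ[ℝ] V) {κ M : ℝ}
    (hκ : 0 < κ) (hM : 0 ≤ M) (hΔι : ∀ x, κ * ‖x‖ ≤ ‖Δ (ι x)‖) (hι : ∀ x, ‖ι x‖ ≤ ‖x‖)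
    (hΔ : ∀ a, ‖Δ a‖ ≤ M * ‖a‖) (S : Space d →ₗ[ℝ] Space d) (ρ r : ℝ) :
    μ {a | ‖a‖ ≤ ρ ∧ ‖S (Δ a)‖ ≤ r} * volume (Metric.closedBall (0 : Space d) 1) ≤
      ENNReal.ofReal (κ ^ d)⁻¹ * volume {y : Space d | ‖y‖ ≤ M * ρ ∧ ‖S y‖ ≤ r} *
        μ (Metric.closedBall 0 (ρ + 1)) := by
  set X : Set V := {a | ‖a‖ ≤ ρ ∧ ‖S (Δ a)‖ ≤ r} with hX
  set Y : Set (Space d) := {y | ‖y‖ ≤ M * ρ ∧ ‖S y‖ ≤ r} with hY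
  set ν := (volume : Measure (Space d)).restrict (Metric.closedBall 0 1) with hν
  have hXm : MeasurableSet X := by
    refine IsClosed.measurableSet ((isClosed_le continuous_norm continuous_const).inter
      (isClosed_le (LinearMap.continuous_of_finiteDimensional (S ∘ₗ Δ)).norm continuous_const))
  have hιc : Continuous ι := LinearMap.continuous_of_finiteDimensional ι
  have hadd : Measurable fun p : Space d × V => p.2 + ι p.1 :=
    (continuous_snd.add (hιc.comp continuous_fst)).measurable
  -- Fubini for the pairs (b, a) with |b| ≤ 1 and a + ι b in X. For fixed b the section is a
  -- translate of X. For fixed a it lies in the preimage under Δ ∘ ι of a translate of Y, and it is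
  -- empty unless |a| ≤ ρ + 1.
  have hZ : MeasurableSet ((fun p : Space d × V => p.2 + ι p.1) ⁻¹' X) := hadd hXm
  have h1 : (ν.prod μ) ((fun p : Space d × V => p.2 + ι p.1) ⁻¹' X) =
      μ X * volume (Metric.closedBall (0 : Space d) 1) := by
    rw [Measure.prod_apply hZ]
    have : ∀ b : Space d, μ (Prod.mk b ⁻¹' ((fun p : Space d × V => p.2 + ι p.1) ⁻¹' X)) = μ X :=
      fun b => measure_preimage_add_right μ (ι b) X
    simp only [this, lintegral_const, hν, Measure.restrict_apply_univ]
  have hdet : κ ^ d ≤ |LinearMap.det (Δ ∘ₗ ι)| := pow_le_abs_det hκ.le hΔι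
  have hdet0 : LinearMap.det (Δ ∘ₗ ι) ≠ 0 := by
    intro h0
    rw [h0, abs_zero] at hdet
    exact absurd hdet (not_le.2 (by positivity))
  have h2 : ∀ a : V, ν ((fun b => (b, a)) ⁻¹' ((fun p : Space d × V => p.2 + ι p.1) ⁻¹' X)) ≤
      (Metric.closedBall (0 : V) (ρ + 1)).indicator
        (fun _ => ENNReal.ofReal (κ ^ d)⁻¹ * volume Y) a := fun a => by
    rw [hν, Measure.restrict_apply' Metric.isClosed_closedBall.measurableSet]
    by_cases ha : a ∈ Metric.closedBall (0 : V) (ρ + 1)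
    · rw [Set.indicator_of_mem ha]
      have hsub : (fun b => (b, a)) ⁻¹' ((fun p : Space d × V => p.2 + ι p.1) ⁻¹' X) ∩
          Metric.closedBall (0 : Space d) 1 ⊆ (Δ ∘ₗ ι) ⁻¹' ((fun y => Δ a + y) ⁻¹' Y) := by
        rintro b ⟨⟨hb1, hb2⟩, -⟩
        simp only [map_add] at hb2
        refine ⟨?_, by simpa using hb2⟩
        have := hΔ (a + ι b)
        rw [map_add] at this
        exact this.trans (mul_le_mul_of_nonneg_left hb1 hM)
      refine (measure_mono hsub).trans ?_
      rw [Measure.addHaar_preimage_linearMap _ hdet0, measure_preimage_add]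
      refine mul_le_mul_left (ENNReal.ofReal_le_ofReal ?_) _
      rw [abs_inv]
      exact inv_anti₀ (by positivity) hdet
    · rw [Set.indicator_of_notMem ha, nonpos_iff_eq_zero]
      convert measure_empty (μ := (volume : Measure (Space d)))
      rw [Set.eq_empty_iff_forall_notMem]
      rintro b ⟨⟨hb1, -⟩, hb3⟩
      refine ha (mem_closedBall_zero_iff.2 ?_)
      have h3 : ‖a‖ ≤ ‖a + ι b‖ + ‖ι b‖ := by
        simpa using norm_sub_le (a + ι b) (ι b)
      have h4 := (hι b).trans (mem_closedBall_zero_iff.1 hb3)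
      simp only at hb1
      linarith
  rw [← h1, Measure.prod_apply_symm hZ]
  refine (lintegral_mono h2).trans ?_
  rw [lintegral_indicator Metric.isClosed_closedBall.measurableSet, lintegral_const,
    Measure.restrict_apply_univ]

section Transversality

variable {T : Fin m → Space d →ₗ[ℝ] Space d} {c : ℝ}

theorem exists_projLinear (hc0 : 0 < c) (hc1 : c < 1) (hT : ∀ i x, ‖T i x‖ ≤ c * ‖x‖)
    (i : ℕ → Fin m) : ∃ L : (Fin m → Space d) →ₗ[ℝ] Space d, ∀ a, L a = proj T a i := by
  refine ⟨⟨⟨fun a => proj T a i, fun a b => ?_⟩, fun x a => ?_⟩, fun a => rfl⟩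
  · refine (hasSum_proj hc0 hc1 hT (a + b) i).unique ?_
    simpa using (hasSum_proj hc0 hc1 hT a i).add (hasSum_proj hc0 hc1 hT b i)
  · refine (hasSum_proj hc0 hc1 hT (x • a) i).unique ?_
    simpa using (hasSum_proj hc0 hc1 hT a i).const_smul x

/-- Only the first letter enters uncontracted. For c < 1/2 the factor c/(1 - c) is below 1, which
lets the first letter dominate the tail. -/
theorem norm_proj_sub_le (hc0 : 0 < c) (hc1 : c < 1) (hT : ∀ i x, ‖T i x‖ ≤ c * ‖x‖)
    (a : Fin m → Space d) (i : ℕ → Fin m) :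
    ‖proj T a i - a (i 0)‖ ≤ c * (1 - c)⁻¹ * ‖a‖ := by
  have h := proj_eq_affineWord hc0 hc1 hT a i 1
  have e1 : affineWord T a (trunc i 1) 0 = a (i 0) := by simp [trunc, affineWord]
  have e2 : wordMap T (trunc i 1) = T (i 0) := by simp [trunc, wordMap]
  rw [e1, e2] at h
  rw [h, add_sub_cancel_right]
  refine (hT _ _).trans ?_
  have := mul_le_mul_of_nonneg_left (norm_proj_le hc0 hc1 hT a (shift^[1] i)) hc0.le
  linarith

/-- The direction `b ↦ (b, -b)` in the coordinates `p, q` of the translation vector. -/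
theorem exists_transversal_direction {p q : Fin m} (hpq : p ≠ q) :
    ∃ ι : Space d →ₗ[ℝ] (Fin m → Space d),
      (∀ x, ι x p = x) ∧ (∀ x, ι x q = -x) ∧ ∀ x, ‖ι x‖ ≤ ‖x‖ := by
  refine ⟨LinearMap.single ℝ (fun _ => Space d) p - LinearMap.single ℝ (fun _ => Space d) q,
    fun x => by simp [hpq], fun x => by simp [hpq.symm], fun x => ?_⟩
  rw [pi_norm_le_iff_of_nonneg (norm_nonneg _)]
  intro r
  by_cases hp : r = p
  · subst hp; simp [hpq]
  · by_cases hq : r = q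
    · subst hq; simp [hpq.symm]
    · simp [hp, hq]

/-- Interpolates the bounds at ⌊t⌋ and ⌊t⌋ + 1 with weights 1 - {t} and {t}; both r^t and φ^t are
the corresponding geometric means, and C is preserved. -/
theorem geometric_mean_bound {x C r t : ℝ} (hx : 0 ≤ x) (hC : 0 ≤ C) (hr : 0 < r) (ht : 0 ≤ t)
    (htd : t ≤ d) {S : Space d →ₗ[ℝ] Space d} (hS : Function.Injective S)
    (h : ∀ j ≤ d, x ≤ C * (r ^ j / topProd j S)) : x ≤ C * (r ^ t / svf t S) := by
  have hk : ⌊t⌋₊ ≤ d := Nat.floor_le_of_le htd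
  have h1 := h _ hk
  by_cases hf : Int.fract t = 0
  · have e : t = ⌊t⌋₊ := by
      have := natFloor_add_fract ht
      rw [hf, add_zero] at this; exact this.symm
    rw [e, svf_natCast S hk, Real.rpow_natCast]
    exact h1
  · have hk' := floor_lt_of_fract_ne_zero ht htd hf
    have h2 := h _ hk'
    have hf0 := Int.fract_nonneg t
    have hf1 : 0 ≤ 1 - Int.fract t := by linarith [Int.fract_lt_one t]
    have hω := topProd_pos hS hk
    have hω' := topProd_pos hS hk'
    have hq1 : 0 ≤ r ^ ⌊t⌋₊ / topProd ⌊t⌋₊ S := by positivity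
    have hq2 : 0 ≤ r ^ (⌊t⌋₊ + 1) / topProd (⌊t⌋₊ + 1) S := by positivity
    calc x = x ^ (1 - Int.fract t) * x ^ Int.fract t := by
          rw [← Real.rpow_add_of_nonneg hx hf1 hf0, sub_add_cancel, Real.rpow_one]
      _ ≤ (C * (r ^ ⌊t⌋₊ / topProd ⌊t⌋₊ S)) ^ (1 - Int.fract t) *
          (C * (r ^ (⌊t⌋₊ + 1) / topProd (⌊t⌋₊ + 1) S)) ^ Int.fract t :=
        mul_le_mul (Real.rpow_le_rpow hx h1 hf1) (Real.rpow_le_rpow hx h2 hf0)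
          (Real.rpow_nonneg hx _) (Real.rpow_nonneg (mul_nonneg hC hq1) _)
      _ = C * (r ^ t / svf t S) := by
        rw [svf_eq_topProd_rpow hS ht htd, Real.mul_rpow hC hq1, Real.mul_rpow hC hq2,
          Real.div_rpow (by positivity) hω.le, Real.div_rpow (by positivity) hω'.le,
          mul_mul_mul_comm, ← Real.rpow_add_of_nonneg hC hf1 hf0, sub_add_cancel, Real.rpow_one,
          div_mul_div_comm, ← Real.rpow_natCast, ← Real.rpow_natCast, ← Real.rpow_mul hr.le,
          ← Real.rpow_mul hr.le, ← Real.rpow_add hr]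
        congr 3
        push_cast
        have := natFloor_add_fract ht
        linarith

/-- Transversality: two points of the attractor whose codes separate after the word `u` are within
`r` of each other only for translation vectors in a set of measure `≲ r^t / φ^t(T_u)`. -/
theorem exists_transversality_const (hinj : ∀ i, Function.Injective (T i)) (hc0 : 0 < c)
    (hc1 : c < 1 / 2) (hT : ∀ i x, ‖T i x‖ ≤ c * ‖x‖) {ρ : ℝ} (hρ : 0 < ρ) :
    ∃ C : ℝ, 0 < C ∧ ∀ (i k : ℕ → Fin m) (n : ℕ), trunc i n = trunc k n → i n ≠ k n →
      ∀ t : ℝ, 0 ≤ t → t ≤ d → ∀ r : ℝ, 0 < r →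
        volume {a : Fin m → Space d | ‖a‖ ≤ ρ ∧ ‖proj T a i - proj T a k‖ ≤ r} ≤
          ENNReal.ofReal (C * (r ^ t / svf t (wordMap T (trunc i n)))) := by
  have hc1' : c < 1 := by linarith
  -- Along the direction (x, -x) the differing letters contribute 2x to π(i) - π(k), and the two
  -- tails take away at most c/(1 - c) ‖x‖ each. Positivity of κ is where c < 1/2 is used.
  set κ : ℝ := 2 - 2 * (c * (1 - c)⁻¹) with hκdef
  have hκ : 0 < κ := by
    have h1 : c * (1 - c)⁻¹ < 1 := by
      rw [← div_eq_mul_inv, div_lt_one (by linarith)]; linarith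
    linarith
  set M : ℝ := 2 * (1 - c)⁻¹ with hMdef
  have hM : 0 ≤ M := mul_nonneg zero_le_two (inv_nonneg.2 (by linarith))
  set R : ℝ := max 1 (M * ρ) with hRdef
  have hR : 1 ≤ R := le_max_left _ _
  set v : ℝ := volume.real (Metric.closedBall (0 : Space d) 1) with hv
  have hv0 : 0 < v := by
    refine ENNReal.toReal_pos ?_ measure_closedBall_lt_top.ne
    exact (Metric.measure_closedBall_pos volume _ one_pos).ne'
  set V : ℝ := volume.real (Metric.closedBall (0 : Fin m → Space d) (ρ + 1)) with hV
  have hV0 : 0 < V := by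
    refine ENNReal.toReal_pos ?_ measure_closedBall_lt_top.ne
    exact (Metric.measure_closedBall_pos volume _ (by linarith)).ne'
  set C : ℝ := (κ ^ d)⁻¹ * (2 * R) ^ d * V / v with hC
  have hC0 : 0 < C := by positivity
  refine ⟨C, hC0, fun i k n hn hne t ht htd r hr => ?_⟩
  set S := wordMap T (trunc i n) with hS
  have hSinj : Function.Injective S := wordMap_injective hinj _
  obtain ⟨Li, hLi⟩ := exists_projLinear hc0 hc1' hT (shift^[n] i)
  obtain ⟨Lk, hLk⟩ := exists_projLinear hc0 hc1' hT (shift^[n] k)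
  obtain ⟨ι, hιi, hιk, hι⟩ := exists_transversal_direction (d := d) hne
  have hsub : ∀ a, proj T a i - proj T a k = S ((Li - Lk) a) := fun a => by
    rw [proj_eq_affineWord hc0 hc1' hT a i n, proj_eq_affineWord hc0 hc1' hT a k n, ← hn,
      LinearMap.sub_apply, map_sub, hLi, hLk]
    abel
  have hΔ : ∀ a, ‖(Li - Lk) a‖ ≤ M * ‖a‖ := fun a => by
    rw [LinearMap.sub_apply, hLi, hLk]
    refine (norm_sub_le _ _).trans ?_
    have h1 := norm_proj_le hc0 hc1' hT a (shift^[n] i)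
    have h2 := norm_proj_le hc0 hc1' hT a (shift^[n] k)
    rw [hMdef]; linarith
  have hΔι : ∀ x, κ * ‖x‖ ≤ ‖(Li - Lk) (ι x)‖ := fun x => by
    have h1 := norm_proj_sub_le hc0 hc1' hT (ι x) (shift^[n] i)
    have h2 := norm_proj_sub_le hc0 hc1' hT (ι x) (shift^[n] k)
    rw [shift_iterate_apply, zero_add] at h1 h2
    rw [hιi] at h1
    rw [hιk] at h2
    rw [LinearMap.sub_apply, hLi, hLk]
    set y := proj T (ι x) (shift^[n] i)
    set z := proj T (ι x) (shift^[n] k)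
    have h3 : ‖(2 : ℝ) • x‖ ≤ ‖y - z‖ + ‖y - x‖ + ‖z - -x‖ := by
      have : (2 : ℝ) • x = (y - z) - (y - x) + (z - -x) := by rw [two_smul]; abel
      rw [this]
      refine (norm_add_le _ _).trans ?_
      linarith [norm_sub_le (y - z) (y - x)]
    rw [norm_smul, Real.norm_eq_abs, abs_of_pos two_pos] at h3
    have h4 : c * (1 - c)⁻¹ * ‖ι x‖ ≤ c * (1 - c)⁻¹ * ‖x‖ :=
      mul_le_mul_of_nonneg_left (hι x) (mul_nonneg hc0.le (inv_nonneg.2 (by linarith)))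
    rw [hκdef]
    linarith
  simp only [hsub]
  set X := {a : Fin m → Space d | ‖a‖ ≤ ρ ∧ ‖S ((Li - Lk) a)‖ ≤ r} with hX
  have hXfin : volume X ≠ ⊤ := by
    refine (lt_of_le_of_lt (measure_mono ?_)
      (measure_closedBall_lt_top (μ := volume) (x := (0 : Fin m → Space d)) (r := ρ))).ne
    exact fun a ha => mem_closedBall_zero_iff.2 ha.1
  have hslab := volume_slab_mul_le (volume : Measure (Fin m → Space d)) (Li - Lk) ι hκ hM hΔι hι hΔ
    S ρ r
  have hreal : ∀ j ≤ d, volume.real X ≤ C * (r ^ j / topProd j S) := fun j hj => by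
    have hω := topProd_pos hSinj hj
    have h1 : volume {y : Space d | ‖y‖ ≤ M * ρ ∧ ‖S y‖ ≤ r} ≤
        ENNReal.ofReal ((2 * R) ^ d * (r ^ j / topProd j S)) := by
      have hs : {y : Space d | ‖y‖ ≤ M * ρ ∧ ‖S y‖ ≤ r} ⊆ {y : Space d | ‖y‖ ≤ R ∧ ‖S y‖ ≤ r} :=
        fun y hy => ⟨hy.1.trans (le_max_right _ _), hy.2⟩
      exact (measure_mono hs).trans (volume_ball_inter_preimage_le hSinj hR hr hj)
    have h2 : volume X * volume (Metric.closedBall (0 : Space d) 1) ≤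
        ENNReal.ofReal ((κ ^ d)⁻¹ * ((2 * R) ^ d * (r ^ j / topProd j S)) * V) := by
      rw [ENNReal.ofReal_mul (by positivity), ENNReal.ofReal_mul (by positivity), hV,
        ofReal_measureReal measure_closedBall_lt_top.ne]
      exact hslab.trans (mul_le_mul_left (mul_le_mul_right h1 _) _)
    have h3 := ENNReal.toReal_mono ENNReal.ofReal_ne_top h2
    rw [ENNReal.toReal_mul, ENNReal.toReal_ofReal (by positivity)] at h3
    change volume.real X * v ≤ _ at h3
    rw [← le_div_iff₀ hv0] at h3
    refine h3.trans (le_of_eq ?_)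
    rw [hC]; ring
  have hfinal := geometric_mean_bound measureReal_nonneg hC0.le hr ht htd hSinj hreal
  rw [← ofReal_measureReal hXfin]
  exact ENNReal.ofReal_le_ofReal hfinal

end Transversality

end ShrinkingTargets

/-! ### A Frostman measure on the symbolic recurring set. -/

namespace ShrinkingTargets

variable {d m : ℕ} {φ : ℝ → List (Fin m) → ℝ} {D α : ℝ}

/-- The `q`-th block of length `N` of a sequence. -/
def block (N : ℕ) (i : ℕ → Fin m) (q : ℕ) : Fin N → Fin m := fun r => i (q * N + r)

theorem trunc_block (N : ℕ) (i : ℕ → Fin m) (q : ℕ) :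
    trunc i ((q + 1) * N) = trunc i (q * N) ++ List.ofFn (block N i q) := by
  rw [add_mul, one_mul, trunc_add]
  congr 1
  refine congrArg List.ofFn (funext fun r => ?_)
  rw [shift_iterate_apply, block, add_comm]

theorem measurableSet_trunc_eq (k l : ℕ) (j : ℕ → Fin m) :
    MeasurableSet {i : ℕ → Fin m | trunc (shift^[k] i) l = trunc j l} := by
  have : {i : ℕ → Fin m | trunc (shift^[k] i) l = trunc j l} =
      ⋂ r : ℕ, ⋂ _ : r < l, (fun i : ℕ → Fin m => i (r + k)) ⁻¹' {j r} := by
    ext i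
    simp [trunc_eq_iff, shift_iterate_apply]
  rw [this]
  exact MeasurableSet.iInter fun r => MeasurableSet.iInter fun _ =>
    measurable_pi_apply _ (measurableSet_singleton _)

theorem measurableSet_recurringSet (ℓ : ℕ → ℕ) (j : ℕ → Fin m) :
    MeasurableSet (recurringSet ℓ j) := by
  have : recurringSet ℓ j = ⋂ K : ℕ, ⋃ k : ℕ, ⋃ _ : K ≤ k,
      {i : ℕ → Fin m | trunc (shift^[k] i) (ℓ k) = trunc j (ℓ k)} := by
    ext i
    simp [recurringSet, frequently_atTop]
  rw [this]
  exact MeasurableSet.iInter fun K => MeasurableSet.iUnion fun k => MeasurableSet.iUnion fun _ =>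
    measurableSet_trunc_eq k _ j

namespace QuasiPotential

/-- Products of block weights that are `φ(u)/Z_N` on the free blocks and Dirac masses on the blocks
that carry the target, are dominated by `φ` if the free stretches are long enough. -/
theorem prod_weight_le (h : QuasiPotential φ d D α) {s : ℝ} (hs : 0 ≤ s) {N : ℕ} (hm : 0 < m)
    (j : ℕ → Fin m) {e b : ℕ → ℕ} (he0 : e 0 = 0) (heb : ∀ p, e p ≤ b p)
    (hbe : ∀ p, b p < e (p + 1)) (w : ℕ → (Fin N → Fin m) → ℝ)
    (hfree : ∀ p q, e p ≤ q → q < b p → ∀ u,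
      w q u = φ s (List.ofFn u) / partitionSum φ s N)
    (hfix : ∀ p q, b p ≤ q → q < e (p + 1) → ∀ u,
      w q u = if u = block N j (q - b p) then 1 else 0)
    (hlong : ∀ p, 1 ≤ (D * partitionSum φ s N) ^ (b p - e p) *
      (D * φ s (trunc j ((e (p + 1) - b p) * N))))
    (hκ : 1 ≤ D * partitionSum φ s N) (i : ℕ → Fin m) (q : ℕ) :
    ∏ q' ∈ Finset.range q, w q' (block N i q') ≤ φ s (trunc i (q * N)) := by
  set Z := partitionSum φ s N with hZ
  have hZ0 : 0 < Z := h.partitionSum_pos hm hs N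
  set G : ℕ → ℝ := fun q => ∏ q' ∈ Finset.range q, w q' (block N i q') with hG
  have hGs : ∀ q, G (q + 1) = G q * w q (block N i q) := fun q => Finset.prod_range_succ _ _
  have hφ := h.pos s hs
  -- On a free stretch each block improves the comparison of G with φ^s by a factor D Z; the surplus
  -- is saved for the coming target.
  have hstage : ∀ p, G (e p) ≤ φ s (trunc i (e p * N)) →
      ∀ x, e p + x ≤ b p → G (e p + x) * (D * Z) ^ x ≤ φ s (trunc i ((e p + x) * N)) := by
    intro p hp x
    induction x with
    | zero => intro _; simpa using hp
    | succ x ih =>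
      intro hx
      have hx' : e p + x < b p := by omega
      rw [← add_assoc, hGs, hfree p _ (Nat.le_add_right _ _) hx', trunc_block, pow_succ]
      calc _ = D * (G (e p + x) * (D * Z) ^ x) * φ s (List.ofFn (block N i (e p + x))) := by
            field_simp
        _ ≤ D * φ s (trunc i ((e p + x) * N)) * φ s (List.ofFn (block N i (e p + x))) :=
            mul_le_mul_of_nonneg_right
              (mul_le_mul_of_nonneg_left (ih hx'.le) h.const_pos.le) (hφ _).le
        _ ≤ _ := h.le_append s hs _ _
  have hG0 : ∀ p, ∀ x, e p + x ≤ b p → G (e p) ≤ φ s (trunc i (e p * N)) →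
      0 ≤ G (e p) → 0 ≤ G (e p + x) := by
    intro p x
    induction x with
    | zero => intro _ _ h0; exact h0
    | succ x ih =>
      intro hx hp h0
      rw [← add_assoc, hGs, hfree p _ (Nat.le_add_right _ _) (by omega)]
      exact mul_nonneg (ih (by omega) hp h0) (div_nonneg (hφ _).le hZ0.le)
  -- On a target stretch the mass either stays constant while the sequence copies j, or drops to 0.
  have hdirac : ∀ p, ∀ y, b p + y ≤ e (p + 1) → G (b p + y) = 0 ∨
      (G (b p + y) = G (b p) ∧ ∀ r < y * N, i (r + b p * N) = j r) := by
    intro p y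
    induction y with
    | zero => intro _; exact Or.inr ⟨rfl, by simp⟩
    | succ y ih =>
      intro hy
      rw [← add_assoc, hGs, hfix p _ (Nat.le_add_right _ _) (by omega)]
      rcases ih (by omega) with h0 | ⟨h1, h2⟩
      · left; rw [h0, zero_mul]
      · split_ifs with hu
        · right
          refine ⟨by rw [mul_one, h1], fun r hr => ?_⟩
          by_cases hry : r < y * N
          · exact h2 r hry
          · have hr' : r - y * N < N := by rw [add_mul] at hr; omega
            have := congrFun hu ⟨r - y * N, hr'⟩
            simp only [block, Nat.add_sub_cancel_left] at this
            rw [show (b p + y) * N + (r - y * N) = r + b p * N by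
              rw [add_mul]; omega, show y * N + (r - y * N) = r by omega] at this
            exact this
        · left; rw [mul_zero]
  -- The surplus of the free stretch pays for the target by `hlong`. It pays for partial targets
  -- too, because φ^s decreases when a word is extended.
  have hpast : ∀ p, G (e p) ≤ φ s (trunc i (e p * N)) → 0 ≤ G (e p) →
      ∀ q, e p ≤ q → q ≤ e (p + 1) → G q ≤ φ s (trunc i (q * N)) ∧ 0 ≤ G q := by
    intro p hp h0 q hq1 hq2
    have hκ0 : 0 < D * Z := by linarith
    by_cases hqb : q ≤ b p
    · obtain ⟨x, rfl⟩ := Nat.exists_eq_add_of_le hq1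
      have h0' := hG0 p x hqb hp h0
      exact ⟨(le_mul_of_one_le_right h0' (one_le_pow₀ hκ)).trans (hstage p hp x hqb), h0'⟩
    · obtain ⟨y, rfl⟩ := Nat.exists_eq_add_of_le (not_le.1 hqb).le
      rcases hdirac p y hq2 with h1 | ⟨h1, h2⟩
      · rw [h1]; exact ⟨(hφ _).le, le_rfl⟩
      · obtain ⟨x, hx⟩ := Nat.exists_eq_add_of_le (heb p)
        have h3 := hstage p hp x hx.ge
        have h0' := hG0 p x hx.ge hp h0
        rw [← hx] at h3 h0'
        rw [h1]
        refine ⟨?_, h0'⟩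
        have e1 : trunc i ((b p + y) * N) = trunc i (b p * N) ++ trunc j (y * N) := by
          rw [add_mul, trunc_add]
          congr 1
          rw [trunc_eq_iff]
          intro r hr
          rw [shift_iterate_apply]
          exact h2 r hr
        obtain ⟨z, hz⟩ : ∃ z, (e (p + 1) - b p) * N = y * N + z := by
          refine Nat.exists_eq_add_of_le (Nat.mul_le_mul_right _ (by omega))
        have h4 : φ s (trunc j ((e (p + 1) - b p) * N)) ≤ φ s (trunc j (y * N)) := by
          rw [hz, trunc_add]
          exact h.append_le_left hs _ _
        have h5 := hlong p
        rw [show b p - e p = x by omega] at h5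
        rw [e1]
        calc G (b p) ≤ G (b p) * ((D * Z) ^ x *
              (D * φ s (trunc j ((e (p + 1) - b p) * N)))) := le_mul_of_one_le_right h0' h5
          _ = G (b p) * (D * Z) ^ x * (D * φ s (trunc j ((e (p + 1) - b p) * N))) := by ring
          _ ≤ φ s (trunc i (b p * N)) * (D * φ s (trunc j (y * N))) :=
              mul_le_mul h3 (mul_le_mul_of_nonneg_left h4 h.const_pos.le)
                (mul_nonneg h.const_pos.le (hφ _).le) (hφ _).le
          _ = D * φ s (trunc i (b p * N)) * φ s (trunc j (y * N)) := by ring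
          _ ≤ _ := h.le_append s hs _ _
  have hstart : ∀ p, G (e p) ≤ φ s (trunc i (e p * N)) ∧ 0 ≤ G (e p) := by
    intro p
    induction p with
    | zero =>
      rw [he0, zero_mul]
      simp [hG, trunc, h.nil hs]
    | succ p ih =>
      exact hpast p ih.1 ih.2 _ ((heb p).trans (hbe p).le) le_rfl
  have hmono : StrictMono e := strictMono_nat_of_lt_succ fun p => (heb p).trans_lt (hbe p)
  have hall : ∀ p, ∀ q, q ≤ e p → G q ≤ φ s (trunc i (q * N)) := by
    intro p
    induction p with
    | zero =>
      intro q hq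
      rw [he0, Nat.le_zero] at hq
      subst hq
      simpa [he0] using (hstart 0).1
    | succ p ih =>
      intro q hq
      by_cases hqe : q ≤ e p
      · exact ih q hqe
      · exact (hpast p (hstart p).1 (hstart p).2 q (not_le.1 hqe).le hq).1
  exact hall q q (hmono.le_apply)

/-- Start times for the target blocks with arbitrarily long free stretches before them. -/
theorem exists_long_start (h : QuasiPotential φ d D α) {s : ℝ} (hs : 0 ≤ s) {ℓ : ℕ → ℕ}
    {j : ℕ → Fin m} {c : ℝ} (hc : Tendsto (wordRate φ ℓ j s) atTop (𝓝 c)) {N : ℕ} (hN : 0 < N)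
    {κ : ℝ} (hκ0 : 0 < κ) (hκ : 0 < Real.log κ + N * c) (e : ℕ) :
    ∃ b, e ≤ b ∧ 1 ≤ κ ^ (b - e) * (D * φ s (trunc j ((ℓ (b * N) / N + 1) * N))) := by
  have hN' : (0 : ℝ) < N := by exact_mod_cast hN
  have hsub : Tendsto (fun k : ℕ => k * N) atTop atTop := tendsto_id.atTop_mul_const' hN
  -- For b large, b free blocks gain about b log κ, while the target at time bN costs about -bNc;
  -- `hκ` says that the balance grows linearly.
  have hlim : Tendsto (fun k : ℕ => (k : ℝ) * (Real.log κ + N * wordRate φ ℓ j s (k * N)))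
      atTop atTop :=
    tendsto_natCast_atTop_atTop.atTop_mul_pos hκ
      (tendsto_const_nhds.add ((hc.comp hsub).const_mul (N : ℝ)))
  have hα := h.rate_pos
  -- The threshold covers the e blocks already spent, one D in the goal and one from splitting the
  -- target, and N s log α for lengthening the target to a multiple of N.
  obtain ⟨b, hb1, hb2, hb3⟩ := ((hlim.eventually_ge_atTop
    (e * Real.log κ - 2 * Real.log D - N * s * Real.log α)).and
      ((eventually_ge_atTop e).and (eventually_gt_atTop 0))).exists
  refine ⟨b, hb2, ?_⟩
  set l := ℓ (b * N) with hl
  obtain ⟨z, hz⟩ : ∃ z, (l / N + 1) * N = l + z :=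
    Nat.exists_eq_add_of_le (by rw [mul_comm]; exact (Nat.lt_mul_div_succ l hN).le)
  have hzN : z ≤ N := by
    have := Nat.div_mul_le_self l N
    rw [add_mul, one_mul] at hz
    omega
  have h1 : Real.log D + Real.log (φ s (trunc j l)) + N * s * Real.log α ≤
      Real.log (φ s (trunc j (l + z))) := by
    have h2 := Real.log_le_log (mul_pos (mul_pos h.const_pos (h.pos s hs _)) (h.pos s hs _))
      (h.le_append s hs (trunc j l) (trunc (shift^[l] j) z))
    rw [Real.log_mul (mul_pos h.const_pos (h.pos s hs _)).ne' (h.pos s hs _).ne',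
      Real.log_mul h.const_pos.ne' (h.pos s hs _).ne', ← trunc_add] at h2
    have h3 := h.le_log hs (trunc (shift^[l] j) z)
    rw [length_trunc] at h3
    have h4 : (N : ℝ) * s * Real.log α ≤ z * s * Real.log α :=
      mul_le_mul_of_nonpos_right (mul_le_mul_of_nonneg_right (by exact_mod_cast hzN) hs)
        (Real.log_neg hα h.rate_lt_one).le
    linarith
  have hb0 : (b : ℝ) ≠ 0 := by positivity
  have h5 : (b : ℝ) * (N * wordRate φ ℓ j s (b * N)) = Real.log (φ s (trunc j l)) := by
    rw [wordRate, ← hl]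
    push_cast
    field_simp
  have hφ := h.pos s hs (trunc j (l + z))
  rw [hz, ← Real.log_nonneg_iff (mul_pos (pow_pos hκ0 _) (mul_pos h.const_pos hφ)),
    Real.log_mul (pow_pos hκ0 _).ne' (mul_pos h.const_pos hφ).ne', Real.log_pow,
    Real.log_mul h.const_pos.ne' hφ.ne', Nat.cast_sub hb2]
  rw [mul_add, h5] at hb1
  linarith

/-- Cutting into blocks costs a factor D per block, that is (log D)/N per letter, which long blocks
make harmless. -/
theorem exists_block_length (h : QuasiPotential φ d D α) (hm : 0 < m) {s : ℝ} (hs : 0 ≤ s)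
    {P c : ℝ}
    (hP : Tendsto (fun k : ℕ => (1 / (k : ℝ)) * Real.log (partitionSum φ s k)) atTop (𝓝 P))
    (hpos : 0 < P + c) :
    ∃ N : ℕ, 0 < N ∧ 0 < Real.log (D * partitionSum φ s N) + N * c := by
  have hD : Tendsto (fun n : ℕ => Real.log D / n) atTop (𝓝 0) :=
    tendsto_const_nhds.div_atTop tendsto_natCast_atTop_atTop
  have hlim := (hD.add hP).add_const c
  rw [zero_add] at hlim
  obtain ⟨N, hN1, hN2⟩ := ((hlim.eventually (lt_mem_nhds hpos)).and
    (eventually_gt_atTop 0)).exists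
  refine ⟨N, hN2, ?_⟩
  have hN' : (0 : ℝ) < N := by exact_mod_cast hN2
  rw [Real.log_mul h.const_pos.ne' (h.partitionSum_pos hm hs N).ne']
  have := mul_pos hN' hN1
  refine lt_of_lt_of_eq this ?_
  field_simp

/-- A Frostman-type measure on the recurring set: `μ[w] ≲ φ^s(w)` if the modified pressure is
positive at `s`. -/
theorem exists_frostman_measure (h : QuasiPotential φ d D α) {s : ℝ} (hs : 0 ≤ s) {ℓ : ℕ → ℕ}
    {j : ℕ → Fin m} {P c : ℝ}
    (hP : Tendsto (fun k : ℕ => (1 / (k : ℝ)) * Real.log (partitionSum φ s k)) atTop (𝓝 P))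
    (hc : Tendsto (wordRate φ ℓ j s) atTop (𝓝 c)) (hpos : 0 < P + c) :
    ∃ μ : Measure (ℕ → Fin m), IsProbabilityMeasure μ ∧ (∀ᵐ i ∂μ, i ∈ recurringSet ℓ j) ∧
      ∃ C : ℝ, 0 < C ∧ ∀ (i : ℕ → Fin m) (n : ℕ),
        μ {k | trunc k n = trunc i n} ≤ ENNReal.ofReal (C * φ s (trunc i n)) := by
  classical
  have hm : 0 < m := (j 0).pos
  have hα := h.rate_pos
  obtain ⟨N, hN, hN2⟩ := h.exists_block_length hm hs hP hpos
  set Z := partitionSum φ s N with hZ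
  have hZ0 : 0 < Z := h.partitionSum_pos hm hs N
  have hκ0 : 0 < D * Z := mul_pos h.const_pos hZ0
  have hc0 : c ≤ 0 := le_of_tendsto' hc fun k => h.wordRate_nonpos ℓ j hs k
  have hκ : 1 ≤ D * Z := by
    have : (N : ℝ) * c ≤ 0 := mul_nonpos_of_nonneg_of_nonpos (by positivity) hc0
    rw [← Real.log_nonneg_iff hκ0]
    linarith
  choose start hst1 hst2 using fun e => h.exists_long_start hs hc hN hκ0 hN2 e
  -- Times are counted in blocks. A cycle runs free up to `start e` and then follows j for ℓ / N + 1
  -- blocks, enough to contain the ℓ letters required at time k = start e * N.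
  let next : ℕ → ℕ := fun e => start e + (ℓ (start e * N) / N + 1)
  let e : ℕ → ℕ := fun p => next^[p] 0
  have hes : ∀ p, e (p + 1) = start (e p) + (ℓ (start (e p) * N) / N + 1) := fun p =>
    Function.iterate_succ_apply' next p 0
  let b : ℕ → ℕ := fun p => start (e p)
  have heb : ∀ p, e p ≤ b p := fun p => hst1 _
  have hbe : ∀ p, b p < e (p + 1) := fun p => by
    rw [hes]; exact Nat.lt_add_of_pos_right (Nat.succ_pos _)
  have hmono : StrictMono e := strictMono_nat_of_lt_succ fun p => (heb p).trans_lt (hbe p)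
  have huniq : ∀ {p p' q}, e p ≤ q → q < e (p + 1) → e p' ≤ q → q < e (p' + 1) → p = p' := by
    intro p p' q h1 h2 h3 h4
    have h5 := hmono.lt_iff_lt.1 (h1.trans_lt h4)
    have h6 := hmono.lt_iff_lt.1 (h3.trans_lt h2)
    omega
  let A := Fin N → Fin m
  have hsum : ∑ u : A, ENNReal.ofReal (φ s (List.ofFn u) / Z) = 1 := by
    rw [← ENNReal.ofReal_sum_of_nonneg fun u _ => div_nonneg (h.pos s hs _).le hZ0.le,
      ← Finset.sum_div]
    change ENNReal.ofReal (Z / Z) = 1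
    rw [div_self hZ0.ne', ENNReal.ofReal_one]
  let gibbs : Measure A := (PMF.ofFintype _ hsum).toMeasure
  have hgibbs : ∀ u, gibbs {u} = ENNReal.ofReal (φ s (List.ofFn u) / Z) := fun u => by
    rw [PMF.toMeasure_apply_singleton _ _ (measurableSet_singleton _), PMF.ofFintype_apply]
  -- The choice of p is immaterial: target windows are disjoint by `huniq`. The weights `w` below
  -- are the point masses of these laws.
  let law : ℕ → Measure A := fun q =>
    if hq : ∃ p, b p ≤ q ∧ q < e (p + 1) then Measure.dirac (block N j (q - b hq.choose))
    else gibbs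
  let w : ℕ → A → ℝ := fun q u =>
    if hq : ∃ p, b p ≤ q ∧ q < e (p + 1) then
      (if u = block N j (q - b hq.choose) then 1 else 0) else φ s (List.ofFn u) / Z
  have hlawP : ∀ q, IsProbabilityMeasure (law q) := fun q => by
    simp only [law]; split_ifs <;> infer_instance
  have hw0 : ∀ q u, 0 ≤ w q u := fun q u => by
    simp only [w]; split_ifs
    · exact zero_le_one
    · exact le_rfl
    · exact div_nonneg (h.pos s hs _).le hZ0.le
  have hlaw : ∀ q u, law q {u} = ENNReal.ofReal (w q u) := fun q u => by
    simp only [law, w]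
    split_ifs with h1 h2
    · rw [Measure.dirac_apply' _ (measurableSet_singleton _), h2]; simp
    · rw [Measure.dirac_apply' _ (measurableSet_singleton _)]
      simp [Ne.symm h2]
    · exact hgibbs u
  have hchoose : ∀ {p q} (h1 : b p ≤ q) (h2 : q < e (p + 1))
      (hq : ∃ p, b p ≤ q ∧ q < e (p + 1)), hq.choose = p := fun {p q} h1 h2 hq =>
    huniq ((heb _).trans hq.choose_spec.1) hq.choose_spec.2 ((heb _).trans h1) h2
  have hfix : ∀ p q, b p ≤ q → q < e (p + 1) → ∀ u,
      w q u = if u = block N j (q - b p) then 1 else 0 := fun p q h1 h2 u => by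
    have hq : ∃ p, b p ≤ q ∧ q < e (p + 1) := ⟨p, h1, h2⟩
    simp only [w]
    rw [dif_pos hq, hchoose h1 h2 hq]
  have hfree : ∀ p q, e p ≤ q → q < b p → ∀ u, w q u = φ s (List.ofFn u) / Z :=
    fun p q h1 h2 u => by
      have hq : ¬ ∃ p, b p ≤ q ∧ q < e (p + 1) := by
        rintro ⟨p', h3, h4⟩
        have := huniq h1 (h2.trans (hbe p)) ((heb _).trans h3) h4
        subst this
        omega
      simp only [w]
      rw [dif_neg hq]
  have hlong : ∀ p, 1 ≤ (D * Z) ^ (b p - e p) *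
      (D * φ s (trunc j ((e (p + 1) - b p) * N))) := fun p => by
    have : e (p + 1) - b p = ℓ (start (e p) * N) / N + 1 := by
      rw [hes]; exact Nat.add_sub_cancel_left _ _
    rw [this]
    exact hst2 (e p)
  have hprod := h.prod_weight_le hs hm j (e := e) (b := b) rfl heb hbe w hfree hfix hlong hκ
  let F : (ℕ → A) → (ℕ → Fin m) := fun x n => x (n / N) ⟨n % N, Nat.mod_lt n hN⟩
  have hF : Measurable F := measurable_pi_lambda _ fun n =>
    (measurable_pi_apply _).comp (measurable_pi_apply _)
  have hFb : ∀ (x : ℕ → A) (q r : ℕ) (hr : r < N), F x (q * N + r) = x q ⟨r, hr⟩ :=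
    fun x q r hr => by
      have h1 : (q * N + r) / N = q := by
        rw [mul_comm, Nat.mul_add_div hN, Nat.div_eq_of_lt hr, add_zero]
      have h2 : (q * N + r) % N = r := by
        rw [mul_comm, Nat.mul_add_mod, Nat.mod_eq_of_lt hr]
      simp only [F, h1, h2]
  let ν : Measure (ℕ → A) := Measure.infinitePi law
  -- The constant pays for the incomplete last block: splitting it off costs D, and its at most N
  -- letters have φ^s at least α^(Ns).
  refine ⟨ν.map F, Measure.isProbabilityMeasure_map hF.aemeasurable, ?_,
    1 / (D * (α ^ N) ^ s), ?_, fun i n => ?_⟩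
  · refine (ae_map_iff hF.aemeasurable (p := fun i => i ∈ recurringSet ℓ j)
      (measurableSet_recurringSet ℓ j)).2 ?_
    have hae : ∀ q p, ∀ᵐ x ∂ν, b p ≤ q → q < e (p + 1) → x q = block N j (q - b p) := by
      intro q p
      by_cases hq : b p ≤ q ∧ q < e (p + 1)
      · have hlq : law q = Measure.dirac (block N j (q - b p)) := by
          have hq' : ∃ p, b p ≤ q ∧ q < e (p + 1) := ⟨p, hq⟩
          simp only [law]
          rw [dif_pos hq', hchoose hq.1 hq.2 hq']
        have h1 : ∀ᵐ u ∂(law q), u = block N j (q - b p) := by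
          rw [hlq]
          exact (ae_dirac_iff (p := fun u => u = block N j (q - b p))
            (measurableSet_singleton _)).2 rfl
        have h2 := (measurePreserving_eval_infinitePi law q).quasiMeasurePreserving.ae h1
        filter_upwards [h2] with x hx _ _ using hx
      · exact Eventually.of_forall fun x h1 h2 => absurd ⟨h1, h2⟩ hq
    have hae' := ae_all_iff.2 fun q => ae_all_iff.2 (hae q)
    filter_upwards [hae'] with x hx
    refine frequently_atTop.2 fun K => ⟨b K * N, ?_, ?_⟩
    · exact (hmono.le_apply.trans (heb K)).trans (Nat.le_mul_of_pos_right _ hN)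
    · rw [trunc_eq_iff]
      intro r hr
      rw [shift_iterate_apply]
      have h1 : r + b K * N = (b K + r / N) * N + r % N := by
        have := Nat.div_add_mod' r N
        rw [add_mul]; omega
      have h2 : b K + r / N < e (K + 1) := by
        rw [hes]
        exact Nat.add_lt_add_left (Nat.lt_succ_of_le (Nat.div_le_div_right hr.le)) _
      rw [h1, hFb x _ _ (Nat.mod_lt r hN), hx _ K (Nat.le_add_right _ _) h2]
      simp only [block, Nat.add_sub_cancel_left, Nat.div_add_mod']
  · have := h.const_pos; positivity
  · set q := n / N with hq
    have hqn : q * N ≤ n := Nat.div_mul_le_self n N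
    have hnq : n - q * N ≤ N := by
      have h1 := Nat.div_add_mod' n N
      have h2 := Nat.mod_lt n hN
      rw [← hq] at h1
      omega
    have hset : F ⁻¹' {k | trunc k n = trunc i n} ⊆
        Set.pi (Finset.range q : Finset ℕ) fun q' => {block N i q'} := by
      intro x hx q' hq'
      have hq' : q' < q := by simpa using hq'
      rw [Set.mem_singleton_iff]
      funext r
      rw [← hFb x q' r r.2]
      refine trunc_eq_iff.1 hx _ (lt_of_lt_of_le ?_ hqn)
      have : (q' + 1) * N ≤ q * N := Nat.mul_le_mul_right _ hq'
      rw [add_mul] at this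
      have := r.2
      omega
    have hcyl : MeasurableSet {k : ℕ → Fin m | trunc k n = trunc i n} :=
      measurableSet_trunc_eq 0 n i
    rw [Measure.map_apply hF hcyl]
    refine (measure_mono hset).trans ?_
    rw [Measure.infinitePi_pi law fun _ _ => measurableSet_singleton _]
    simp only [hlaw]
    rw [← ENNReal.ofReal_prod_of_nonneg fun _ _ => hw0 _ _]
    refine ENNReal.ofReal_le_ofReal ((hprod i q).trans ?_)
    obtain ⟨z, hz⟩ := Nat.exists_eq_add_of_le hqn
    have h1 := h.le_append s hs (trunc i (q * N)) (trunc (shift^[q * N] i) z)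
    rw [← trunc_add, ← hz] at h1
    have h2 : (α ^ N) ^ s ≤ φ s (trunc (shift^[q * N] i) z) := by
      refine le_trans ?_ (h.ge_rate hs _)
      rw [length_trunc]
      exact Real.rpow_le_rpow (by positivity)
        (pow_le_pow_of_le_one hα.le h.rate_lt_one.le (by omega)) hs
    rw [one_div, inv_mul_eq_div, le_div_iff₀ (mul_pos h.const_pos (by positivity))]
    refine le_trans ?_ h1
    have h3 := mul_le_mul_of_nonneg_left h2
      (mul_nonneg h.const_pos.le (h.pos s hs (trunc i (q * N))).le)
    linarith

end QuasiPotential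

end ShrinkingTargets

/-! ### Potentials, the energy estimate and the lower bound for the dimension. -/

namespace ShrinkingTargets

open scoped ENNReal

variable {d m : ℕ}

/-- The dyadic potential `∑_n 2^{nt} μ{k : |f(i) - f(k)| ≤ 2^{-n}}` of the image measure. -/
noncomputable def dyadicPotential {Ω : Type*} [MeasurableSpace Ω] (μ : Measure Ω)
    (f : Ω → Space d) (t : ℝ) (i : Ω) : ℝ≥0∞ :=
  ∑' n : ℕ, μ {k | ‖f i - f k‖ ≤ (1 / 2) ^ n} / ENNReal.ofReal (((1 / 2) ^ n) ^ t)

/-- The mass distribution principle: an almost surely finite potential bounds the dimension from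
below. -/
theorem le_dimH_of_dyadicPotential {Ω : Type*} [MeasurableSpace Ω] {μ : Measure Ω}
    [IsProbabilityMeasure μ] {f : Ω → Space d} (hf : Measurable f) {t : ℝ} (ht : 0 < t)
    {A : Set Ω} (hA : ∀ᵐ i ∂μ, i ∈ A) (hm : Measurable (dyadicPotential μ f t))
    (hfin : ∀ᵐ i ∂μ, dyadicPotential μ f t i < ∞) :
    ENNReal.ofReal t ≤ dimH (f '' A) := by
  -- On a set of positive measure the potential is bounded by some M, which bounds each term and
  -- hence the mass of every dyadic ball centred there.
  let G : ℕ → Set Ω := fun M => {i | dyadicPotential μ f t i ≤ M}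
  have hGm : ∀ M, MeasurableSet (G M) := fun M => measurableSet_le hm measurable_const
  obtain ⟨M, hM⟩ : ∃ M, μ (G M) ≠ 0 := by
    by_contra! hcon
    have h1 : μ (⋃ M, G M) = 0 := measure_iUnion_null hcon
    have h2 : ∀ᵐ i ∂μ, i ∈ ⋃ M, G M := by
      filter_upwards [hfin] with i hi
      obtain ⟨M, hM⟩ := ENNReal.exists_nat_gt hi.ne
      exact Set.mem_iUnion.2 ⟨M, hM.le⟩
    have h3 : ∀ᵐ i ∂μ, False := by
      filter_upwards [h2, measure_eq_zero_iff_ae_notMem.1 h1] with i hi hi' using hi' hi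
    exact (ae_neBot.2 (IsProbabilityMeasure.ne_zero μ)).ne
      (by simpa [Filter.eventually_false_iff_eq_bot] using h3)
  set ν : Measure (Space d) := (μ.restrict (G M)).map f with hν
  have hball : ∀ i ∈ G M, ∀ n : ℕ, μ {k | ‖f i - f k‖ ≤ (1 / 2) ^ n} ≤
      M * ENNReal.ofReal (((1 / 2) ^ n) ^ t) := fun i hi n => by
    have hi' : dyadicPotential μ f t i ≤ M := hi
    have h1 := (ENNReal.le_tsum n).trans hi'
    rwa [ENNReal.div_le_iff (by simp; positivity) ENNReal.ofReal_ne_top] at h1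
  -- The factor 2^t comes from rounding a diameter up to a power of 1/2; M + 1 keeps K nonzero when
  -- M = 0.
  set K : ℝ≥0∞ := (M + 1) * ENNReal.ofReal (2 ^ t) with hK
  have hK0 : K ≠ 0 := by
    simp only [hK, ne_eq, mul_eq_zero, ENNReal.ofReal_eq_zero, not_or, not_le]
    exact ⟨by simp, by positivity⟩
  have hKtop : K ≠ ∞ := ENNReal.mul_ne_top (by simp) ENNReal.ofReal_ne_top
  have hmass : ∀ U : Set (Space d), Metric.ediam U ≤ 1 → (K⁻¹ • ν) U ≤ Metric.ediam U ^ t := by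
    intro U hU
    rw [Measure.smul_apply, smul_eq_mul, mul_comm, ← div_eq_mul_inv, ENNReal.div_le_iff hK0 hKtop]
    have hνU : ν U ≤ μ (f ⁻¹' closure U ∩ G M) := by
      refine (measure_mono subset_closure).trans (le_of_eq ?_)
      rw [hν, Measure.map_apply hf isClosed_closure.measurableSet,
        Measure.restrict_apply (hf isClosed_closure.measurableSet)]
    rcases Set.eq_empty_or_nonempty (f ⁻¹' closure U ∩ G M) with hemp | ⟨i, hi, hiG⟩
    · rw [hemp, measure_empty] at hνU
      exact hνU.trans zero_le
    have hdtop : Metric.ediam U ≠ ∞ := (hU.trans_lt ENNReal.one_lt_top).ne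
    set δ := (Metric.ediam U).toReal with hδ
    have hUδ : Metric.ediam U = ENNReal.ofReal δ := (ENNReal.ofReal_toReal hdtop).symm
    have hδ1 : δ ≤ 1 := by
      have := ENNReal.toReal_mono ENNReal.one_ne_top hU
      simpa using this
    have hδ0 : 0 ≤ δ := ENNReal.toReal_nonneg
    have hsub : f ⁻¹' closure U ∩ G M ⊆ {k | ‖f i - f k‖ ≤ δ} := by
      rintro k ⟨hk, -⟩
      have h1 := Metric.edist_le_ediam_of_mem (show f i ∈ closure U from hi) hk
      rw [Metric.ediam_closure, hUδ, edist_dist, dist_eq_norm] at h1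
      exact (ENNReal.ofReal_le_ofReal_iff hδ0).1 h1
    have hν2 := hνU.trans (measure_mono hsub)
    rcases hδ0.eq_or_lt with h0 | hpos
    -- Diameter 0: the bound holds at every dyadic scale, and t > 0 makes it tend to 0.
    · have hlim : Tendsto (fun n : ℕ => (M : ℝ≥0∞) * ENNReal.ofReal (((1 / 2) ^ n) ^ t)) atTop
          (𝓝 (M * ENNReal.ofReal 0)) := by
        refine ENNReal.Tendsto.const_mul (ENNReal.tendsto_ofReal ?_) (Or.inr (by simp))
        have h1 : Tendsto (fun n : ℕ => ((1 / 2 : ℝ)) ^ n) atTop (𝓝 0) :=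
          tendsto_pow_atTop_nhds_zero_of_lt_one (by norm_num) (by norm_num)
        have h2 := h1.rpow_const (p := t) (Or.inr ht.le)
        rwa [Real.zero_rpow ht.ne'] at h2
      rw [ENNReal.ofReal_zero, mul_zero] at hlim
      refine le_trans (ge_of_tendsto' hlim fun n => ?_) zero_le
      refine hν2.trans ((measure_mono ?_).trans (hball i hiG n))
      intro k hk
      have hk' : ‖f i - f k‖ ≤ δ := hk
      rw [← h0] at hk'
      exact hk'.trans (by positivity)
    · obtain ⟨n, hn1, hn2⟩ := exists_nat_pow_near_of_lt_one hpos hδ1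
        (show (0 : ℝ) < 1 / 2 by norm_num) (by norm_num)
      have h1 : μ {k | ‖f i - f k‖ ≤ δ} ≤ M * ENNReal.ofReal (((1 / 2) ^ n) ^ t) :=
        (measure_mono fun k (hk : ‖f i - f k‖ ≤ δ) => hk.trans hn2).trans (hball i hiG n)
      refine hν2.trans (h1.trans ?_)
      have h2 : ((1 / 2 : ℝ) ^ n) ^ t ≤ 2 ^ t * δ ^ t := by
        rw [← Real.mul_rpow zero_le_two hδ0]
        refine Real.rpow_le_rpow (by positivity) ?_ ht.le
        rw [pow_succ] at hn1
        linarith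
      rw [hUδ, ENNReal.ofReal_rpow_of_nonneg hδ0 ht.le, hK, mul_comm (ENNReal.ofReal (δ ^ t)),
        mul_assoc, ← ENNReal.ofReal_mul (by positivity)]
      exact mul_le_mul' (by simp) (ENNReal.ofReal_le_ofReal h2)
  have hle := Measure.le_hausdorffMeasure t (K⁻¹ • ν) 1 one_pos hmass
  have hpos : 0 < μH[t] (f '' A) := by
    refine lt_of_lt_of_le ?_ (hle (f '' A))
    rw [Measure.smul_apply, smul_eq_mul]
    refine ENNReal.mul_pos (ENNReal.inv_ne_zero.2 hKtop) ?_
    have h1 : μ (G M) ≤ ν (f '' A) := by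
      refine le_trans ?_ (Measure.le_map_apply hf.aemeasurable _)
      refine le_trans ?_ (measure_mono (Set.subset_preimage_image f A))
      have h2 : ∀ᵐ i ∂(μ.restrict (G M)), i ∈ A := ae_restrict_of_ae hA
      rw [← Measure.restrict_apply_univ]
      exact measure_mono_ae (by filter_upwards [h2] with i hi _ using hi)
    exact (lt_of_lt_of_le (pos_iff_ne_zero.2 hM) h1).ne'
  rw [ENNReal.ofReal_eq_coe_nnreal ht.le]
  exact le_dimH_of_hausdorffMeasure_ne_zero hpos.ne'

theorem measurableSet_norm_sub_le {V Ω : Type*} [MeasurableSpace V] [MeasurableSpace Ω]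
    {f : V × Ω → Space d} (hf : Measurable f) (r : ℝ) :
    MeasurableSet {q : (V × Ω) × Ω | ‖f q.1 - f (q.1.1, q.2)‖ ≤ r} := by
  have h1 : Measurable fun q : (V × Ω) × Ω => f q.1 := hf.comp measurable_fst
  have h2 : Measurable fun q : (V × Ω) × Ω => f (q.1.1, q.2) :=
    hf.comp ((measurable_fst.comp measurable_fst).prodMk measurable_snd)
  exact measurableSet_le (h1.sub h2).norm measurable_const

section Projection

variable {T : Fin m → Space d →ₗ[ℝ] Space d} {c : ℝ}

theorem measurable_proj (hc0 : 0 < c) (hc1 : c < 1) (hT : ∀ i x, ‖T i x‖ ≤ c * ‖x‖) :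
    Measurable fun p : (Fin m → Space d) × (ℕ → Fin m) => proj T p.1 p.2 := by
  refine measurable_of_tendsto_metrizable (f := fun k p =>
    ∑ r ∈ Finset.range k, wordMap T (trunc p.2 r) (p.1 (p.2 r))) (fun k => ?_) ?_
  · refine Finset.measurable_sum _ fun r _ => ?_
    have h1 : Measurable fun p : (Fin m → Space d) × (Fin (r + 1) → Fin m) =>
        wordMap T (List.ofFn fun q : Fin r => p.2 q.castSucc) (p.1 (p.2 (Fin.last r))) := by
      refine measurable_from_prod_countable_left fun u => ?_
      exact (LinearMap.continuous_of_finiteDimensional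
        (wordMap T (List.ofFn fun q : Fin r => u q.castSucc))).measurable.comp
        (measurable_pi_apply (u (Fin.last r)))
    have h2 : Measurable fun p : (Fin m → Space d) × (ℕ → Fin m) =>
        (p.1, fun q : Fin (r + 1) => p.2 q) := by fun_prop
    exact h1.comp h2
  · rw [tendsto_pi_nhds]
    exact fun p => (hasSum_proj hc0 hc1 hT p.1 p.2).tendsto_sum_nat

variable {μ : Measure (ℕ → Fin m)}

/-- Transversality compares distinct codes only, so the diagonal has to be null. -/
theorem measure_singleton_eq_zero {C s : ℝ} (hs : 0 < s) {ψ : List (Fin m) → ℝ}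
    (hψ : ∀ w, ψ w ≤ ((1 / 2) ^ w.length) ^ s) (hC : 0 < C)
    (hμ : ∀ (i : ℕ → Fin m) (n : ℕ),
      μ {k | trunc k n = trunc i n} ≤ ENNReal.ofReal (C * ψ (trunc i n)))
    (i : ℕ → Fin m) : μ {i} = 0 := by
  have hlim : Tendsto (fun n : ℕ => ENNReal.ofReal (C * ((1 / 2) ^ n) ^ s)) atTop
      (𝓝 (ENNReal.ofReal (C * 0))) := by
    refine ENNReal.tendsto_ofReal (Tendsto.const_mul C ?_)
    have h1 : Tendsto (fun n : ℕ => ((1 / 2 : ℝ)) ^ n) atTop (𝓝 0) :=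
      tendsto_pow_atTop_nhds_zero_of_lt_one (by norm_num) (by norm_num)
    have h2 := h1.rpow_const (p := s) (Or.inr hs.le)
    rwa [Real.zero_rpow hs.ne'] at h2
  rw [mul_zero, ENNReal.ofReal_zero] at hlim
  refine le_antisymm (ge_of_tendsto' hlim fun n => ?_) zero_le
  refine (measure_mono ?_).trans ((hμ i n).trans (ENNReal.ofReal_le_ofReal ?_))
  · rintro k rfl; rfl
  · have := hψ (trunc i n)
    rw [length_trunc] at this
    exact mul_le_mul_of_nonneg_left this hC.le

/-- The energy estimate for a fixed base point. -/
theorem exists_lintegral_volume_le {D α : ℝ}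
    (h : QuasiPotential (fun t w => svf t (wordMap T w)) d D α)
    (hinj : ∀ i, Function.Injective (T i)) (hc0 : 0 < c) (hc1 : c < 1 / 2)
    (hT : ∀ i x, ‖T i x‖ ≤ c * ‖x‖) {t s : ℝ} (ht : 0 ≤ t) (hts : t < s) (hsd : s ≤ d) {C : ℝ}
    (hC : 0 < C)
    (hμ : ∀ (i : ℕ → Fin m) (n : ℕ),
      μ {k | trunc k n = trunc i n} ≤ ENNReal.ofReal (C * svf s (wordMap T (trunc i n))))
    {ρ : ℝ} (hρ : 0 < ρ) :
    ∃ K : ℝ, 0 < K ∧ ∀ (i : ℕ → Fin m) (r : ℝ), 0 < r →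
      ∫⁻ k, volume {a : Fin m → Space d | ‖a‖ ≤ ρ ∧ ‖proj T a i - proj T a k‖ ≤ r} ∂μ ≤
        ENNReal.ofReal (K * r ^ t) := by
  have hs : 0 < s := ht.trans_lt hts
  obtain ⟨C₁, hC₁, htrans⟩ := exists_transversality_const hinj hc0 hc1 hT hρ
  -- A cylinder of length n has mass of order φ^s, transversality divides by φ^t, and φ^s/φ^t ≤ θ^n:
  -- the gap t < s makes the sum over n geometric.
  set θ : ℝ := (1 / 2) ^ (s - t) with hθ
  have hθ0 : 0 < θ := by positivity
  have hθ1 : θ < 1 := Real.rpow_lt_one (by norm_num) (by norm_num) (by linarith)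
  refine ⟨C₁ * C * (1 - θ)⁻¹, mul_pos (mul_pos hC₁ hC) (inv_pos.2 (by linarith)),
    fun i r hr => ?_⟩
  let cyl : ℕ → Set (ℕ → Fin m) := fun n => {k | trunc k n = trunc i n}
  have hcyl : ∀ n, MeasurableSet (cyl n) := fun n => measurableSet_trunc_eq 0 n i
  let B : ℕ → ℝ≥0∞ := fun n => ENNReal.ofReal (C₁ * (r ^ t / svf t (wordMap T (trunc i n))))
  have hne : ∀ᵐ k ∂μ, k ≠ i := by
    have h0 := measure_singleton_eq_zero hs (fun w => h.le_half hs.le w) hC hμ i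
    exact measure_eq_zero_iff_ae_notMem.1 h0
  -- Each k ≠ i lies in the cylinder around i ending at their first difference; summing over all
  -- cylinders around i only enlarges the bound.
  have hpt : ∀ᵐ k ∂μ, volume {a : Fin m → Space d | ‖a‖ ≤ ρ ∧ ‖proj T a i - proj T a k‖ ≤ r} ≤
      ∑' n, (cyl n).indicator (fun _ => B n) k := by
    filter_upwards [hne] with k hk
    set n := PiNat.firstDiff i k with hn
    have h1 : trunc i n = trunc k n :=
      trunc_eq_iff.2 fun r hr => PiNat.apply_eq_of_lt_firstDiff hr
    refine (htrans i k n h1 (PiNat.apply_firstDiff_ne hk.symm) t ht (hts.le.trans hsd) r hr).trans ?_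
    refine le_trans ?_ (ENNReal.le_tsum n)
    rw [Set.indicator_of_mem (show k ∈ cyl n from h1.symm)]
  refine (lintegral_mono_ae hpt).trans ?_
  rw [lintegral_tsum fun n => (measurable_const.indicator (hcyl n)).aemeasurable]
  have hterm : ∀ n, ∫⁻ k, (cyl n).indicator (fun _ => B n) k ∂μ ≤
      ENNReal.ofReal (C₁ * C * r ^ t * θ ^ n) := fun n => by
    rw [lintegral_indicator (hcyl n), lintegral_const, Measure.restrict_apply_univ]
    have hφ := h.pos t ht (trunc i n)
    refine (mul_le_mul_right (hμ i n) _).trans ?_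
    rw [← ENNReal.ofReal_mul (by positivity)]
    refine ENNReal.ofReal_le_ofReal ?_
    have h1 := h.upper t s ht hts.le (trunc i n)
    rw [length_trunc, ← Real.rpow_natCast, ← Real.rpow_mul (by norm_num), mul_comm (n : ℝ),
      Real.rpow_mul (by norm_num), Real.rpow_natCast, ← hθ] at h1
    calc _ ≤ C₁ * (r ^ t / svf t (wordMap T (trunc i n))) *
          (C * (θ ^ n * svf t (wordMap T (trunc i n)))) := by gcongr
      _ = _ := by field_simp
  refine (ENNReal.tsum_le_tsum hterm).trans ?_
  have hsum := summable_geometric_of_lt_one hθ0.le hθ1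
  rw [← ENNReal.ofReal_tsum_of_nonneg (fun n => by positivity) (hsum.mul_left _), tsum_mul_left,
    tsum_geometric_of_lt_one hθ0.le hθ1]
  refine ENNReal.ofReal_le_ofReal (le_of_eq ?_)
  ring

variable [IsProbabilityMeasure μ]

theorem measurable_dyadicPotential_proj (hc0 : 0 < c) (hc1 : c < 1)
    (hT : ∀ i x, ‖T i x‖ ≤ c * ‖x‖) (t : ℝ) :
    Measurable fun p : (Fin m → Space d) × (ℕ → Fin m) =>
      dyadicPotential μ (proj T p.1) t p.2 := by
  refine Measurable.tsum fun n => Measurable.div_const ?_ _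
  have hp := measurable_proj hc0 hc1 hT
  have h1 : MeasurableSet {q : ((Fin m → Space d) × (ℕ → Fin m)) × (ℕ → Fin m) |
      ‖proj T q.1.1 q.1.2 - proj T q.1.1 q.2‖ ≤ (1 / 2) ^ n} := measurableSet_norm_sub_le hp _
  exact measurable_measure_prodMk_left h1

theorem ae_le_dimH {D α : ℝ} (h : QuasiPotential (fun t w => svf t (wordMap T w)) d D α)
    (hinj : ∀ i, Function.Injective (T i)) (hc0 : 0 < c) (hc1 : c < 1 / 2)
    (hT : ∀ i x, ‖T i x‖ ≤ c * ‖x‖) {t s : ℝ} (ht : 0 < t) (hts : t < s) (hsd : s ≤ d) {C : ℝ}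
    (hC : 0 < C)
    (hμ : ∀ (i : ℕ → Fin m) (n : ℕ),
      μ {k | trunc k n = trunc i n} ≤ ENNReal.ofReal (C * svf s (wordMap T (trunc i n))))
    {A : Set (ℕ → Fin m)} (hA : ∀ᵐ i ∂μ, i ∈ A) :
    ∀ᵐ a : Fin m → Space d, ENNReal.ofReal t ≤ dimH (proj T a '' A) := by
  have hc1' : c < 1 := by linarith
  -- Two gaps are needed: u < s sums over cylinders in the energy estimate, and t < u sums over the
  -- dyadic scales of the potential.
  set u : ℝ := (t + s) / 2 with hu
  have htu : t < u := by linarith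
  have hus : u < s := by linarith
  have hp := measurable_proj hc0 hc1' hT
  have hpot := measurable_dyadicPotential_proj (μ := μ) hc0 hc1' hT t
  have hball : ∀ M : ℕ, ∀ᵐ a : Fin m → Space d, a ∈ Metric.closedBall (0 : Fin m → Space d) (M + 1) →
      ∀ᵐ i ∂μ, dyadicPotential μ (proj T a) t i < ∞ := by
    intro M
    have hρ : (0 : ℝ) < M + 1 := by positivity
    obtain ⟨K, hK, hint⟩ := exists_lintegral_volume_le (μ := μ) h hinj hc0 hc1 hT (ht.trans htu).le
      hus hsd hC hμ hρ
    set lam := (volume : Measure (Fin m → Space d)).restrict (Metric.closedBall 0 (M + 1)) with hlam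
    rw [← ae_restrict_iff' Metric.isClosed_closedBall.measurableSet]
    have hmeas : ∀ n : ℕ, MeasurableSet {q : ((Fin m → Space d) × (ℕ → Fin m)) × (ℕ → Fin m) |
        ‖proj T q.1.1 q.1.2 - proj T q.1.1 q.2‖ ≤ (1 / 2) ^ n} := fun n =>
      measurableSet_norm_sub_le hp _
    have hg : ∀ n : ℕ, Measurable fun p : (Fin m → Space d) × (ℕ → Fin m) =>
        μ {k | ‖proj T p.1 p.2 - proj T p.1 k‖ ≤ (1 / 2) ^ n} := fun n =>
      measurable_measure_prodMk_left (hmeas n)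
    have hstep : ∀ n : ℕ, ∫⁻ p, μ {k | ‖proj T p.1 p.2 - proj T p.1 k‖ ≤ (1 / 2) ^ n}
        ∂(lam.prod μ) ≤ ENNReal.ofReal (K * ((1 / 2) ^ n) ^ u) := fun n => by
      rw [lintegral_prod_symm' _ (hg n)]
      have h1 : ∀ i, ∫⁻ a, μ {k | ‖proj T a i - proj T a k‖ ≤ (1 / 2) ^ n} ∂lam ≤
          ENNReal.ofReal (K * ((1 / 2) ^ n) ^ u) := fun i => by
        have hm2 : MeasurableSet {q : (Fin m → Space d) × (ℕ → Fin m) |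
            ‖proj T q.1 i - proj T q.1 q.2‖ ≤ (1 / 2) ^ n} :=
          (measurable_fst.prodMk measurable_const).prodMk measurable_snd (hmeas n)
        have e1 := Measure.prod_apply (μ := lam) (ν := μ) hm2
        have e2 := Measure.prod_apply_symm (μ := lam) (ν := μ) hm2
        refine (le_of_eq (e1.symm.trans e2)).trans (le_trans (lintegral_mono fun k => ?_)
          (hint i ((1 / 2) ^ n) (by positivity)))
        rw [hlam, Measure.restrict_apply' Metric.isClosed_closedBall.measurableSet]
        exact measure_mono fun a ha => ⟨mem_closedBall_zero_iff.1 ha.2, ha.1⟩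
      refine (lintegral_mono h1).trans ?_
      rw [lintegral_const, measure_univ, mul_one]
    have htot : ∫⁻ p, dyadicPotential μ (proj T p.1) t p.2 ∂(lam.prod μ) ≠ ∞ := by
      unfold dyadicPotential
      rw [lintegral_tsum fun n => ((hg n).div_const _).aemeasurable]
      set θ : ℝ := (1 / 2) ^ (u - t) with hθ
      have hθ0 : 0 < θ := by positivity
      have hθ1 : θ < 1 := Real.rpow_lt_one (by norm_num) (by norm_num) (by linarith)
      have hsum := summable_geometric_of_lt_one hθ0.le hθ1
      refine ne_top_of_le_ne_top (b := ENNReal.ofReal (∑' n : ℕ, K * θ ^ n))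
        ENNReal.ofReal_ne_top ?_
      rw [ENNReal.ofReal_tsum_of_nonneg (fun n => by positivity) (hsum.mul_left _)]
      refine ENNReal.tsum_le_tsum fun n => ?_
      simp only [div_eq_mul_inv]
      rw [lintegral_mul_const _ (by simpa only [div_eq_mul_inv] using hg n), ← div_eq_mul_inv,
        ENNReal.div_le_iff (by simp; positivity) ENNReal.ofReal_ne_top,
        ← ENNReal.ofReal_mul (by positivity)]
      refine le_trans ?_ ((hstep n).trans (le_of_eq ?_))
      · simp only [div_eq_mul_inv, le_refl]
      · have e : (((1 / 2 : ℝ)) ^ n) ^ u = θ ^ n * ((1 / 2) ^ n) ^ t := by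
          rw [hθ, ← Real.rpow_natCast, ← Real.rpow_natCast, ← Real.rpow_mul (by norm_num),
            ← Real.rpow_mul (by norm_num), ← Real.rpow_mul (by norm_num),
            ← Real.rpow_add (by norm_num)]
          congr 1
          ring
        rw [e, mul_assoc, one_div, one_mul]
    exact Measure.ae_ae_of_ae_prod (ae_lt_top hpot htot)
  filter_upwards [ae_all_iff.2 hball] with a ha
  obtain ⟨M, hM⟩ := exists_nat_ge ‖a‖
  refine le_dimH_of_dyadicPotential (hp.comp (measurable_const.prodMk measurable_id)) ht hA
    (hpot.comp (measurable_const.prodMk measurable_id))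
    (ha M (mem_closedBall_zero_iff.2 (by linarith)))

end Projection

end ShrinkingTargets

/-! ### Ergodic theory: almost sure rates of the singular value function. -/

namespace ShrinkingTargets

section Birkhoff

variable {Ω : Type*} {f : Ω → Ω} {g : Ω → ℝ}

/-- The running maximum of the Birkhoff sums of `g`. -/
noncomputable def maxBirkhoff (f : Ω → Ω) (g : Ω → ℝ) : ℕ → Ω → ℝ
  | 0 => fun _ => 0
  | n + 1 => fun x => max 0 (g x + maxBirkhoff f g n (f x))

theorem maxBirkhoff_nonneg (n : ℕ) (x : Ω) : 0 ≤ maxBirkhoff f g n x := by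
  cases n with
  | zero => exact le_rfl
  | succ n => exact le_max_left _ _

theorem maxBirkhoff_succ (n : ℕ) (x : Ω) :
    maxBirkhoff f g (n + 1) x = max 0 (g x + maxBirkhoff f g n (f x)) := rfl

theorem maxBirkhoff_le_succ (n : ℕ) (x : Ω) :
    maxBirkhoff f g n x ≤ maxBirkhoff f g (n + 1) x := by
  induction n generalizing x with
  | zero => exact maxBirkhoff_nonneg _ _
  | succ n ih =>
    rw [maxBirkhoff_succ, maxBirkhoff_succ]
    exact max_le_max le_rfl (by linarith [ih (f x)])

theorem maxBirkhoff_mono (x : Ω) : Monotone fun n => maxBirkhoff f g n x :=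
  monotone_nat_of_le_succ fun n => maxBirkhoff_le_succ n x

theorem birkhoffSum_le_maxBirkhoff (n : ℕ) (x : Ω) :
    birkhoffSum f g n x ≤ maxBirkhoff f g n x := by
  induction n generalizing x with
  | zero => simp [birkhoffSum_zero, maxBirkhoff]
  | succ n ih =>
    rw [birkhoffSum_succ', maxBirkhoff_succ]
    exact le_max_of_le_right (by linarith [ih (f x)])

theorem maxBirkhoff_le {K : ℝ} (hK : 0 ≤ K) (hg : ∀ x, |g x| ≤ K) (n : ℕ) (x : Ω) :
    maxBirkhoff f g n x ≤ n * K := by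
  induction n generalizing x with
  | zero => simp [maxBirkhoff]
  | succ n ih =>
    rw [maxBirkhoff_succ]
    push_cast
    refine max_le (by positivity) ?_
    linarith [ih (f x), le_of_abs_le (hg x)]

variable [MeasurableSpace Ω] {μ : Measure Ω} [IsProbabilityMeasure μ]

theorem measurable_maxBirkhoff (hf : Measurable f) (hg : Measurable g) (n : ℕ) :
    Measurable (maxBirkhoff f g n) := by
  induction n with
  | zero => exact measurable_const
  | succ n ih => exact measurable_const.max (hg.add (ih.comp hf))

/-- If `∫ g < 0` then the Birkhoff sums of `g` are almost surely bounded above. -/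
theorem ae_bddAbove_birkhoffSum (hf : Ergodic f μ) (hg : Measurable g) {K : ℝ}
    (hK : ∀ x, |g x| ≤ K) (hneg : ∫ x, g x ∂μ < 0) :
    ∀ᵐ x ∂μ, ∃ B : ℝ, ∀ n, birkhoffSum f g n x ≤ B := by
  obtain ⟨x₀⟩ : Nonempty Ω := nonempty_of_isProbabilityMeasure μ
  have hK0 : 0 ≤ K := (abs_nonneg _).trans (hK x₀)
  have hfm := hf.measurable
  set M := maxBirkhoff f g with hM
  have hMm : ∀ n, Measurable (M n) := measurable_maxBirkhoff hfm hg
  have hMint : ∀ n, Integrable (M n) μ := fun n =>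
    Integrable.of_bound (hMm n).aestronglyMeasurable (n * K) (Eventually.of_forall fun x => by
      rw [Real.norm_eq_abs, abs_of_nonneg (maxBirkhoff_nonneg n x)]
      exact maxBirkhoff_le hK0 hK n x)
  -- The set of unbounded Birkhoff maxima. It is invariant because g is bounded, so by ergodicity it
  -- is null or of full measure.
  let E : Set Ω := {x | ∀ B : ℕ, ∃ n, (B : ℝ) < M n x}
  have hE : MeasurableSet E := by
    have : E = ⋂ B : ℕ, ⋃ n, {x | (B : ℝ) < M n x} := by ext x; simp [E]
    rw [this]
    exact MeasurableSet.iInter fun B => MeasurableSet.iUnion fun n =>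
      measurableSet_lt measurable_const (hMm n)
  have hinv : f ⁻¹' E = E := by
    ext x
    constructor
    · intro hx B
      obtain ⟨B', hB'⟩ := exists_nat_ge (B + K)
      obtain ⟨n, hn⟩ := hx B'
      refine ⟨n + 1, ?_⟩
      rw [hM, maxBirkhoff_succ]
      refine lt_max_of_lt_right ?_
      have := neg_le_of_abs_le (hK x)
      linarith
    · intro hx B
      obtain ⟨B', hB'⟩ := exists_nat_ge (B + K)
      obtain ⟨n, hn⟩ := hx B'
      refine ⟨n, ?_⟩
      have h1 := hn.trans_le (maxBirkhoff_le_succ n x)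
      rw [maxBirkhoff_succ] at h1
      have h3 : (0 : ℝ) ≤ B := Nat.cast_nonneg B
      rcases lt_max_iff.1 h1 with h2 | h2
      · linarith
      · have := le_of_abs_le (hK x)
        linarith
  rcases hf.toPreErgodic.ae_empty_or_univ hE hinv with h0 | h1
  · filter_upwards [h0] with x hx
    have hxE : x ∉ E := fun hxE => (iff_of_eq hx).1 hxE
    simp only [E, Set.mem_ofPred_eq, not_forall, not_exists, not_lt] at hxE
    obtain ⟨B, hB⟩ := hxE
    exact ⟨B, fun n => (birkhoffSum_le_maxBirkhoff n x).trans (hB n)⟩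
  · exfalso
    -- Garsia's argument: invariance of the measure and monotonicity of M give F n a nonnegative
    -- integral, while F n = max (-M n ∘ f, g) equals g eventually on E. If E had full measure, the
    -- integral of g would be nonnegative.
    let F : ℕ → Ω → ℝ := fun n x => M (n + 1) x - M n (f x)
    have hFeq : ∀ n x, F n x = max (-M n (f x)) (g x) := fun n x => by
      simp only [F, hM]
      rw [maxBirkhoff_succ, max_sub_sub_right _ _ _ |>.symm, zero_sub, add_sub_cancel_right]
    have hFint : ∀ n, 0 ≤ ∫ x, F n x ∂μ := fun n => by
      have h2 : ∫ x, M n (f x) ∂μ = ∫ x, M n x ∂μ := by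
        have := integral_map (μ := μ) hfm.aemeasurable (f := M n)
          (by rw [hf.map_eq]; exact (hMm n).aestronglyMeasurable)
        rw [hf.map_eq] at this
        exact this.symm
      have h3 : Integrable (fun x => M n (f x)) μ :=
        hf.toMeasurePreserving.integrable_comp_of_integrable (hMint n)
      rw [integral_sub (hMint _) h3, h2, sub_nonneg]
      exact integral_mono (hMint n) (hMint _) fun x => maxBirkhoff_le_succ n x
    have hlim : Tendsto (fun n => ∫ x, F n x ∂μ) atTop (𝓝 (∫ x, g x ∂μ)) := by
      refine tendsto_integral_of_dominated_convergence (fun _ => K) (fun n => ?_)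
        (integrable_const K) (fun n => Eventually.of_forall fun x => ?_) ?_
      · exact ((hMm _).sub ((hMm n).comp hfm)).aestronglyMeasurable
      · rw [hFeq, Real.norm_eq_abs, abs_le]
        have h4 := abs_le.1 (hK x)
        exact ⟨h4.1.trans (le_max_right _ _),
          max_le (by linarith [maxBirkhoff_nonneg (f := f) (g := g) n (f x)]) h4.2⟩
      · filter_upwards [h1] with x hx
        have hxE : f x ∈ E := by
          have : x ∈ f ⁻¹' E := by rw [hinv]; exact (iff_of_eq hx).2 trivial
          exact this
        obtain ⟨B, hB⟩ := exists_nat_ge K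
        obtain ⟨N, hN⟩ := hxE B
        refine tendsto_const_nhds.congr' ?_
        filter_upwards [eventually_ge_atTop N] with n hn
        rw [hFeq, max_eq_right]
        have h5 := maxBirkhoff_mono (f := f) (g := g) (f x) hn
        simp only at h5
        have h6 := neg_le_of_abs_le (hK x)
        linarith
    exact absurd (ge_of_tendsto' hlim hFint) (not_le.2 hneg)

/-- Birkhoff's ergodic theorem for a bounded observable. -/
theorem ae_birkhoffSum_sub_le (hf : Ergodic f μ) (hg : Measurable g) {K : ℝ}
    (hK : ∀ x, |g x| ≤ K) {ε : ℝ} (hε : 0 < ε) :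
    ∀ᵐ x ∂μ, ∃ B : ℝ, ∀ n : ℕ, |birkhoffSum f g n x - n * ∫ y, g y ∂μ| ≤ ε * n + B := by
  have hint : Integrable g μ := Integrable.of_bound hg.aestronglyMeasurable K
    (Eventually.of_forall hK)
  set I := ∫ y, g y ∂μ with hI
  have hup := ae_bddAbove_birkhoffSum (g := fun x => g x - (I + ε)) (K := K + |I + ε|) hf
    (hg.sub_const _) (fun x => (abs_sub _ _).trans (by linarith [hK x])) (by
      rw [integral_sub hint (integrable_const _)]
      simp [← hI, hε])
  have hlow := ae_bddAbove_birkhoffSum (g := fun x => (I - ε) - g x) (K := |I - ε| + K) hf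
    (hg.const_sub _) (fun x => (abs_sub _ _).trans (by linarith [hK x])) (by
      rw [integral_sub (integrable_const _) hint]
      simp [← hI, hε])
  filter_upwards [hup, hlow] with x ⟨B₁, hB₁⟩ ⟨B₂, hB₂⟩
  refine ⟨max B₁ B₂, fun n => ?_⟩
  have h1 := hB₁ n
  have h2 := hB₂ n
  simp only [birkhoffSum, Finset.sum_sub_distrib, Finset.sum_const, Finset.card_range,
    nsmul_eq_mul] at h1 h2 ⊢
  rw [abs_le]
  constructor
  · nlinarith [le_max_right B₁ B₂]
  · nlinarith [le_max_left B₁ B₂]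

end Birkhoff

variable {d m : ℕ} {φ : ℝ → List (Fin m) → ℝ} {D α : ℝ}

theorem measurable_comp_trunc (ψ : List (Fin m) → ℝ) (n : ℕ) :
    Measurable fun j : ℕ → Fin m => ψ (trunc j n) := by
  have h1 : Measurable fun u : Fin n → Fin m => ψ (List.ofFn u) := measurable_of_finite _
  have h2 : Measurable fun j : ℕ → Fin m => fun r : Fin n => j r := by fun_prop
  exact h1.comp h2

namespace QuasiPotential

theorem abs_log_le (h : QuasiPotential φ d D α) {t : ℝ} (ht : 0 ≤ t) (w : List (Fin m)) :
    |Real.log (φ t w)| ≤ w.length * (t * -Real.log α) := by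
  rw [abs_of_nonpos (Real.log_nonpos (h.pos t ht w).le (h.le_one ht w))]
  linarith [h.le_log ht w]

theorem abs_log_append_sub_le (h : QuasiPotential φ d D α) {t : ℝ} (ht : 0 ≤ t)
    (w w' : List (Fin m)) :
    |Real.log (φ t (w ++ w')) - Real.log (φ t w) - Real.log (φ t w')| ≤ -Real.log D := by
  have hw := h.pos t ht w
  have hw' := h.pos t ht w'
  have h1 := Real.log_le_log (h.pos t ht _) (h.append_le t ht w w')
  have h2 := Real.log_le_log (mul_pos (mul_pos h.const_pos hw) hw') (h.le_append t ht w w')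
  rw [Real.log_mul hw.ne' hw'.ne'] at h1
  rw [Real.log_mul (mul_pos h.const_pos hw).ne' hw'.ne', Real.log_mul h.const_pos.ne' hw.ne'] at h2
  have h3 := Real.log_neg h.const_pos h.const_lt_one
  rw [abs_le]
  constructor <;> linarith

/-- An almost additive cocycle is `1/N` times a Birkhoff sum, up to a relative error `O(1/N)`. -/
theorem abs_mul_log_sub_birkhoffSum_le (h : QuasiPotential φ d D α) {t : ℝ} (ht : 0 ≤ t) (N : ℕ)
    (j : ℕ → Fin m) (n : ℕ) :
    |N * Real.log (φ t (trunc j n)) -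
      birkhoffSum shift (fun i => Real.log (φ t (trunc i N))) n j| ≤
      n * -Real.log D + N * (-Real.log D + 2 * (N * (t * -Real.log α))) := by
  set G : ℕ → ℝ := fun n => Real.log (φ t (trunc j n)) with hG
  set C := -Real.log D with hC
  set K := t * -Real.log α with hK
  have hC0 : 0 ≤ C := by
    have := Real.log_neg h.const_pos h.const_lt_one
    linarith
  have hK0 : 0 ≤ K := mul_nonneg ht (by linarith [Real.log_neg h.rate_pos h.rate_lt_one])
  have hadd : ∀ a b, |G (a + b) - G a - Real.log (φ t (trunc (shift^[a] j) b))| ≤ C := fun a b => by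
    simp only [hG, trunc_add]
    exact h.abs_log_append_sub_le ht _ _
  have h1 : |∑ i ∈ Finset.range n, (G (i + N) - G i) -
      birkhoffSum shift (fun i => Real.log (φ t (trunc i N))) n j| ≤ n * C := by
    rw [birkhoffSum, ← Finset.sum_sub_distrib]
    refine (Finset.abs_sum_le_sum_abs _ _).trans ?_
    refine (Finset.sum_le_card_nsmul _ _ C fun i _ => hadd i N).trans ?_
    simp
  -- Telescoping in two ways: n increments of lag N equal N increments of lag n, and each of the
  -- latter is close to G n.
  have h2 : ∑ i ∈ Finset.range n, (G (i + N) - G i) =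
      ∑ r ∈ Finset.range N, (G (n + r) - G r) := by
    have e1 := Finset.sum_range_add G N n
    have e2 := Finset.sum_range_add G n N
    rw [add_comm N n] at e1
    rw [Finset.sum_sub_distrib, Finset.sum_sub_distrib]
    simp only [add_comm N] at e1
    linarith
  have h3 : |N * G n - ∑ r ∈ Finset.range N, (G (n + r) - G r)| ≤ N * (C + 2 * (N * K)) := by
    have e : N * G n = ∑ _r ∈ Finset.range N, G n := by simp
    rw [e, ← Finset.sum_sub_distrib]
    refine (Finset.abs_sum_le_sum_abs _ _).trans ?_
    refine (Finset.sum_le_card_nsmul _ _ (C + 2 * (N * K)) fun r hr => ?_).trans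
      (le_of_eq (by rw [Finset.card_range, nsmul_eq_mul]))
    have hrN : (r : ℝ) ≤ N := by exact_mod_cast (Finset.mem_range.1 hr).le
    have hrK : r * K ≤ N * K := mul_le_mul_of_nonneg_right hrN hK0
    have h4 := abs_le.1 (hadd n r)
    have h5 := h.abs_log_le ht (trunc (shift^[n] j) r)
    have h6 := h.abs_log_le ht (trunc j r)
    rw [length_trunc] at h5 h6
    have h5' := abs_le.1 h5
    have h6' := abs_le.1 h6
    simp only [← hK] at h5' h6'
    have hGr : G r = Real.log (φ t (trunc j r)) := rfl
    rw [abs_le]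
    constructor <;> linarith
  rw [h2] at h1
  have h7 := abs_le.1 h1
  have h8 := abs_le.1 h3
  rw [abs_le]
  constructor <;> simp only [hG] at h7 h8 ⊢ <;> linarith

/-- Almost sure convergence of the exponential rates of `φ^t(j|_n)`. -/
theorem exists_ae_tendsto_log (h : QuasiPotential φ d D α) {μ : Measure (ℕ → Fin m)}
    [IsProbabilityMeasure μ] (hμ : Ergodic (shift (m := m)) μ) {t : ℝ} (ht : 0 ≤ t) :
    ∃ L : ℝ, ∀ᵐ j ∂μ, Tendsto (fun n : ℕ => Real.log (φ t (trunc j n)) / n) atTop (𝓝 L) := by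
  set C := -Real.log D with hC
  have hC0 : 0 ≤ C := by
    have := Real.log_neg h.const_pos h.const_lt_one
    linarith
  let I : ℕ → ℝ := fun N => ∫ i, Real.log (φ t (trunc i N)) ∂μ
  -- In C + 2, C is the defect of additivity, one unit is the Birkhoff error with ε = 1, and one
  -- absorbs the bounded term A once n ≥ A.
  have hev : ∀ N : ℕ, ∀ᵐ j ∂μ, 0 < N → ∀ᶠ n : ℕ in atTop,
      |Real.log (φ t (trunc j n)) / n - I N / N| ≤ (C + 2) / N := by
    intro N
    have hB := ae_birkhoffSum_sub_le hμ
      (measurable_comp_trunc (fun w => Real.log (φ t w)) N) (K := N * (t * -Real.log α))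
      (fun i => by simpa using h.abs_log_le ht (trunc i N)) one_pos
    filter_upwards [hB] with j ⟨B, hB⟩ hN
    have hN' : (0 : ℝ) < N := by exact_mod_cast hN
    set A := N * (C + 2 * (N * (t * -Real.log α))) + B with hA
    obtain ⟨n₀, hn₀⟩ := exists_nat_ge A
    filter_upwards [eventually_ge_atTop n₀, eventually_gt_atTop 0] with n hn hn0
    have hn' : (0 : ℝ) < n := by exact_mod_cast hn0
    have hAn : A ≤ n := hn₀.trans (by exact_mod_cast hn)
    have h1 := abs_le.1 (h.abs_mul_log_sub_birkhoffSum_le ht N j n)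
    have h2 := abs_le.1 (hB n)
    rw [← hC] at h1
    have h3 : |N * Real.log (φ t (trunc j n)) - n * I N| ≤ (C + 2) * n := by
      rw [abs_le]
      simp only [I]
      constructor <;> linarith
    have h4 : Real.log (φ t (trunc j n)) / n - I N / N =
        (N * Real.log (φ t (trunc j n)) - n * I N) / (n * N) := by
      field_simp
    rw [h4, abs_div, abs_of_pos (mul_pos hn' hN'), div_le_div_iff₀ (mul_pos hn' hN') hN']
    calc _ ≤ (C + 2) * n * N := mul_le_mul_of_nonneg_right h3 hN'.le
      _ = _ := by ring
  have hall := ae_all_iff.2 hev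
  have hsmall : ∀ ε : ℝ, 0 < ε → ∃ N : ℕ, 0 < N ∧ (C + 2) / N < ε := fun ε hε => by
    obtain ⟨N, hN⟩ := exists_nat_gt ((C + 2) / ε)
    have hN0 : (0 : ℝ) < N := lt_of_le_of_lt (by positivity) hN
    refine ⟨N, by exact_mod_cast hN0, ?_⟩
    rwa [div_lt_iff₀ hN0, mul_comm, ← div_lt_iff₀ hε]
  -- One typical point defines L; every other typical point is compared with it through the numbers
  -- I N / N, which do not depend on the point.
  obtain ⟨j₀, hj₀⟩ := hall.exists
  have hcau : CauchySeq fun n : ℕ => Real.log (φ t (trunc j₀ n)) / n := by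
    refine Metric.cauchySeq_iff'.2 fun ε hε => ?_
    obtain ⟨N, hN, hNε⟩ := hsmall (ε / 2) (by linarith)
    obtain ⟨n₀, hn₀⟩ := eventually_atTop.1 (hj₀ N hN)
    refine ⟨n₀, fun n hn => ?_⟩
    rw [Real.dist_eq]
    have h1 := abs_le.1 (hn₀ n hn)
    have h2 := abs_le.1 (hn₀ n₀ le_rfl)
    rw [abs_lt]
    constructor <;> linarith
  obtain ⟨L, hL⟩ := cauchySeq_tendsto_of_complete hcau
  refine ⟨L, ?_⟩
  filter_upwards [hall] with j hj
  refine Metric.tendsto_atTop.2 fun ε hε => ?_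
  obtain ⟨N, hN, hNε⟩ := hsmall (ε / 2) (by linarith)
  have hL1 : |L - I N / N| ≤ (C + 2) / N :=
    le_of_tendsto (hL.sub_const _).abs (hj₀ N hN)
  obtain ⟨n₀, hn₀⟩ := eventually_atTop.1 (hj N hN)
  refine ⟨n₀, fun n hn => ?_⟩
  rw [Real.dist_eq]
  have h1 := abs_le.1 (hn₀ n hn)
  have h2 := abs_le.1 hL1
  rw [abs_lt]
  constructor <;> linarith

/-- The exponential rates exist simultaneously for all exponents. -/
theorem exists_ae_forall_tendsto_log (h : QuasiPotential φ d D α) {μ : Measure (ℕ → Fin m)}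
    [IsProbabilityMeasure μ] (hμ : Ergodic (shift (m := m)) μ) :
    ∃ L : ℝ → ℝ, ∀ᵐ j ∂μ, ∀ t, 0 ≤ t →
      Tendsto (fun n : ℕ => Real.log (φ t (trunc j n)) / n) atTop (𝓝 (L t)) := by
  -- Integer exponents are countably many, so one null set serves them all; the other exponents
  -- follow by interpolation and scaling.
  choose L hL using fun k : ℕ => h.exists_ae_tendsto_log hμ (Nat.cast_nonneg (α := ℝ) k)
  refine ⟨fun t => if t ≤ d then (1 - Int.fract t) * L ⌊t⌋₊ + Int.fract t * L (⌊t⌋₊ + 1)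
    else t / d * L d, ?_⟩
  filter_upwards [ae_all_iff.2 hL] with j hj t ht
  have hpos : ∀ (k : ℕ) w, 0 < φ k w := fun k w => h.pos k (Nat.cast_nonneg k) w
  by_cases htd : t ≤ d
  · simp only [if_pos htd]
    refine (((hj ⌊t⌋₊).const_mul (1 - Int.fract t)).add
      ((hj (⌊t⌋₊ + 1)).const_mul (Int.fract t))).congr fun n => ?_
    rw [h.interp t ht htd, Real.log_mul (Real.rpow_pos_of_pos (hpos _ _) _).ne'
      (Real.rpow_pos_of_pos (hpos _ _) _).ne', Real.log_rpow (hpos _ _), Real.log_rpow (hpos _ _)]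
    ring
  · simp only [if_neg htd]
    refine ((hj d).const_mul (t / d)).congr fun n => ?_
    rw [h.scale t (not_le.1 htd), Real.log_rpow (hpos _ _)]
    ring

/-- Along targets of at most linear length, the exponential rate is governed by that of the
target point. -/
theorem tendsto_wordRate_sub (h : QuasiPotential φ d D α) {ℓ : ℕ → ℕ} {j : ℕ → Fin m} {t : ℝ}
    (ht : 0 ≤ t) {L B : ℝ} (hB0 : 0 ≤ B)
    (hL : Tendsto (fun n : ℕ => Real.log (φ t (trunc j n)) / n) atTop (𝓝 L))
    (hB : ∀ᶠ k : ℕ in atTop, (ℓ k : ℝ) ≤ B * k) :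
    Tendsto (fun k : ℕ => wordRate φ ℓ j t k - (ℓ k / k : ℝ) * L) atTop (𝓝 0) := by
  -- The estimate must hold for all n, small ones included, because ℓ_k need not tend to infinity.
  have happrox : ∀ ε : ℝ, 0 < ε → ∃ A : ℝ, ∀ n : ℕ,
      |Real.log (φ t (trunc j n)) - n * L| ≤ ε * n + A := fun ε hε => by
    obtain ⟨n₀, hn₀⟩ := Metric.tendsto_atTop.1 hL ε hε
    refine ⟨n₀ * (t * -Real.log α + |L|), fun n => ?_⟩
    have hK0 : 0 ≤ t * -Real.log α :=
      mul_nonneg ht (by linarith [Real.log_neg h.rate_pos h.rate_lt_one])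
    by_cases hn : n₀ ≤ n ∧ 0 < n
    · have hn' : (0 : ℝ) < n := by exact_mod_cast hn.2
      have h1 := (hn₀ n hn.1).le
      rw [Real.dist_eq] at h1
      have h2 : Real.log (φ t (trunc j n)) - n * L =
          n * (Real.log (φ t (trunc j n)) / n - L) := by field_simp
      rw [h2, abs_mul, abs_of_pos hn']
      have h3 := mul_le_mul_of_nonneg_left h1 hn'.le
      have h4 : 0 ≤ n₀ * (t * -Real.log α + |L|) := by positivity
      linarith
    · have hn' : (n : ℝ) ≤ n₀ := by
        have : n ≤ n₀ := by omega
        exact_mod_cast this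
      have h1 := h.abs_log_le ht (trunc j n)
      rw [length_trunc] at h1
      have h2 : |(n : ℝ) * L| = n * |L| := by rw [abs_mul, Nat.abs_cast]
      have h3 := abs_sub (Real.log (φ t (trunc j n))) (n * L)
      have h4 : (n : ℝ) * (t * -Real.log α + |L|) ≤ n₀ * (t * -Real.log α + |L|) :=
        mul_le_mul_of_nonneg_right hn' (by positivity)
      have h5 : 0 ≤ ε * n := by positivity
      linarith
  refine Metric.tendsto_nhds.2 fun ε hε => ?_
  obtain ⟨A, hA⟩ := happrox (ε / (2 * (B + 1))) (by positivity)
  obtain ⟨k₀, hk₀⟩ := exists_nat_gt (2 * A / ε)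
  filter_upwards [hB, eventually_ge_atTop k₀, eventually_gt_atTop 0] with k hkB hk hk0
  have hk' : (0 : ℝ) < k := by exact_mod_cast hk0
  have h1 := hA (ℓ k)
  have h2 : wordRate φ ℓ j t k - (ℓ k / k : ℝ) * L =
      (Real.log (φ t (trunc j (ℓ k))) - ℓ k * L) / k := by
    rw [wordRate]; ring
  rw [dist_zero_right, Real.norm_eq_abs, h2, abs_div, abs_of_pos hk', div_lt_iff₀ hk']
  have h3 : ε / (2 * (B + 1)) * ℓ k ≤ ε / (2 * (B + 1)) * (B * k) :=
    mul_le_mul_of_nonneg_left hkB (by positivity)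
  have h4 : ε / (2 * (B + 1)) * (B * k) ≤ ε / 2 * k := by
    rw [div_mul_eq_mul_div, div_le_iff₀ (by positivity)]
    nlinarith [mul_pos hε hk']
  have h5 : A < ε / 2 * k := by
    have h6 : 2 * A / ε < k := hk₀.trans_le (by exact_mod_cast hk)
    rw [div_lt_iff₀ hε] at h6
    linarith
  linarith

/-- The rate is asymptotically (ℓ_k/k) L, and L ≤ -s log 2 < 0 may be divided out. Hence one
convergent rate determines the relative length of the targets, and with it the rates at all
exponents by the next lemma. -/
theorem tendsto_length_div (h : QuasiPotential φ d D α) {ℓ : ℕ → ℕ} {j : ℕ → Fin m} {s : ℝ}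
    (hs : 0 < s) {L c : ℝ}
    (hL : Tendsto (fun n : ℕ => Real.log (φ s (trunc j n)) / n) atTop (𝓝 L))
    (hc : Tendsto (wordRate φ ℓ j s) atTop (𝓝 c)) :
    Tendsto (fun k : ℕ => (ℓ k / k : ℝ)) atTop (𝓝 (c / L)) := by
  have hl2 : 0 < Real.log 2 := Real.log_pos (by norm_num)
  obtain ⟨B, hB0, hB⟩ := h.exists_length_bound hs hc
  have hLneg : L < 0 := by
    have h1 : L ≤ -(s * Real.log 2) := by
      refine le_of_tendsto hL ?_
      filter_upwards [eventually_gt_atTop 0] with n hn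
      have hn' : (0 : ℝ) < n := by exact_mod_cast hn
      have h2 := h.log_le hs.le (trunc j n)
      rw [length_trunc] at h2
      rw [div_le_iff₀ hn']
      linarith
    have : 0 < s * Real.log 2 := by positivity
    linarith
  have h1 := (hc.sub (h.tendsto_wordRate_sub hs.le hB0 hL hB)).div_const L
  rw [sub_zero] at h1
  refine h1.congr fun k => ?_
  rw [sub_sub_cancel, mul_div_cancel_right₀ _ hLneg.ne]

theorem tendsto_wordRate_of_length (h : QuasiPotential φ d D α) {ℓ : ℕ → ℕ} {j : ℕ → Fin m}
    {t : ℝ} (ht : 0 ≤ t) {L q : ℝ}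
    (hL : Tendsto (fun n : ℕ => Real.log (φ t (trunc j n)) / n) atTop (𝓝 L))
    (hq : Tendsto (fun k : ℕ => (ℓ k / k : ℝ)) atTop (𝓝 q)) :
    Tendsto (wordRate φ ℓ j t) atTop (𝓝 (q * L)) := by
  have hq0 : 0 ≤ q := ge_of_tendsto' hq fun k => by positivity
  have hB : ∀ᶠ k : ℕ in atTop, (ℓ k : ℝ) ≤ (q + 1) * k := by
    filter_upwards [hq.eventually (gt_mem_nhds (show q < q + 1 by linarith)),
      eventually_gt_atTop 0] with k hk hk0
    have hk' : (0 : ℝ) < k := by exact_mod_cast hk0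
    exact ((div_lt_iff₀ hk').1 hk).le
  have h1 := (h.tendsto_wordRate_sub ht (by linarith) hL hB).add (hq.mul_const L)
  rw [zero_add] at h1
  exact h1.congr fun k => by ring

end QuasiPotential

end ShrinkingTargets

/-! ### Assembly of the dimension formulas. -/

namespace ShrinkingTargets

variable {d m : ℕ} {T : Fin m → Space d →ₗ[ℝ] Space d} {D α c : ℝ} {ℓ : ℕ → ℕ} {j : ℕ → Fin m}

/-- A negative pressure bounds the dimension from above. -/
theorem dimH_le_of_targetPressure_lt
    (h : QuasiPotential (fun t w => svf t (wordMap T w)) d D α)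
    (hinj : ∀ i, Function.Injective (T i)) (hc0 : 0 < c) (hc1 : c < 1)
    (hT : ∀ i x, ‖T i x‖ ≤ c * ‖x‖) {s : ℝ} (hs : 0 ≤ s) (hsd : s < d) {ε : ℝ} (hε : 0 < ε)
    (hev : ∀ᶠ k in atTop, targetPressure (fun t w => svf t (wordMap T w)) ℓ j s k < -ε)
    (a : Fin m → Space d) : dimH (proj T a '' recurringSet ℓ j) ≤ ENNReal.ofReal s :=
  dimH_image_recurringSet_le hinj hc0 hc1 hT hs hsd (h.summable_targetSum hs hε hev) a

theorem dimH_le_of_forall_lt {A : Set (Space d)} {s₀ : ℝ} (hd : s₀ < d)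
    (h : ∀ s, s₀ < s → s < d → dimH A ≤ ENNReal.ofReal s) : dimH A ≤ ENNReal.ofReal s₀ := by
  have h1 : Tendsto ENNReal.ofReal (𝓝[>] s₀) (𝓝 (ENNReal.ofReal s₀)) :=
    (ENNReal.continuous_ofReal.tendsto s₀).mono_left nhdsWithin_le_nhds
  refine ge_of_tendsto h1 ?_
  filter_upwards [Ioo_mem_nhdsGT hd] with s hs
  exact h s hs.1 hs.2

theorem dimH_le_dim (A : Set (Space d)) : dimH A ≤ ENNReal.ofReal d := by
  refine (dimH_mono (Set.subset_univ A)).trans (le_of_eq ?_)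
  rw [Real.dimH_univ_eq_finrank, finrank_euclideanSpace_fin, ENNReal.ofReal_natCast]

/-- When all rates of the targets converge, the dimension is almost surely the zero of the
pressure, capped at `d`. -/
theorem exists_pressureZero_and_dimH
    (h : QuasiPotential (fun t w => svf t (wordMap T w)) d D α)
    (hinj : ∀ i, Function.Injective (T i)) (hc0 : 0 < c) (hc1 : c < 1 / 2)
    (hT : ∀ i x, ‖T i x‖ ≤ c * ‖x‖)
    (hrate : ∀ t, 0 ≤ t →
      ∃ r, Tendsto (wordRate (fun t w => svf t (wordMap T w)) ℓ j t) atTop (𝓝 r)) :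
    ∃ s₀ : ℝ, IsUniquePressureZero T ℓ j s₀ ∧ AlmostEveryDimEq T ℓ j (min s₀ d) := by
  obtain ⟨s₀, P, hs₀, hP, hzero, hpos, hneg⟩ := h.exists_unique_zero hrate
  refine ⟨s₀, ⟨hs₀, P, hP, hzero⟩, ?_⟩
  have hd : (0 : ℝ) < d := by exact_mod_cast h.dim_pos
  have hupper : ∀ a, dimH (proj T a '' recurringSet ℓ j) ≤ ENNReal.ofReal (min s₀ d) := fun a => by
    rcases le_or_gt (d : ℝ) s₀ with hds | hds
    · rw [min_eq_right hds]
      exact dimH_le_dim _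
    · rw [min_eq_left hds.le]
      refine dimH_le_of_forall_lt hds fun s hs hsd => ?_
      have hs0 : 0 ≤ s := hs₀.trans hs.le
      have hPs := hneg s hs
      exact dimH_le_of_targetPressure_lt h hinj hc0 (by linarith) hT hs0 hsd
        (show 0 < -(P s / 2) by linarith)
        ((hP s hs0).eventually (gt_mem_nhds (by linarith))) a
  set δ := min s₀ (d : ℝ) with hδ
  rcases (le_min hs₀ hd.le : 0 ≤ δ).eq_or_lt with h0 | h0
  · refine Eventually.of_forall fun a => le_antisymm (hupper a) ?_
    rw [show δ = 0 from h0.symm, ENNReal.ofReal_zero]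
    exact zero_le
  -- A sequence increasing to δ, so that only countably many null sets of translations are
  -- discarded. The Frostman measure is taken at the midpoint of t n and δ, where the pressure is
  -- positive.
  let t : ℕ → ℝ := fun n => δ * (1 - 1 / ((n : ℝ) + 2))
  have hlower : ∀ n, ∀ᵐ a : Fin m → Space d,
      ENNReal.ofReal (t n) ≤ dimH (proj T a '' recurringSet ℓ j) := fun n => by
    have hn : (0 : ℝ) < 1 / ((n : ℝ) + 2) := by positivity
    have hn1 : 1 / ((n : ℝ) + 2) < 1 := by
      rw [div_lt_one (by positivity)]
      linarith [(Nat.cast_nonneg n : (0 : ℝ) ≤ n)]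
    have ht0 : 0 < t n := mul_pos h0 (by linarith)
    have htδ : t n < δ := mul_lt_of_lt_one_right h0 (by linarith)
    have hsδ : (t n + δ) / 2 < δ := by linarith
    have hs0 : 0 ≤ (t n + δ) / 2 := by linarith
    obtain ⟨p, hp⟩ := h.exists_pressure (j 0).pos hs0
    obtain ⟨r, hr⟩ := hrate _ hs0
    have hsum : p + r = P ((t n + δ) / 2) :=
      tendsto_nhds_unique (h.tendsto_targetPressure hs0 hp hr) (hP _ hs0)
    obtain ⟨μ, hμ, hA, C, hC, hball⟩ := h.exists_frostman_measure hs0 hp hr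
      (hsum ▸ hpos _ hs0 (hsδ.trans_le (min_le_left _ _)))
    exact ae_le_dimH h hinj hc0 hc1 hT ht0 (by linarith)
      (hsδ.le.trans (min_le_right _ _)) hC hball hA
  have hlim : Tendsto (fun n => ENNReal.ofReal (t n)) atTop (𝓝 (ENNReal.ofReal δ)) := by
    refine (ENNReal.continuous_ofReal.tendsto δ).comp ?_
    have h1 : Tendsto (fun n : ℕ => 1 / ((n : ℝ) + 2)) atTop (𝓝 0) :=
      tendsto_const_nhds.div_atTop (tendsto_atTop_add_const_right _ _ tendsto_natCast_atTop_atTop)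
    simpa [t] using (h1.const_sub 1).const_mul δ
  filter_upwards [ae_all_iff.2 hlower] with a ha
  exact le_antisymm (hupper a) (le_of_tendsto' hlim ha)

/-- For almost every target the zero of the pressure does not depend on the target. -/
theorem exists_ae_pressureZero_and_dimH
    (h : QuasiPotential (fun t w => svf t (wordMap T w)) d D α)
    (hinj : ∀ i, Function.Injective (T i)) (hc0 : 0 < c) (hc1 : c < 1 / 2)
    (hT : ∀ i x, ‖T i x‖ ≤ c * ‖x‖) {μ : Measure (ℕ → Fin m)} [IsProbabilityMeasure μ]
    (hμ : Ergodic (shift (m := m)) μ) :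
    ∃ s₀ : ℝ, ∀ᵐ j ∂μ,
      (∃ s : ℝ, 0 < s ∧ ∃ r, Tendsto (targetRate T ℓ j s) atTop (𝓝 r)) →
      IsUniquePressureZero T ℓ j s₀ ∧ AlmostEveryDimEq T ℓ j (min s₀ d) := by
  obtain ⟨L, hL⟩ := h.exists_ae_forall_tendsto_log hμ
  -- This dichotomy does not involve j, which is why one s₀ can serve almost every target.
  by_cases hq : ∃ q, Tendsto (fun k : ℕ => (ℓ k / k : ℝ)) atTop (𝓝 q)
  · obtain ⟨q, hq⟩ := hq
    have hm : 0 < m := by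
      obtain ⟨j⟩ := nonempty_of_isProbabilityMeasure μ
      exact (j 0).pos
    choose! p hp using fun t ht => h.exists_pressure hm (t := t) ht
    have key : ∀ j, (∀ t, 0 ≤ t → Tendsto (fun n : ℕ =>
        Real.log (svf t (wordMap T (trunc j n))) / n) atTop (𝓝 (L t))) →
        ∃ s₀ : ℝ, (0 ≤ s₀ ∧ p s₀ + q * L s₀ = 0 ∧
          ∀ s, 0 ≤ s → p s + q * L s = 0 → s = s₀) ∧
          IsUniquePressureZero T ℓ j s₀ ∧ AlmostEveryDimEq T ℓ j (min s₀ d) := fun j hj => by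
      have hw : ∀ t, 0 ≤ t → Tendsto (wordRate (fun t w => svf t (wordMap T w)) ℓ j t) atTop
          (𝓝 (q * L t)) := fun t ht => h.tendsto_wordRate_of_length ht (hj t ht) hq
      obtain ⟨s₀, hs₀, hdim⟩ := exists_pressureZero_and_dimH h hinj hc0 hc1 hT
        fun t ht => ⟨_, hw t ht⟩
      obtain ⟨h0, P, hP, hz⟩ := hs₀
      have hPe : ∀ t, 0 ≤ t → P t = p t + q * L t := fun t ht =>
        tendsto_nhds_unique (hP t ht) (h.tendsto_targetPressure ht (hp t ht) (hw t ht))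
      exact ⟨s₀, ⟨h0, (hPe s₀ h0).symm.trans ((hz s₀ h0).2 rfl),
        fun s hs hs' => (hz s hs).1 ((hPe s hs).trans hs')⟩, ⟨h0, P, hP, hz⟩, hdim⟩
    -- For all typical j the pressure is the same function p + q L, so the zero found at one of them
    -- is the zero at every other.
    obtain ⟨j₁, hj₁⟩ := hL.exists
    obtain ⟨s₁, hs₁, -⟩ := key j₁ hj₁
    refine ⟨s₁, ?_⟩
    filter_upwards [hL] with j hj _
    obtain ⟨s₀, hs₀, hres⟩ := key j hj
    rwa [hs₁.2.2 s₀ hs₀.1 hs₀.2.1] at hres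
  · refine ⟨0, ?_⟩
    filter_upwards [hL] with j hj ⟨s, hs, r, hr⟩
    exact absurd ⟨_, h.tendsto_length_div hs (hj s hs.le) hr⟩ hq

/-- When the targets shrink superexponentially the recurring set has dimension zero. -/
theorem dimH_eq_zero_of_tendsto_atBot
    (h : QuasiPotential (fun t w => svf t (wordMap T w)) d D α)
    (hinj : ∀ i, Function.Injective (T i)) (hc0 : 0 < c) (hc1 : c < 1)
    (hT : ∀ i x, ‖T i x‖ ≤ c * ‖x‖)
    (hP : ∀ s : ℝ, 0 < s → Tendsto (pressureSeq T ℓ j s) atTop atBot) (a : Fin m → Space d) :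
    dimH (proj T a '' recurringSet ℓ j) = 0 := by
  have hd : (0 : ℝ) < d := by exact_mod_cast h.dim_pos
  have h1 := dimH_le_of_forall_lt (A := proj T a '' recurringSet ℓ j) hd fun s hs hsd =>
    dimH_le_of_targetPressure_lt h hinj hc0 hc1 hT hs.le hsd one_pos
      ((hP s hs).eventually (eventually_lt_atBot (-1))) a
  rw [ENNReal.ofReal_zero] at h1
  exact le_antisymm h1 zero_le

end ShrinkingTargets

theorem theorem1 {d m : ℕ} (hd : 0 < d)
    (T : Fin m → ShrinkingTargets.Space d →ₗ[ℝ] ShrinkingTargets.Space d)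
    (hbij : ∀ i, Function.Bijective (T i))
    (hhalf : ∀ i, (T i).singularValues 0 < 1 / 2)
    (D : ℝ) (hD0 : 0 < D) (hD1 : D < 1)
    (hquasi : ∀ t : ℝ, 0 ≤ t → t ≤ d → ∀ w w' : List (Fin m),
      D * ShrinkingTargets.svf t (ShrinkingTargets.wordMap T w) *
          ShrinkingTargets.svf t (ShrinkingTargets.wordMap T w') ≤
        ShrinkingTargets.svf t (ShrinkingTargets.wordMap T (w ++ w')))
    (ℓ : ℕ → ℕ) :
    -- almost sure statement, for any ergodic shift-invariant probability measure
    (∀ μ : Measure (ℕ → Fin m), IsProbabilityMeasure μ →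
      Ergodic (ShrinkingTargets.shift (m := m)) μ →
      ∃ s₀ : ℝ, ∀ᵐ j ∂μ,
        (∃ s : ℝ, 0 < s ∧ ∃ c : ℝ,
          Tendsto (ShrinkingTargets.targetRate T ℓ j s) atTop (𝓝 c)) →
        ShrinkingTargets.IsUniquePressureZero T ℓ j s₀ ∧
          ShrinkingTargets.AlmostEveryDimEq T ℓ j (min s₀ d)) ∧
    -- an individual target point, when the limit exists and is finite for every exponent
    (∀ j : ℕ → Fin m,
      (∀ s : ℝ, 0 < s → s ≤ d → ∃ c : ℝ,
        Tendsto (ShrinkingTargets.targetRate T ℓ j s) atTop (𝓝 c)) →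
      ∃ s₀ : ℝ, ShrinkingTargets.IsUniquePressureZero T ℓ j s₀ ∧
        ShrinkingTargets.AlmostEveryDimEq T ℓ j (min s₀ d)) ∧
    -- an individual target point, when the limit is minus infinity for some exponent
    (∀ j : ℕ → Fin m,
      (∃ s : ℝ, 0 < s ∧ Tendsto (ShrinkingTargets.targetRate T ℓ j s) atTop atBot) →
      (∀ s : ℝ, 0 < s → Tendsto (ShrinkingTargets.pressureSeq T ℓ j s) atTop atBot) ∧
        ∀ a : Fin m → ShrinkingTargets.Space d,
          dimH (ShrinkingTargets.proj T a '' ShrinkingTargets.recurringSet ℓ j) = 0) := by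
  have hinj : ∀ i, Function.Injective (T i) := fun i => (hbij i).1
  obtain ⟨c, hc0, hc1, hT⟩ := ShrinkingTargets.exists_contraction_bound hhalf
  obtain ⟨α, h⟩ := ShrinkingTargets.exists_quasiPotential hd hbij hhalf hD0 hD1 hquasi
  refine ⟨fun μ hμ herg => ?_, fun j hj => ?_, fun j ⟨s, hs, hrate⟩ => ?_⟩
  · exact ShrinkingTargets.exists_ae_pressureZero_and_dimH h hinj hc0 hc1 hT herg
  · exact ShrinkingTargets.exists_pressureZero_and_dimH h hinj hc0 hc1 hT
      (h.exists_tendsto_wordRate hj)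
  -- By definition `pressureSeq` is `targetPressure` for the potential φ^t(T_w).
  · have hP : ∀ s : ℝ, 0 < s →
        Tendsto (ShrinkingTargets.pressureSeq T ℓ j s) atTop atBot :=
      fun t ht => h.tendsto_targetPressure_atBot hs hrate ht
    exact ⟨hP, ShrinkingTargets.dimH_eq_zero_of_tendsto_atBot h hinj hc0 (by linarith) hT hP⟩
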